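/- **Setting.** Let $W$ be the Weyl group of a symmetrizable Kac–Moody root datum with Dynkin node set $I$, weight lattice $\Lambda$, linearly independent simple roots $\alpha_i$ and simple coroots $\alpha_i^\vee$; $W$ is generated by the simple reflections $s_i$ and carries the length $\ell$ and the Bruhat order $\le$. Let $\lambda\in\Lambda$ be dominant with stabilizer $W_\lambda$, and order $W/W_\lambda$ by the Bruhat order of minimum length coset representatives. For $v\in W$ and $\tau\in W/W_\lambda$ with $vW_\lambda\le\tau$, the Deodhar lift $\mathrm{up}(v,\tau)$ is the Bruhat minimum of $\{w\in W\mid v\le w,\ wW_\lambda=\tau\}$. For $b\in\mathbb Q$, the $b$-Bruhat order $\le_b$ on $W$ is generated by the Bruhat covers $v\lessdot vs_\alpha$ with $\alpha$ a real coroot and $b\langle\alpha,\lambda\rangle\in\mathbb Z$; it is carried to $W/W_\lambda$ by minimum length representatives. An LS path $p$ of shape $\lambda$ is a sequence of vectors $a_1\sigma_1\lambda,\dots,a_m\sigma_m\lambda$ with $m\ge1$, positive rationals $a_k$ of sum $1$, and $\sigma_k\in W/W_\lambda$ such that $\sigma_{k+1}<_{b}\sigma_k$ for $b=a_{k+1}+\dots+a_m$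 ($1\le k<m$). Its final direction is $\phi(p)=\sigma_m$. If $zW_\lambda\le\phi(p)$, then $\mathrm{up}(z,p):=w_1$, where $w_{m+1}=z$ and $w_k=\mathrm{up}(w_{k+1},\sigma_k)$ for $k=m,\dots,1$. The crystal operator $f_i$ is the root operator: after cutting vectors, write $p$ as the concatenation of $A,B,C$, where the end of $A$ is the last time at which the $i$-height $\langle\alpha_i^\vee,\cdot\rangle$ along the path attains its minimum, all vectors of $B$ have positive $i$-height, and the total $i$-height of $B$ is $1$; then $f_i(p)$ is obtained by replacing each direction $\sigma$ in $B$ by $s_i\sigma$ (it is undefined if there is no such $B$). An $i$-string is a connected component of the graph with edges $p\to f_i(p)$ on the set of LS paths of shape $\lambda$; it is a finite directed path. Fix $i$, put $s=s_i$, and let $S$ be an $i$-string with head (source) $h$, tail (sink) $t$ and middle $m=S\setminus\{h,t\}$. For $u,v\in W$ let $P_{u,v}(S)=\{p\in S\mid \phi(p)\ge vW_\lambda,\ \mathrm{up}(v,p)=u\}$. **Proposition.** Let $z\in W$ satisfy $sz>z$ and $zW_\lambda\le\phi(h)$. Then $w:=\mathrm{up}(z,h)$ exists, $sw>w$, and for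 all $p\in S$ we have $\phi(p)\ge zW_\lambda$ and $\mathrm{up}(z,p)\in\{w,sw\}$. Consider the conditions 1. for all $p\in S$: $\phi(p)\ge szW_\lambda$ and $\mathrm{up}(sz,p)\in\{w,sw\}$; 2. $\phi(t)\ge szW_\lambda$, $\mathrm{up}(sz,t)\in\{w,sw\}$, and $\phi(p)\not\ge szW_\lambda$ for all $p\in S\setminus\{t\}$; 3. for some $\tilde w\in W$ with $\tilde w\notin\{w,sw\}$ and $s\tilde w>\tilde w$: $\phi(p)\ge szW_\lambda$ for all $p\in S$, $\mathrm{up}(sz,t)\in\{w,sw\}$, and $\mathrm{up}(sz,p)\in\{\tilde w,s\tilde w\}$ for all $p\in S\setminus\{t\}$. If $|S|\ge2$, exactly one of 1, 2, 3 holds. If $|S|=1$, then 1 and 2 both hold (they coincide). Moreover, for every $x\in W$ with $sx>x$, either $P_{x,z}(S)$, $P_{sx,z}(S)$, $P_{x,sz}(S)$, $P_{sx,sz}(S)$ are all empty, or exactly one of the following eight cases holds (and these alternatives exclude each other): $$\begin{array}{|c|c|c|c|c|c|}\hline \text{Case}&P_{x,z}(S)&P_{sx,z}(S)&P_{x,sz}(S)&P_{sx,sz}(S)&|S|\\\hline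 U.1.1&S&\emptyset&\{t\}&\emptyset&\ge1\\ U.1.2&S&\emptyset&S&\emptyset&\ge2\\ U.1.3&S&\emptyset&\{h,t\}&m&\ge3\\ U.2.1&\{h\}&S\setminus\{h\}&\emptyset&\{t\}&\ge1\\ U.2.2&\{h\}&S\setminus\{h\}&\{h\}&S\setminus\{h\}&\ge2\\ U.2.3&\{h\}&S\setminus\{h\}&S\setminus\{t\}&\{t\}&\ge3\\ U.3.1&\emptyset&\emptyset&S\setminus\{t\}&\emptyset&\ge2\\ U.3.2&\emptyset&\emptyset&\{h\}&m&\ge3\\\hline \end{array}$$ If $|S|=1$, then U.1.1 or U.2.1 holds for $x=w$. If $|S|\ge2$, then: condition 1 holds if and only if one of U.1.2, U.1.3, U.2.2, U.2.3 holds for $x=w$; condition 2 or 3 holds if and only if U.1.1 or U.2.1 holds for $x=w$; and, for $x\in W$ with $sx>x$, condition 3 holds with $\tilde w=x$ if and only if U.3.1 or U.3.2 holds for $x$. -/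

import Mathlib

namespace KacMoody

/-- The root datum of a symmetrizable Kac-Moody algebra with Dynkin node set `I` and weight
lattice `Λ`: linearly independent simple roots in `Λ` and simple coroots in the dual of `Λ`,
such that `(⟨αᵢ^∨, αⱼ⟩)ᵢⱼ` is a symmetrizable generalized Cartan matrix. -/
structure RootDatum (I Λ : Type*) [AddCommGroup Λ] where
  root : I → Λ
  coroot : I → Module.Dual ℤ Λ
  pairing_self : ∀ i, coroot i (root i) = 2
  pairing_nonpos : ∀ i j, i ≠ j → coroot i (root j) ≤ 0
  pairing_zero : ∀ i j, coroot i (root j) = 0 → coroot j (root i) = 0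
  symmetrizable : ∃ d : I → ℚ, (∀ i, 0 < d i) ∧
    ∀ i j, d i * (coroot i (root j) : ℚ) = d j * (coroot j (root i) : ℚ)
  root_linearIndependent : LinearIndependent ℤ root
  coroot_linearIndependent : LinearIndependent ℤ coroot

namespace RootDatum

variable {I Λ : Type*} [AddCommGroup Λ] (D : RootDatum I Λ)

/-- The Weyl group: the group of automorphisms of the weight lattice generated by the simple
reflections `x ↦ x - ⟨αᵢ^∨, x⟩ αᵢ`. -/
abbrev W : Subgroup (Λ ≃ₗ[ℤ] Λ) :=
  Subgroup.closure (Set.range fun i => Module.reflection (D.pairing_self i))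

/-- The simple reflection `sᵢ`, as an element of the Weyl group. -/
def s (i : I) : D.W :=
  ⟨Module.reflection (D.pairing_self i), Subgroup.subset_closure ⟨i, rfl⟩⟩

/-- The length of `w`: the least number of factors in a product of simple reflections equal
to `w`. -/
noncomputable def length (w : D.W) : ℕ :=
  sInf {n | ∃ ω : List I, ω.length = n ∧ (ω.map D.s).prod = w}

/-- A cover `v ⋖ w` in the Bruhat order: `ℓ(w) = ℓ(v) + 1` and `w = v r` with `r` a reflection,
that is, a conjugate of a simple reflection. -/
def Covers (v w : D.W) : Prop :=
  D.length w = D.length v + 1 ∧ ∃ (u : D.W) (j : I), w = v * (u * D.s j * u⁻¹)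

/-- The (strong) Bruhat order on the Weyl group. -/
def Le : D.W → D.W → Prop := Relation.ReflTransGen D.Covers

/-- The strict Bruhat order on the Weyl group. -/
def Lt (v w : D.W) : Prop := D.Le v w ∧ v ≠ w

/-- Dominant weights. -/
def IsDominant (lam : Λ) : Prop := ∀ i, 0 ≤ D.coroot i lam

/-- The coset space `W / W_λ`, where `W_λ` is the stabilizer of `λ`. -/
abbrev Cosets (lam : Λ) : Type _ := D.W ⧸ MulAction.stabilizer D.W lam

variable (lam : Λ)

/-- The coset `w W_λ`. -/
abbrev coset (w : D.W) : D.Cosets lam := (w : D.W ⧸ MulAction.stabilizer D.W lam)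

/-- `w` is of minimum length in its coset `w W_λ`. -/
def IsMinRep (w : D.W) : Prop := ∀ v : D.W, D.coset lam v = D.coset lam w → D.length w ≤ D.length v

/-- The Bruhat order on `W / W_λ`, transported from the minimum length coset representatives. -/
def CosetLe (σ τ : D.Cosets lam) : Prop :=
  ∃ v w : D.W, D.IsMinRep lam v ∧ D.IsMinRep lam w ∧
    D.coset lam v = σ ∧ D.coset lam w = τ ∧ D.Le v w

/-- A cover `v ⋖ w = v s_α` in the `b`-Bruhat order on `W`: the coroot `α = u αⱼ^∨` satisfies
`b ⟨α, λ⟩ ∈ ℤ`. Here `s_α = u sⱼ u⁻¹` and `⟨α, λ⟩ = ⟨αⱼ^∨, u⁻¹ λ⟩`; replacing `α` by `-α` does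
not matter. -/
def BCovers (b : ℚ) (v w : D.W) : Prop :=
  D.length w = D.length v + 1 ∧ ∃ (u : D.W) (j : I), w = v * (u * D.s j * u⁻¹) ∧
    ∃ n : ℤ, b * (D.coroot j (u⁻¹ • lam) : ℚ) = n

/-- The `b`-Bruhat order on `W`. -/
def BLe (b : ℚ) : D.W → D.W → Prop := Relation.ReflTransGen (D.BCovers lam b)

/-- The strict `b`-Bruhat order on `W / W_λ`, through minimum length coset representatives. -/
def CosetBLt (b : ℚ) (σ τ : D.Cosets lam) : Prop :=
  σ ≠ τ ∧ ∃ v w : D.W, D.IsMinRep lam v ∧ D.IsMinRep lam w ∧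
    D.coset lam v = σ ∧ D.coset lam w = τ ∧ D.BLe lam b v w

/-- `IsUp lam v τ w` says that the Deodhar lift `up(v, τ)` exists and equals `w`: `w` is the Bruhat
minimum of the set of all `w'` with `v ≤ w'` and `w' W_λ = τ`. -/
def IsUp (v : D.W) (τ : D.Cosets lam) (w : D.W) : Prop :=
  (D.Le v w ∧ D.coset lam w = τ) ∧ ∀ w' : D.W, D.Le v w' → D.coset lam w' = τ → D.Le w w'

/-- A step of a path: the pair `(a, σ)` stands for the vector `a σ·λ`, of direction `σ`. -/
abbrev Step : Type _ := ℚ × D.Cosets lam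

/-- The LS paths of shape `λ`. The path with `steps = [(a₁, σ₁), …, (aₘ, σₘ)]` consists of the
vectors `a₁ σ₁λ, …, aₘ σₘλ`, in this order. The `aₖ` are positive rationals with sum `1`, and
`σₖ₊₁ <_b σₖ` in the `b`-Bruhat order with `b = aₖ₊₁ + ⋯ + aₘ`. -/
structure LSPath where
  steps : List (D.Step lam)
  pos : ∀ x ∈ steps, 0 < x.1
  sum_eq_one : (steps.map Prod.fst).sum = 1
  chain : ∀ (L₁ : List (D.Step lam)) (x y : D.Step lam) (L₂ : List (D.Step lam)),
    steps = L₁ ++ x :: y :: L₂ →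
      D.CosetBLt lam (((y :: L₂).map Prod.fst).sum) y.2 x.2

variable {D lam}

theorem LSPath.steps_ne_nil (p : D.LSPath lam) : p.steps ≠ [] := by
  intro h
  have := p.sum_eq_one
  simp [h] at this

/-- The final direction `φ(p)`. -/
def LSPath.final (p : D.LSPath lam) : D.Cosets lam := (p.steps.getLast p.steps_ne_nil).2

/-- `IsLiftList z [(a₁, σ₁), …, (aₘ, σₘ)] w` says that there are `wₘ₊₁ = z, wₘ, …, w₁ = w` with
`wₖ = up(wₖ₊₁, σₖ)` for `k = m, …, 1`. -/
def IsLiftList (z : D.W) : List (D.Step lam) → D.W → Prop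
  | [], w => w = z
  | x :: L, w => ∃ v, IsLiftList z L v ∧ D.IsUp lam v x.2 w

/-- `p.IsLift z w` says that `up(z, p)` is defined, which includes `z W_λ ≤ φ(p)`, and equals `w`.
So `{p | p.IsLift z w}` is the set of the LS paths `p` with `φ(p) ≥ z W_λ` and `up(z, p) = w`. -/
def LSPath.IsLift (p : D.LSPath lam) (z w : D.W) : Prop :=
  D.CosetLe lam (D.coset lam z) p.final ∧ IsLiftList z p.steps w

/-- The `i`-height `⟨αᵢ^∨, v⟩` of the vector `v = a σ·λ` of a step. -/
def stepHeight (i : I) (x : D.Step lam) : ℚ :=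
  x.1 * (D.coroot i (MulAction.ofQuotientStabilizer D.W lam x.2) : ℚ)

/-- The total `i`-height of a sequence of steps. -/
def height (i : I) (L : List (D.Step lam)) : ℚ := (L.map (stepHeight i)).sum

/-- `L` is obtained from `K` by cutting every step of `K` into one or more pieces of the same
direction (of positive length). Then `L` and `K` describe the same piecewise-linear path. -/
def IsCut (L K : List (D.Step lam)) : Prop :=
  ∃ blocks : List (List (D.Step lam)), L = blocks.flatten ∧
    List.Forall₂ (fun block x => (∀ y ∈ block, 0 < y.1 ∧ y.2 = x.2) ∧
      block ≠ [] ∧ (block.map Prod.fst).sum = x.1) blocks K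

/-- The arrow `p → q` of colour `i` of the crystal graph, that is, `q = fᵢ p`. After cutting steps,
the path `p` is `A` followed by `B` followed by `C`, where
* the end of `A` is the last time at which the `i`-height of the path (measured from its start)
  attains its minimum, and
* along `B` the `i`-height rises by exactly `1`, every step of `B` having positive `i`-height;

and `q` is obtained from `p` by replacing every direction `σ` in `B` by `sᵢ σ`. -/
def Arrow (i : I) (p q : D.LSPath lam) : Prop :=
  ∃ A B C : List (D.Step lam),
    IsCut (A ++ B ++ C) p.steps ∧
    IsCut (A ++ B.map (fun x => (x.1, D.s i • x.2)) ++ C) q.steps ∧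
    (∀ X, X <+: A → height i A ≤ height i X) ∧
    (∀ X, X <+: B ++ C → X ≠ [] → 0 < height i X) ∧
    (∀ x ∈ B, 0 < stepHeight i x) ∧ height i B = 1

/-- An `i`-string: a connected component of the graph formed by the arrows of colour `i`. -/
def IsString (i : I) (S : Set (D.LSPath lam)) : Prop :=
  ∃ p, S = {q | Relation.EqvGen (Arrow i) p q}

/-- `h` is the head (source) of the `i`-string `S`. -/
def IsHead (i : I) (S : Set (D.LSPath lam)) (h : D.LSPath lam) : Prop :=
  h ∈ S ∧ ∀ p, ¬ Arrow i p h

/-- `t` is the tail (sink) of the `i`-string `S`. -/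
def IsTail (i : I) (S : Set (D.LSPath lam)) (t : D.LSPath lam) : Prop :=
  t ∈ S ∧ ∀ p, ¬ Arrow i t p

/-- The set `P_{w,z}(S)` of all `p ∈ S` with `φ(p) ≥ z W_λ` and `up(z, p) = w`. -/
def upSet (S : Set (D.LSPath lam)) (w z : D.W) : Set (D.LSPath lam) := {p ∈ S | p.IsLift z w}

/-- The names of the eight columns of the chart. -/
inductive UCase
  | U11 | U12 | U13 | U21 | U22 | U23 | U31 | U32

/-- The column `c` of the chart describes the sets `P_{x,z}(S)`, `P_{sx,z}(S)`, `P_{x,sz}(S)`,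
`P_{sx,sz}(S)`, where `s = sᵢ`, `h` is the head, and `t` is the tail of `S`. -/
def InCase (i : I) (S : Set (D.LSPath lam)) (h t : D.LSPath lam) (z x : D.W) (c : UCase) : Prop :=
  let P := upSet S x z
  let P' := upSet S (D.s i * x) z
  let Q := upSet S x (D.s i * z)
  let Q' := upSet S (D.s i * x) (D.s i * z)
  let m := S \ {h, t}
  match c with
  | .U11 => P = S ∧ P' = ∅ ∧ Q = {t} ∧ Q' = ∅ ∧ 1 ≤ S.encard
  | .U12 => P = S ∧ P' = ∅ ∧ Q = S ∧ Q' = ∅ ∧ 2 ≤ S.encard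
  | .U13 => P = S ∧ P' = ∅ ∧ Q = {h, t} ∧ Q' = m ∧ 3 ≤ S.encard
  | .U21 => P = {h} ∧ P' = S \ {h} ∧ Q = ∅ ∧ Q' = {t} ∧ 1 ≤ S.encard
  | .U22 => P = {h} ∧ P' = S \ {h} ∧ Q = {h} ∧ Q' = S \ {h} ∧ 2 ≤ S.encard
  | .U23 => P = {h} ∧ P' = S \ {h} ∧ Q = S \ {t} ∧ Q' = {t} ∧ 3 ≤ S.encard
  | .U31 => P = ∅ ∧ P' = ∅ ∧ Q = S \ {t} ∧ Q' = ∅ ∧ 2 ≤ S.encard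
  | .U32 => P = ∅ ∧ P' = ∅ ∧ Q = {h} ∧ Q' = m ∧ 3 ≤ S.encard

/-- All four sets `P_{x,z}(S)`, `P_{sx,z}(S)`, `P_{x,sz}(S)`, `P_{sx,sz}(S)` are empty. -/
def AllEmpty (i : I) (S : Set (D.LSPath lam)) (z x : D.W) : Prop :=
  upSet S x z = ∅ ∧ upSet S (D.s i * x) z = ∅ ∧
    upSet S x (D.s i * z) = ∅ ∧ upSet S (D.s i * x) (D.s i * z) = ∅

/-- `up(z, p)` is defined and belongs to `{w, sᵢ w}`. -/
def LiftMem (i : I) (p : D.LSPath lam) (z w : D.W) : Prop :=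
  p.IsLift z w ∨ p.IsLift z (D.s i * w)

/-- `φ(p) ≥ s z W_λ` for all `p ∈ S`, and `up(sz, p) ∈ {w, sw}` for all `p ∈ S`. -/
def Lift1 (i : I) (S : Set (D.LSPath lam)) (z w : D.W) : Prop :=
  ∀ p ∈ S, LiftMem i p (D.s i * z) w

/-- `φ(t) ≥ s z W_λ`, `up(sz, t) ∈ {w, sw}`, and `φ(p) ≱ s z W_λ` for all `p ∈ S \ {t}`. -/
def Lift2 (i : I) (S : Set (D.LSPath lam)) (t : D.LSPath lam) (z w : D.W) : Prop :=
  LiftMem i t (D.s i * z) w ∧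
    ∀ p ∈ S \ {t}, ¬ D.CosetLe lam (D.coset lam (D.s i * z)) p.final

/-- `φ(p) ≥ s z W_λ` for all `p ∈ S`, `up(sz, t) ∈ {w, sw}`, and `up(sz, p) ∈ {w', sw'}` for all
`p ∈ S \ {t}`, where `w' ∉ {w, sw}` and `sw' > w'`. -/
def Lift3 (i : I) (S : Set (D.LSPath lam)) (t : D.LSPath lam) (z w w' : D.W) : Prop :=
  w' ≠ w ∧ w' ≠ D.s i * w ∧ D.Lt w' (D.s i * w') ∧
    LiftMem i t (D.s i * z) w ∧ ∀ p ∈ S \ {t}, LiftMem i p (D.s i * z) w'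

end RootDatum

end KacMoody

/-! The lift `up(v, p)` is computed from the last step of `p` back to the first. For one direction
`τ` and an ascent `v` (meaning `v < sv`), the sign of `⟨αᵢ^∨, τλ⟩` decides how the lift interacts
with `s`. If it is positive, the lift `w` is an ascent and the lift to `sτ` is `sw`
(`isUp_s_smul_iff`). If it is negative, `v` and `sv` have the same lift (`isUp_s_mul_iff_of_neg`).
If it is zero, the lift `w` of `v` is again an ascent, and `sv` lifts to `w` or `sw` (`IsUp.asc`,
`IsUp.exists_s_mul`). All three come from the lifting property of the Bruhat order.

Let `fᵢ` reflect the block `B` of a path `A, B, C`. When the lift along `C` is an ascent, reflecting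
`B` multiplies the lift along `B, C` by `s`. If the last step of nonzero height in `A` is negative,
it absorbs this factor and the lift of the whole path does not change. Otherwise `A` has only steps
of height zero, which happens only if the path is the head, because every other path of the string
has negative minimum. So the lift of `z` is `w` at the head and a constant `e ∈ {w, sw}` elsewhere.
The same argument works for `sz`, except for the arrow into the tail, where `C` may have height zero
throughout. At a tail distinct from the head, the last step of nonzero height is negative, so `z`
and `sz` have the same lift `e` there. On the other paths the lift of `sz` either exists nowhere, or
is an ascent `y` at the head and a constant `e' ∈ {y, sy}` in the middle. This is `LiftPattern`. The
three conditions and the chart then depend only on the existence of `y`, the equalities `y = w`, `e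
= w`, `e' = y`, and on whether the middle is empty.

The argument needs heads to have nonnegative heights and tails to end at their minimum, hence the
existence of `fᵢ p` and `eᵢ p` (`exists_arrow_from`, `exists_arrow_to`). These rest on the
integrality of local minima, which is what the `b`-Bruhat order provides. It also needs strings to
be directed paths (`Arrow.unique_right`, `Arrow.unique_left`). The Weyl group facts used are built
from positivity of roots and the strong exchange property. -/

namespace KacMoody

namespace RootDatum

open Finsupp

/-! ### Words, length and roots in the Weyl group. -/

section Weyl

variable {I Λ : Type*} [AddCommGroup Λ] (D : RootDatum I Λ)

theorem s_smul (i : I) (x : Λ) : D.s i • x = x - D.coroot i x • D.root i :=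
  Module.reflection_apply x (D.pairing_self i)

theorem s_mul_self (i : I) : D.s i * D.s i = 1 := by
  apply Subtype.ext
  ext x
  exact Module.involutive_reflection (D.pairing_self i) x

theorem s_inv (i : I) : (D.s i)⁻¹ = D.s i :=
  inv_eq_of_mul_eq_one_left (D.s_mul_self i)

theorem s_mul_cancel (i : I) (w : D.W) : D.s i * (D.s i * w) = w := by
  rw [← mul_assoc, s_mul_self, one_mul]

theorem mul_s_cancel (i : I) (w : D.W) : w * D.s i * D.s i = w := by
  rw [mul_assoc, s_mul_self, mul_one]

theorem s_smul_root (i : I) : D.s i • D.root i = -D.root i := by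
  rw [s_smul, pairing_self]; module

theorem weyl_ext {v w : D.W} (h : ∀ x : Λ, v • x = w • x) : v = w :=
  Subtype.ext (LinearEquiv.ext h)

theorem exists_word (w : D.W) : ∃ ω : List I, (ω.map D.s).prod = w := by
  obtain ⟨w, hw⟩ := w
  induction hw using Subgroup.closure_induction with
  | mem x hx =>
    obtain ⟨i, rfl⟩ := hx
    exact ⟨[i], by simp [s]⟩
  | one => exact ⟨[], rfl⟩
  | mul x y hx hy ihx ihy =>
    obtain ⟨a, ha⟩ := ihx
    obtain ⟨b, hb⟩ := ihy
    refine ⟨a ++ b, ?_⟩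
    rw [List.map_append, List.prod_append, ha, hb]
    rfl
  | inv x hx ih =>
    obtain ⟨a, ha⟩ := ih
    refine ⟨a.reverse, ?_⟩
    have : (((a.map D.s).prod)⁻¹ : D.W) = (a.reverse.map D.s).prod := by
      rw [List.prod_inv_reverse, List.map_map, List.map_reverse]
      congr 2
    rw [← this, ha]
    rfl

theorem weyl_induction {P : D.W → Prop} (one : P 1) (mul : ∀ i w, P w → P (D.s i * w))
    (w : D.W) : P w := by
  obtain ⟨ω, rfl⟩ := D.exists_word w
  induction ω with
  | nil => exact one
  | cons i ω ih => simpa using mul i _ ih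

/-! ### The length function -/

theorem exists_reduced_word (w : D.W) :
    ∃ ω : List I, ω.length = D.length w ∧ (ω.map D.s).prod = w :=
  Nat.sInf_mem (s := {n | ∃ ω : List I, ω.length = n ∧ (ω.map D.s).prod = w})
    (by obtain ⟨ω, h⟩ := D.exists_word w; exact ⟨_, ω, rfl, h⟩)

theorem length_prod_le (ω : List I) : D.length (ω.map D.s).prod ≤ ω.length :=
  Nat.sInf_le ⟨ω, rfl, rfl⟩

theorem length_mul_le (v w : D.W) : D.length (v * w) ≤ D.length v + D.length w := by
  obtain ⟨a, ha, rfl⟩ := D.exists_reduced_word v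
  obtain ⟨b, hb, rfl⟩ := D.exists_reduced_word w
  rw [← List.prod_append, ← List.map_append, ← ha, ← hb, ← List.length_append]
  exact D.length_prod_le _

theorem length_one : D.length 1 = 0 := Nat.le_zero.1 (D.length_prod_le [])

theorem length_s_le (i : I) : D.length (D.s i) ≤ 1 := by
  simpa using D.length_prod_le [i]

theorem length_inv_le (w : D.W) : D.length w⁻¹ ≤ D.length w := by
  obtain ⟨a, ha, hw⟩ := D.exists_reduced_word w
  have : w⁻¹ = (a.reverse.map D.s).prod := by
    rw [← hw, List.prod_inv_reverse, List.map_map, List.map_reverse]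
    congr 2
  rw [this, ← ha, ← List.length_reverse]
  exact D.length_prod_le _

theorem length_inv (w : D.W) : D.length w⁻¹ = D.length w :=
  le_antisymm (D.length_inv_le w) (by simpa using D.length_inv_le w⁻¹)

theorem length_mul_s_le (w : D.W) (i : I) : D.length (w * D.s i) ≤ D.length w + 1 :=
  (D.length_mul_le _ _).trans (by have := D.length_s_le i; omega)

theorem length_le_mul_s (w : D.W) (i : I) : D.length w ≤ D.length (w * D.s i) + 1 := by
  simpa [mul_s_cancel] using D.length_mul_s_le (w * D.s i) i

theorem eq_one_of_length {w : D.W} (h : D.length w = 0) : w = 1 := by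
  obtain ⟨a, ha, rfl⟩ := D.exists_reduced_word w
  rw [h, List.length_eq_zero_iff] at ha
  simp [ha]

theorem exists_mul_s_length_lt {w : D.W} (h : w ≠ 1) :
    ∃ i, D.length (w * D.s i) < D.length w := by
  obtain ⟨a, ha, hw⟩ := D.exists_reduced_word w
  rcases List.eq_nil_or_concat a with rfl | ⟨b, i, rfl⟩
  · exact absurd hw.symm (by simpa using h)
  · refine ⟨i, ?_⟩
    have : w * D.s i = (b.map D.s).prod := by
      rw [← hw, List.map_concat, List.concat_eq_append, List.prod_append]
      simp [mul_s_cancel]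
    rw [this, ← ha]
    exact (D.length_prod_le b).trans_lt (by simp)

/-! ### Alternating products of two simple reflections -/

/-- The product of `k` simple reflections, alternating between `sᵢ` and `sⱼ` and ending in `sⱼ`. -/
def alt : ℕ → I → I → D.W
  | 0, _, _ => 1
  | k + 1, i, j => alt k j i * D.s j

theorem alt_succ (k : ℕ) (i j : I) : D.alt (k + 1) i j = D.alt k j i * D.s j := rfl

theorem length_alt_le (k : ℕ) (i j : I) : D.length (D.alt k i j) ≤ k := by
  induction k generalizing i j with
  | zero => exact D.length_one.le
  | succ k ih => exact (D.length_mul_s_le _ _).trans (by have := ih j i; omega)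

/-- Splits off the right end of a long alternating product, so that a braid relation can be applied
to it. -/
theorem exists_alt_add (n m : ℕ) (i j : I) :
    ∃ x : D.W, D.length x ≤ n ∧ D.alt (n + m) i j = x * D.alt m i j := by
  induction m generalizing i j with
  | zero => exact ⟨_, D.length_alt_le n i j, by simp [alt]⟩
  | succ m ih =>
    obtain ⟨x, hx, e⟩ := ih j i
    exact ⟨x, hx, by rw [← add_assoc, alt_succ, e, alt_succ, mul_assoc]⟩

/-- Splitting off a maximal alternating product from the right. -/
theorem exists_eq_mul_alt (w : D.W) (i j : I) (h : D.length w ≤ D.length (w * D.s i)) :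
    ∃ (v : D.W) (k : ℕ), w = v * D.alt k i j ∧ D.length w = D.length v + k ∧
      D.length v ≤ D.length (v * D.s i) ∧ D.length v ≤ D.length (v * D.s j) := by
  induction hn : D.length w using Nat.strong_induction_on generalizing w i j with
  | _ n ih =>
    by_cases hj : D.length w ≤ D.length (w * D.s j)
    · exact ⟨w, 0, by simp [alt], by simpa using hn.symm, h, hj⟩
    · have h1 := D.length_le_mul_s w j
      obtain ⟨v, k, hw, hl, a, b⟩ := ih (D.length (w * D.s j)) (by omega) (w * D.s j) j i
        (by rw [mul_s_cancel]; omega) rfl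
      refine ⟨v, k + 1, ?_, by omega, b, a⟩
      rw [alt_succ, ← mul_assoc, ← hw, mul_s_cancel]

/-! ### Positive roots -/

/-- Nonnegative integral combinations of the simple roots. -/
def Pos (x : Λ) : Prop := ∃ c : I →₀ ℤ, 0 ≤ c ∧ x = linearCombination ℤ D.root c

variable {D}

theorem Pos.add {x y : Λ} (hx : D.Pos x) (hy : D.Pos y) : D.Pos (x + y) := by
  obtain ⟨c, hc, rfl⟩ := hx
  obtain ⟨d, hd, rfl⟩ := hy
  exact ⟨c + d, add_nonneg hc hd, by simp⟩

theorem Pos.smul {x : Λ} (hx : D.Pos x) {n : ℤ} (hn : 0 ≤ n) : D.Pos (n • x) := by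
  obtain ⟨c, hc, rfl⟩ := hx
  exact ⟨n • c, fun i => mul_nonneg hn (hc i), by simp⟩

theorem eq_zero_of_pos {x : Λ} (hx : D.Pos x) (hx' : D.Pos (-x)) : x = 0 := by
  obtain ⟨c, hc, rfl⟩ := hx
  obtain ⟨d, hd, e⟩ := hx'
  rw [← map_neg] at e
  have := D.root_linearIndependent e
  have h0 : c = 0 := by
    ext i
    have h1 := hc i
    have h2 := hd i
    rw [← this] at h2
    simp only [coe_neg, Pi.neg_apply, coe_zero, Pi.zero_apply] at h1 h2 ⊢
    omega
  simp [h0]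

variable (D)

theorem pos_root (i : I) : D.Pos (D.root i) :=
  ⟨single i 1, by simp, by simp⟩

theorem root_ne_zero (i : I) : D.root i ≠ 0 := fun h => by
  have := D.pairing_self i
  simp [h] at this

theorem smul_root_ne_zero (u : D.W) (i : I) : u • D.root i ≠ 0 := by
  rw [Ne, smul_eq_zero_iff_eq]
  exact D.root_ne_zero i

/-- Infinite dihedral case. The cone `0 ≤ x`, `b x ≤ 2 y` is carried by `sᵢ` into the same cone with
the roles of `i` and `j` exchanged: `4 x ≤ a b x ≤ 2 a y` gives `a y ≤ 2 (a y - x)`. -/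
theorem alt_smul_of_four_le {a b : ℤ} (ha : 0 ≤ a) (hb : 0 ≤ b) (hab : 4 ≤ a * b) (i j : I)
    (hij : D.coroot i (D.root j) = -a) (hji : D.coroot j (D.root i) = -b) (k : ℕ) (x y : ℤ)
    (hx : 0 ≤ x) (hxy : b * x ≤ 2 * y) :
    ∃ x' y' : ℤ, 0 ≤ x' ∧ 0 ≤ y' ∧
      D.alt k j i • (x • D.root i + y • D.root j) = x' • D.root i + y' • D.root j := by
  induction k generalizing i j a b x y with
  | zero => exact ⟨x, y, hx, by nlinarith, by simp [alt]⟩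
  | succ k ih =>
    have hy : 0 ≤ y := by nlinarith
    obtain ⟨x', y', hx', hy', e⟩ := ih hb ha (by linarith [mul_comm a b]) j i hji hij y (a * y - x)
      hy (by nlinarith)
    refine ⟨y', x', hy', hx', ?_⟩
    rw [alt_succ, mul_smul, s_smul, map_add, map_smul, map_smul, pairing_self, hij]
    rw [show x • D.root i + y • D.root j - (x • 2 + y • -a) • D.root i
      = y • D.root j + (a * y - x) • D.root i by simp only [smul_eq_mul]; module, e, add_comm]

end Weyl

/-! ### Rank two computations and the sign of `w αᵢ`. -/

variable {I Λ : Type*} [AddCommGroup Λ] (D : RootDatum I Λ)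

/-- The shape `x + p αᵢ + q αⱼ` is stable under both reflections, so rewriting with this rule and
`s_smul_add'` evaluates any alternating product on a generic weight. -/
theorem s_smul_add (i j : I) {a : ℤ} (h : D.coroot i (D.root j) = -a) (x : Λ) (p q : ℤ) :
    D.s i • (x + p • D.root i + q • D.root j)
      = x + (a * q - p - D.coroot i x) • D.root i + q • D.root j := by
  simp only [s_smul, map_add, map_smul, pairing_self, h, smul_eq_mul]
  module

theorem s_smul_add' (i j : I) {a : ℤ} (h : D.coroot i (D.root j) = -a) (x : Λ) (p q : ℤ) :
    D.s i • (x + q • D.root j + p • D.root i)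
      = x + q • D.root j + (a * q - p - D.coroot i x) • D.root i := by
  rw [add_right_comm, s_smul_add D i j h, add_right_comm]

/-- Finite dihedral case: the pairs `(a, b)` with `a b < 4` are those of `A₁ × A₁`, `A₂`, `B₂`,
`G₂`, with `m = 2, 3, 4, 6`. Each braid relation, and the positivity of the roots reached before it,
is a direct computation. -/
theorem exists_braid {a b : ℤ} (ha : 0 ≤ a) (hb : 0 ≤ b) (hab : a * b < 4) (i j : I)
    (h0 : a = 0 ↔ b = 0)
    (hij : D.coroot i (D.root j) = -a) (hji : D.coroot j (D.root i) = -b) :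
    ∃ m, 0 < m ∧ D.alt m i j = D.alt m j i ∧ ∀ k < m, ∃ x y : ℤ, 0 ≤ x ∧ 0 ≤ y ∧
      D.alt k i j • D.root i = x • D.root i + y • D.root j := by
  -- The zero multiples of `αᵢ` and `αⱼ` put the vector into the shape on which `s_smul_add`
  -- rewrites.
  have key : ∀ m, (∀ x, D.alt m i j • (x + (0 : ℤ) • D.root i + (0 : ℤ) • D.root j)
      = D.alt m j i • (x + (0 : ℤ) • D.root i + (0 : ℤ) • D.root j)) →
      D.alt m i j = D.alt m j i := fun m h => D.weyl_ext fun x => by simpa using h x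
  have key2 : ∀ k, (∃ x y : ℤ, 0 ≤ x ∧ 0 ≤ y ∧
      D.alt k i j • ((0 : Λ) + (1 : ℤ) • D.root i + (0 : ℤ) • D.root j) =
        0 + x • D.root i + y • D.root j) → ∃ x y : ℤ, 0 ≤ x ∧ 0 ≤ y ∧
      D.alt k i j • D.root i = x • D.root i + y • D.root j := by
    rintro k ⟨x, y, hx, hy, e⟩
    exact ⟨x, y, hx, hy, by simpa using e⟩
  have ha4 : a < 4 := by
    by_contra hc
    have : b ≠ 0 := fun h => by have := h0.2 h; omega
    have : 1 ≤ b := by omega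
    nlinarith
  have hb4 : b < 4 := by
    by_contra hc
    have : a ≠ 0 := fun h => by have := h0.1 h; omega
    have : 1 ≤ a := by omega
    nlinarith
  have step : ∀ m, 0 < m → (∀ x, D.alt m i j • (x + (0 : ℤ) • D.root i + (0 : ℤ) • D.root j)
      = D.alt m j i • (x + (0 : ℤ) • D.root i + (0 : ℤ) • D.root j)) →
      (∀ k < m, ∃ x y : ℤ, 0 ≤ x ∧ 0 ≤ y ∧
      D.alt k i j • ((0 : Λ) + (1 : ℤ) • D.root i + (0 : ℤ) • D.root j) =
        0 + x • D.root i + y • D.root j) →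
      ∃ m, 0 < m ∧ D.alt m i j = D.alt m j i ∧ ∀ k < m, ∃ x y : ℤ, 0 ≤ x ∧ 0 ≤ y ∧
      D.alt k i j • D.root i = x • D.root i + y • D.root j :=
    fun m hm h h' => ⟨m, hm, key m h, fun k hk => key2 k (h' k hk)⟩
  have hm : ∃ m, 0 < m ∧ (a = 0 ∧ b = 0 ∧ m = 2 ∨ a = 1 ∧ b = 1 ∧ m = 3 ∨ a = 1 ∧ b = 2 ∧ m = 4 ∨
      a = 2 ∧ b = 1 ∧ m = 4 ∨ a = 1 ∧ b = 3 ∧ m = 6 ∨ a = 3 ∧ b = 1 ∧ m = 6) := by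
    interval_cases a <;> interval_cases b <;> simp at h0 hab ⊢
  obtain ⟨m, hm0, hm⟩ := hm
  refine step m hm0 (fun x => ?_) fun k hk => ?_
  · rcases hm with ⟨rfl, rfl, rfl⟩ | ⟨rfl, rfl, rfl⟩ | ⟨rfl, rfl, rfl⟩ | ⟨rfl, rfl, rfl⟩ |
      ⟨rfl, rfl, rfl⟩ | ⟨rfl, rfl, rfl⟩ <;>
    · simp only [alt, one_mul, mul_smul, s_smul_add D i j hij, s_smul_add' D j i hji]
      congr 2
      · congr 1; ring
      · ring
  · rcases hm with ⟨rfl, rfl, rfl⟩ | ⟨rfl, rfl, rfl⟩ | ⟨rfl, rfl, rfl⟩ | ⟨rfl, rfl, rfl⟩ |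
      ⟨rfl, rfl, rfl⟩ | ⟨rfl, rfl, rfl⟩ <;>
    · interval_cases k <;>
      · simp only [alt, one_smul D.W, one_mul, mul_smul, s_smul_add D i j hij,
          s_smul_add' D j i hji]
        refine ⟨_, _, ?_, ?_, rfl⟩ <;> simp

/-- If `ℓ(w) ≤ ℓ(w sᵢ)`, then `w αᵢ` is a positive root. -/
theorem pos_of_length_le (w : D.W) (i : I) (h : D.length w ≤ D.length (w * D.s i)) :
    D.Pos (w • D.root i) := by
  induction hn : D.length w using Nat.strong_induction_on generalizing w i with
  | _ n ih =>
    by_cases hw : w = 1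
    · simpa [hw] using D.pos_root i
    obtain ⟨j, hj⟩ := D.exists_mul_s_length_lt hw
    have hij : i ≠ j := by rintro rfl; omega
    -- Induction applies to the factor `v`, which is positive on both `αᵢ` and `αⱼ`; what remains is
    -- a statement about the alternating product.
    obtain ⟨v, k, hwv, hl, hi', hj'⟩ := D.exists_eq_mul_alt w i j h
    have hk : 0 < k := by
      rcases Nat.eq_zero_or_pos k with rfl | hk
      · simp only [alt, mul_one] at hwv
        subst hwv
        omega
      · exact hk
    have pi := ih (D.length v) (by omega) v i hi' rfl
    have pj := ih (D.length v) (by omega) v j hj' rfl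
    suffices ∃ x y : ℤ, 0 ≤ x ∧ 0 ≤ y ∧
        D.alt k i j • D.root i = x • D.root i + y • D.root j by
      obtain ⟨x, y, hx, hy, e⟩ := this
      rw [hwv, mul_smul, e, smul_add, smul_comm v x, smul_comm v y]
      exact (pi.smul hx).add (pj.smul hy)
    obtain ⟨a, ha⟩ : ∃ a, D.coroot i (D.root j) = -a := ⟨_, (neg_neg _).symm⟩
    obtain ⟨b, hb⟩ : ∃ b, D.coroot j (D.root i) = -b := ⟨_, (neg_neg _).symm⟩
    have ha0 : 0 ≤ a := by have := D.pairing_nonpos i j hij; omega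
    have hb0 : 0 ≤ b := by have := D.pairing_nonpos j i hij.symm; omega
    by_cases hab : 4 ≤ a * b
    · obtain ⟨k, rfl⟩ : ∃ k', k = k' + 1 := ⟨k - 1, by omega⟩
      obtain ⟨x, y, hx, hy, e⟩ := D.alt_smul_of_four_le ha0 hb0 hab i j ha hb k 1 b
        (by norm_num) (by linarith)
      refine ⟨x, y, hx, hy, ?_⟩
      rw [alt_succ, mul_smul, s_smul, hb, ← e]
      congr 1
      module
    · obtain ⟨m, hm, braid, hpos⟩ := D.exists_braid ha0 hb0 (by omega) i j
        ⟨fun h => by have := D.pairing_zero i j (by omega); omega,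
          fun h => by have := D.pairing_zero j i (by omega); omega⟩ ha hb
      by_cases hkm : k < m
      · exact hpos k hkm
      -- If `k ≥ m`, the braid relation rewrites the end of `w` so that it finishes in `sᵢ`, and
      -- then `w sᵢ` is shorter than `w`.
      · exfalso
        obtain ⟨n, rfl⟩ : ∃ n, k = n + m := ⟨k - m, by omega⟩
        obtain ⟨m, rfl⟩ : ∃ m', m = m' + 1 := ⟨m - 1, by omega⟩
        obtain ⟨x, hx, e⟩ := D.exists_alt_add n (m + 1) i j
        have h1 : w * D.s i = v * (x * D.alt m i j) := by
          rw [hwv, e, braid, alt_succ, ← mul_assoc, ← mul_assoc, ← mul_assoc, mul_s_cancel]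
        have h2 := D.length_mul_le v (x * D.alt m i j)
        have h3 := D.length_mul_le x (D.alt m i j)
        have h4 := D.length_alt_le m i j
        rw [← h1] at h2
        omega

theorem neg_of_length_ge (w : D.W) (i : I) (h : D.length (w * D.s i) ≤ D.length w) :
    D.Pos (-(w • D.root i)) := by
  have := D.pos_of_length_le (w * D.s i) i (by rwa [mul_s_cancel])
  rwa [mul_smul, s_smul_root, smul_neg] at this

theorem length_lt_mul_s_iff (w : D.W) (i : I) :
    D.length w < D.length (w * D.s i) ↔ D.Pos (w • D.root i) := by
  refine ⟨fun h => D.pos_of_length_le w i h.le, fun h => ?_⟩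
  by_contra h'
  exact D.smul_root_ne_zero w i (eq_zero_of_pos h (D.neg_of_length_ge w i (not_lt.1 h')))

theorem pos_or_neg (u : D.W) (j : I) : D.Pos (u • D.root j) ∨ D.Pos (-(u • D.root j)) :=
  (le_total _ _).imp (D.pos_of_length_le u j) (D.neg_of_length_ge u j)

theorem length_mul_s_ne (w : D.W) (i : I) : D.length (w * D.s i) ≠ D.length w := fun h =>
  D.smul_root_ne_zero w i (eq_zero_of_pos (D.pos_of_length_le w i h.ge)
    (D.neg_of_length_ge w i h.le))

theorem length_s_mul (i : I) (w : D.W) : D.length (D.s i * w) = D.length (w⁻¹ * D.s i) := by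
  rw [← length_inv, mul_inv_rev, s_inv]

theorem length_s_mul_ne (i : I) (w : D.W) : D.length (D.s i * w) ≠ D.length w := by
  rw [length_s_mul, ← D.length_inv w]
  exact D.length_mul_s_ne _ _

theorem length_lt_s_mul_iff (w : D.W) (i : I) :
    D.length w < D.length (D.s i * w) ↔ D.Pos (w⁻¹ • D.root i) := by
  rw [length_s_mul, ← D.length_inv w]
  exact D.length_lt_mul_s_iff _ _

theorem length_s_mul_le (i : I) (w : D.W) : D.length (D.s i * w) ≤ D.length w + 1 := by
  rw [length_s_mul, ← D.length_inv w]
  exact D.length_mul_s_le _ _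

theorem length_le_s_mul (i : I) (w : D.W) : D.length w ≤ D.length (D.s i * w) + 1 := by
  rw [length_s_mul, ← D.length_inv w]
  exact D.length_le_mul_s _ _

/-! ### Coroots and reflections -/

/-- The rescaled coroots `dⱼ αⱼ^∨` transform under the Weyl group exactly as the roots do, so a real
root and its rescaled coroot have the same coefficients. This is the use of symmetrizability. -/
theorem exists_coeff (d : I → ℚ)
    (hd : ∀ i j, d i * (D.coroot i (D.root j) : ℚ) = d j * (D.coroot j (D.root i) : ℚ))
    (u : D.W) (j : I) : ∃ c : I →₀ ℤ, u • D.root j = linearCombination ℤ D.root c ∧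
      ∀ x, d j * (D.coroot j (u⁻¹ • x) : ℚ) =
        linearCombination ℤ (fun k => d k * (D.coroot k x : ℚ)) c := by
  induction u using D.weyl_induction with
  | one => exact ⟨single j 1, by simp, fun x => by simp⟩
  | mul k u ih =>
    obtain ⟨c, e, hc⟩ := ih
    refine ⟨c - single k (D.coroot k (linearCombination ℤ D.root c)), ?_, fun x => ?_⟩
    · rw [mul_smul, e, s_smul]
      simp
    · rw [mul_inv_rev, s_inv, mul_smul, hc, map_sub, linearCombination_single]
      have h1 : linearCombination ℤ (fun l => d l * (D.coroot l (D.root k) : ℚ)) c =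
          d k * (D.coroot k (linearCombination ℤ D.root c) : ℚ) := by
        simp only [linearCombination_apply, Finsupp.sum, map_sum, map_smul, Int.cast_sum,
          Finset.mul_sum]
        refine Finset.sum_congr rfl fun l _ => ?_
        rw [hd l k]
        simp
        ring
      have h2 : linearCombination ℤ (fun l => d l * (D.coroot l (D.s k • x) : ℚ)) c =
          linearCombination ℤ (fun l => d l * (D.coroot l x : ℚ)) c - (D.coroot k x : ℚ) *
          linearCombination ℤ (fun l => d l * (D.coroot l (D.root k) : ℚ)) c := by
        simp only [linearCombination_apply, Finsupp.sum, Finset.mul_sum, ← Finset.sum_sub_distrib]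
        refine Finset.sum_congr rfl fun l _ => ?_
        rw [s_smul]
        simp
        ring
      rw [h2, h1]
      simp
      ring

theorem coroot_eq_of_root_eq {u v : D.W} {j k : I} (h : u • D.root j = v • D.root k) (x : Λ) :
    D.coroot j (u⁻¹ • x) = D.coroot k (v⁻¹ • x) := by
  obtain ⟨d, hd0, hd⟩ := D.symmetrizable
  obtain ⟨c, e, hc⟩ := D.exists_coeff d hd u j
  obtain ⟨c', e', hc'⟩ := D.exists_coeff d hd v k
  obtain rfl : c = c' := D.root_linearIndependent (by rw [← e, ← e', h])
  have h1 : ∀ x, d j * (D.coroot j (u⁻¹ • x) : ℚ) = d k * (D.coroot k (v⁻¹ • x) : ℚ) :=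
    fun x => (hc x).trans (hc' x).symm
  -- Both coroots take the value 2 on the common root, which forces the two scale factors to agree.
  have h2 : d j = d k := by
    have := h1 (u • D.root j)
    rw [inv_smul_smul, h, inv_smul_smul, pairing_self, pairing_self] at this
    simpa using this
  have := h1 x
  rw [h2] at this
  exact_mod_cast mul_left_cancel₀ (hd0 k).ne' this

theorem reflection_smul (u : D.W) (j : I) (x : Λ) :
    (u * D.s j * u⁻¹) • x = x - D.coroot j (u⁻¹ • x) • u • D.root j := by
  rw [mul_smul, mul_smul, s_smul, smul_sub, smul_inv_smul, smul_comm]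

theorem reflection_eq_of_root_eq {u v : D.W} {j k : I} (h : u • D.root j = v • D.root k) :
    u * D.s j * u⁻¹ = v * D.s k * v⁻¹ :=
  D.weyl_ext fun x => by rw [reflection_smul, reflection_smul, coroot_eq_of_root_eq D h, h]

/-- Every reflection belongs to a positive root. -/
theorem exists_pos_reflection (u : D.W) (j : I) : ∃ v : D.W,
    v * D.s j * v⁻¹ = u * D.s j * u⁻¹ ∧ D.Pos (v • D.root j) ∧ (v = u ∨ v = u * D.s j) := by
  rcases D.pos_or_neg u j with h | h
  · exact ⟨u, rfl, h, .inl rfl⟩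
  · exact ⟨u * D.s j, by simp [mul_assoc, s_inv, s_mul_cancel], by
      rwa [mul_smul, s_smul_root, smul_neg], .inr rfl⟩

/-- The simple reflection `sᵢ` permutes the positive roots other than `αᵢ`. -/
theorem pos_s_smul {u : D.W} {j i : I} (h : D.Pos (u • D.root j)) (hne : u • D.root j ≠ D.root i) :
    D.Pos (D.s i • u • D.root j) := by
  obtain ⟨c, hc, e⟩ := h
  -- Otherwise the root is a multiple of `αᵢ`; applying `u⁻¹` shows that the multiplier divides 1,
  -- so the root would be `αᵢ` itself.
  have hk : ∃ k, k ≠ i ∧ c k ≠ 0 := by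
    by_contra! hk
    have h1 : c = single i (c i) := by
      ext k
      by_cases hki : k = i
      · simp [hki]
      · simp [hk k hki, Ne.symm hki]
    have h2 : u • D.root j = c i • D.root i := by rw [e, h1]; simp
    obtain ⟨d, hd0, hd⟩ := D.symmetrizable
    obtain ⟨c', e', -⟩ := D.exists_coeff d hd u⁻¹ i
    have h3 : D.root j = c i • u⁻¹ • D.root i := by
      rw [smul_comm, ← h2, inv_smul_smul]
    have h4 : single j 1 = c i • c' := D.root_linearIndependent (by
      rw [map_smul, ← e', ← h3]; simp)
    have h5 : 1 = c i * c' j := by simpa using DFunLike.congr_fun h4 j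
    have h6 : c i = 1 := Int.eq_one_of_dvd_one (hc i) ⟨_, h5⟩
    rw [h6, one_smul] at h2
    exact hne h2
  obtain ⟨k, hki, hk⟩ := hk
  rcases D.pos_or_neg (D.s i * u) j with h | ⟨c', hc', e'⟩
  · rwa [mul_smul] at h
  -- The reflection `sᵢ` changes only the coefficient at `i`, so the positive coefficient at `k`
  -- survives.
  · exfalso
    rw [mul_smul, s_smul, e] at e'
    have h1 : -(c - single i (D.coroot i (linearCombination ℤ D.root c))) = c' :=
      D.root_linearIndependent (by rw [← e']; simp)
    have h2 := DFunLike.congr_fun h1 k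
    have h5 : single i (D.coroot i (linearCombination ℤ D.root c)) k = 0 :=
      single_eq_of_ne hki
    have h3 := hc k
    have h4 := hc' k
    simp only [coe_zero, Pi.zero_apply, coe_neg, coe_sub, Pi.neg_apply, Pi.sub_apply,
      h5] at h2 h3 h4
    omega

/-! ### Strong exchange and the lifting property for covers. -/

section Exchange
variable {I Λ : Type*} [AddCommGroup Λ] (D : RootDatum I Λ)

/-- Strong exchange, by induction on `v`. Strip a right descent `s_k` from `v`: either the root is
`α_k`, or `s_k` keeps it positive and the conjugated reflection shortens `v s_k`. -/
theorem length_mul_reflection_lt {u : D.W} {j : I} (h : D.Pos (u • D.root j)) {v : D.W}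
    (hv : D.Pos (-(v • u • D.root j))) : D.length (v * (u * D.s j * u⁻¹)) < D.length v := by
  induction hn : D.length v using Nat.strong_induction_on generalizing u v with
  | _ n ih =>
    by_cases hv1 : v = 1
    · rw [hv1, one_smul] at hv
      exact absurd (eq_zero_of_pos h hv) (D.smul_root_ne_zero u j)
    obtain ⟨k, hk⟩ := D.exists_mul_s_length_lt hv1
    by_cases hu : u • D.root j = D.root k
    · rw [D.reflection_eq_of_root_eq (u := u) (v := 1) (j := j) (k := k) (by rw [hu, one_smul])]
      simpa [hn] using hk
    · have := ih _ (hn ▸ hk) (u := D.s k * u) (v := v * D.s k)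
        (by rw [mul_smul]; exact D.pos_s_smul h hu)
        (by rwa [mul_smul, mul_smul, ← mul_smul (D.s k) (D.s k), s_mul_self, one_smul]) rfl
      have e : v * D.s k * (D.s k * u * D.s j * (D.s k * u)⁻¹) =
          v * (u * D.s j * u⁻¹) * D.s k := by
        rw [mul_inv_rev, s_inv]
        simp only [mul_assoc, s_mul_cancel]
      rw [e] at this
      have := D.length_le_mul_s (v * (u * D.s j * u⁻¹)) k
      omega

theorem reflection_mul_self (u : D.W) (j : I) : (u * D.s j * u⁻¹) * (u * D.s j * u⁻¹) = 1 := by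
  simp [mul_assoc, s_mul_cancel]

/-- A reflection negates its own root, so this is `length_mul_reflection_lt` applied to the product
of `v` with the reflection. -/
theorem lt_length_mul_reflection {u : D.W} {j : I} (h : D.Pos (u • D.root j)) {v : D.W}
    (hv : D.Pos (v • u • D.root j)) : D.length v < D.length (v * (u * D.s j * u⁻¹)) := by
  have := D.length_mul_reflection_lt h (v := v * (u * D.s j * u⁻¹)) (by
    rw [mul_smul, reflection_smul, inv_smul_smul, pairing_self]
    convert hv using 1
    rw [two_smul, sub_add_cancel_left, smul_neg, neg_neg])
  rwa [mul_assoc, reflection_mul_self, mul_one] at this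

theorem pos_of_lt_length_mul_reflection {u : D.W} {j : I} (h : D.Pos (u • D.root j)) {v : D.W}
    (hv : D.length v < D.length (v * (u * D.s j * u⁻¹))) : D.Pos (v • u • D.root j) := by
  rcases D.pos_or_neg (v * u) j with h' | h' <;> rw [mul_smul] at h'
  · exact h'
  · exact absurd hv (D.length_mul_reflection_lt h h').le.not_gt

/-- If the positive roots differed, the element `sⱼ u⁻¹` would be shortened by the reflection when
judged by the first root and lengthened when judged by the second. -/
theorem root_eq_of_reflection_eq {u v : D.W} {j k : I} (hu : D.Pos (u • D.root j))
    (hv : D.Pos (v • D.root k)) (e : u * D.s j * u⁻¹ = v * D.s k * v⁻¹) :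
    u • D.root j = v • D.root k := by
  have h1 : D.Pos (u⁻¹ • v • D.root k) := D.pos_of_lt_length_mul_reflection hv (by
    rw [← e]
    exact D.lt_length_mul_reflection hu (by rw [inv_smul_smul]; exact D.pos_root j))
  by_contra hne
  have h2 : D.Pos (D.s j • (u⁻¹ * v) • D.root k) := by
    refine D.pos_s_smul (by rwa [mul_smul]) fun h => hne ?_
    rw [← h, mul_smul, smul_inv_smul]
  have h3 := D.lt_length_mul_reflection hv (v := D.s j * u⁻¹) (by
    rwa [mul_smul, ← mul_smul u⁻¹])
  rw [← e] at h3
  have h4 := D.length_mul_reflection_lt hu (v := D.s j * u⁻¹) (by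
    rw [mul_smul, inv_smul_smul, s_smul_root, neg_neg]; exact D.pos_root j)
  omega

theorem coroot_mul_s_inv_smul (u : D.W) (j : I) (x : Λ) :
    D.coroot j ((u * D.s j)⁻¹ • x) = -D.coroot j (u⁻¹ • x) := by
  rw [mul_inv_rev, s_inv, mul_smul, s_smul (x := u⁻¹ • x), map_sub,
    (D.coroot j).map_smul, pairing_self, smul_eq_mul]
  ring

/-- A reflection determines its coroot up to sign. -/
theorem coroot_eq_of_reflection_eq {u v : D.W} {j k : I}
    (e : u * D.s j * u⁻¹ = v * D.s k * v⁻¹) (x : Λ) :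
    D.coroot j (u⁻¹ • x) = D.coroot k (v⁻¹ • x) ∨ D.coroot j (u⁻¹ • x) = -D.coroot k (v⁻¹ • x) := by
  obtain ⟨u', eu, hu, hu'⟩ := D.exists_pos_reflection u j
  obtain ⟨v', ev, hv, hv'⟩ := D.exists_pos_reflection v k
  have := D.coroot_eq_of_root_eq (D.root_eq_of_reflection_eq hu hv (by rw [eu, ev, e])) x
  rcases hu' with rfl | rfl <;> rcases hv' with rfl | rfl <;>
    (try simp only [coroot_mul_s_inv_smul] at this) <;> omega

/-- Unless the reflection is `s_k`, its conjugate by `s_k` belongs to a positive root and lengthens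
`v s_k`; but `ℓ(v s_k) > ℓ(v)`, while the product has length at most `ℓ(v)`. -/
theorem eq_mul_s_of_cover {v u : D.W} {j k : I}
    (h : D.length (v * (u * D.s j * u⁻¹)) = D.length v + 1)
    (hv : D.length v < D.length (v * D.s k))
    (hw : D.length (v * (u * D.s j * u⁻¹) * D.s k) < D.length (v * (u * D.s j * u⁻¹))) :
    v * (u * D.s j * u⁻¹) = v * D.s k := by
  obtain ⟨u', eu, hu, -⟩ := D.exists_pos_reflection u j
  rw [← eu] at h hw ⊢
  by_cases hk : u' • D.root j = D.root k
  · rw [D.reflection_eq_of_root_eq (u := u') (v := 1) (j := j) (k := k) (by rw [hk, one_smul])]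
    simp
  · exfalso
    have h1 := D.pos_of_lt_length_mul_reflection hu (v := v) (by omega)
    have h2 := D.lt_length_mul_reflection (u := D.s k * u') (v := v * D.s k) (j := j)
      (by rw [mul_smul]; exact D.pos_s_smul hu hk)
      (by rwa [mul_smul, mul_smul, ← mul_smul (D.s k) (D.s k), s_mul_self, one_smul])
    have e : v * D.s k * (D.s k * u' * D.s j * (D.s k * u')⁻¹) =
        v * (u' * D.s j * u'⁻¹) * D.s k := by
      rw [mul_inv_rev, s_inv]
      simp only [mul_assoc, s_mul_cancel]
    rw [e] at h2
    omega

theorem eq_s_mul_of_cover {v u : D.W} {j k : I}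
    (h : D.length (v * (u * D.s j * u⁻¹)) = D.length v + 1)
    (hv : D.length v < D.length (D.s k * v))
    (hw : D.length (D.s k * (v * (u * D.s j * u⁻¹))) < D.length (v * (u * D.s j * u⁻¹))) :
    v * (u * D.s j * u⁻¹) = D.s k * v := by
  have e : v⁻¹ * (v * u * D.s j * (v * u)⁻¹) = (v * (u * D.s j * u⁻¹))⁻¹ := by
    simp [mul_assoc, s_inv]
  have := D.eq_mul_s_of_cover (v := v⁻¹) (u := v * u) (j := j) (k := k)
    (by rw [e, length_inv, length_inv, h])
    (by rwa [length_inv, ← D.length_s_mul])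
    (by rwa [e, ← D.length_s_mul, length_inv])
  rw [e] at this
  rw [← inv_inj, this, mul_inv_rev, s_inv]

end Exchange

/-! ### Lifting along an involution -/

section Lifting

variable {α : Type*} {R : α → α → Prop} {l : α → ℕ} {f : α → α} {P : α → Prop}

open Relation in
-- Stated for an abstract involution `f` so that it serves both left and right multiplication by a
-- simple reflection. Every edge is either transported by `f`, or joins `a` to `f a`, or goes from
-- the top of a pair to the bottom of another one; in each case the smaller and the larger members
-- of the pairs stay related. The predicate `P` ensures that the edges inside the pairs exist.
theorem reflTransGen_lifting (hf : ∀ a, f (f a) = a) (hl : ∀ a, l (f a) ≠ l a)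
    (hP : ∀ a b, R a b → P a → P b) (hPf : ∀ a, P a → P (f a))
    (same : ∀ a b, R a b → (l a < l (f a) ↔ l b < l (f b)) → R (f a) (f b))
    (cross : ∀ a b, R a b → l a < l (f a) → l (f b) < l b → b = f a)
    (base : ∀ a, P a → l a < l (f a) → R a (f a)) {a b : α} (h : ReflTransGen R a b) (ha : P a) :
    ReflTransGen R (if l a < l (f a) then a else f a) (if l b < l (f b) then b else f b) ∧
    ReflTransGen R (if l a < l (f a) then f a else a) (if l b < l (f b) then f b else b) := by
  induction h using ReflTransGen.head_induction_on with
  | refl => exact ⟨.refl, .refl⟩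
  | @head a c hac hcb ih =>
    have hc := hP _ _ hac ha
    obtain ⟨ih1, ih2⟩ := ih hc
    suffices ReflTransGen R (if l a < l (f a) then a else f a) (if l c < l (f c) then c else f c) ∧
      ReflTransGen R (if l a < l (f a) then f a else a) (if l c < l (f c) then f c else c) from
      ⟨this.1.trans ih1, this.2.trans ih2⟩
    by_cases h1 : l a < l (f a) <;> by_cases h2 : l c < l (f c)
    · simp only [if_pos h1, if_pos h2]
      exact ⟨.single hac, .single (same _ _ hac (by simp [h1, h2]))⟩
    · simp only [if_pos h1, if_neg h2]
      obtain rfl := cross _ _ hac h1 (lt_of_le_of_ne (not_lt.1 h2) (hl c))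
      rw [hf]
      exact ⟨.refl, .refl⟩
    · simp only [if_neg h1, if_pos h2]
      have hfa : R (f a) a := by
        have := base _ (hPf a ha) (by rw [hf]; exact lt_of_le_of_ne (not_lt.1 h1) (hl a))
        rwa [hf] at this
      exact ⟨.head hfa (.single hac), .head hac (.single (base _ hc h2))⟩
    · simp only [if_neg h1, if_neg h2]
      exact ⟨.single (same _ _ hac (by simp [h1, h2])), .single hac⟩

open Relation in
-- Where `P` fails there are no edges from `a` to `f a`, so a chain can never pass from the bottom
-- of a pair to the top of one. With equal positions at both ends it never changes position, and `f`
-- transports each edge.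
theorem reflTransGen_map_of_same (hl : ∀ a, l (f a) ≠ l a)
    (hP : ∀ a b, R a b → (P a ↔ P b))
    (same : ∀ a b, R a b → (l a < l (f a) ↔ l b < l (f b)) → R (f a) (f b))
    (cross : ∀ a b, R a b → l a < l (f a) → l (f b) < l b → b = f a)
    (hcross : ∀ a, R a (f a) → P a) {a b : α} (h : ReflTransGen R a b) (ha : ¬P a)
    (hab : l a < l (f a) ↔ l b < l (f b)) : ReflTransGen R (f a) (f b) := by
  suffices (l a < l (f a) → l b < l (f b)) ∧ ((l a < l (f a) ↔ l b < l (f b)) →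
    ReflTransGen R (f a) (f b)) from this.2 hab
  clear hab
  induction h using ReflTransGen.head_induction_on with
  | refl => exact ⟨id, fun _ => .refl⟩
  | @head a c hac hcb ih =>
    obtain ⟨ih1, ih2⟩ := ih (fun h => ha ((hP _ _ hac).2 h))
    have h1 : l a < l (f a) → l c < l (f c) := by
      intro h1
      by_contra h2
      obtain rfl := cross _ _ hac h1 (lt_of_le_of_ne (not_lt.1 h2) (hl c))
      exact ha (hcross a hac)
    refine ⟨fun h => ih1 (h1 h), fun h => ?_⟩
    have h2 : l a < l (f a) ↔ l c < l (f c) := ⟨h1, fun h' => h.2 (ih1 h')⟩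
    exact .head (same _ _ hac h2) (ih2 (h2.symm.trans h))

end Lifting

/-! ### The `b`-Bruhat order -/

section BOrder

variable {I Λ : Type*} [AddCommGroup Λ] (D : RootDatum I Λ) (lam : Λ)

/-- The number `⟨αᵢ^∨, v λ⟩`. -/
def ht (i : I) (v : D.W) : ℤ := D.coroot i (v • lam)

theorem ht_s_mul (i : I) (v : D.W) : D.ht lam i (D.s i * v) = -D.ht lam i v := by
  rw [ht, ht, mul_smul, s_smul (x := v • lam), map_sub, (D.coroot i).map_smul, pairing_self,
    smul_eq_mul]
  ring

variable {D lam}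

/-- By `exists_coeff` the coroot of a positive root is a nonnegative rational combination of simple
coroots. -/
theorem coroot_nonneg_of_pos (hlam : D.IsDominant lam) {u : D.W} {j : I}
    (h : D.Pos (u • D.root j)) : 0 ≤ D.coroot j (u⁻¹ • lam) := by
  obtain ⟨d, hd0, hd⟩ := D.symmetrizable
  obtain ⟨c, e, hc⟩ := D.exists_coeff d hd u j
  obtain ⟨c', hc', e'⟩ := h
  obtain rfl : c = c' := D.root_linearIndependent (by rw [← e, ← e'])
  have h1 : 0 ≤ d j * (D.coroot j (u⁻¹ • lam) : ℚ) := by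
    rw [hc, linearCombination_apply]
    refine Finset.sum_nonneg fun k _ => ?_
    have h1 : (0 : ℚ) ≤ c k := by exact_mod_cast hc' k
    have h2 : (0 : ℚ) ≤ D.coroot k lam := by exact_mod_cast hlam k
    have h3 := (hd0 k).le
    simp only [zsmul_eq_mul]
    positivity
  exact_mod_cast nonneg_of_mul_nonneg_right h1 (hd0 j)

theorem ht_nonneg (hlam : D.IsDominant lam) {i : I} {v : D.W}
    (h : D.length v < D.length (D.s i * v)) : 0 ≤ D.ht lam i v := by
  have := coroot_nonneg_of_pos hlam ((D.length_lt_s_mul_iff v i).1 h)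
  rwa [inv_inv] at this

theorem length_s_mul_lt_of_not_lt {i : I} {v : D.W} (h : ¬D.length v < D.length (D.s i * v)) :
    D.length (D.s i * v) < D.length v :=
  lt_of_le_of_ne (not_lt.1 h) (D.length_s_mul_ne i v)

theorem lt_of_ht_pos (hlam : D.IsDominant lam) {i : I} {v : D.W} (h : 0 < D.ht lam i v) :
    D.length v < D.length (D.s i * v) := by
  by_contra h'
  have := ht_nonneg hlam (i := i) (v := D.s i * v)
    (by rw [s_mul_cancel]; exact length_s_mul_lt_of_not_lt h')
  rw [ht_s_mul] at this
  omega

theorem lt_of_ht_neg (hlam : D.IsDominant lam) {i : I} {v : D.W} (h : D.ht lam i v < 0) :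
    D.length (D.s i * v) < D.length v := by
  by_contra h'
  exact absurd (ht_nonneg hlam (lt_of_le_of_ne (not_lt.1 h') (D.length_s_mul_ne i v).symm)) (by omega)

/-- Induction along the simple reflections that generate the stabilizer of `λ`. -/
theorem stabilizer_induction (hlam : D.IsDominant lam) {P : D.W → Prop} (one : P 1)
    (mul : ∀ x r, D.coroot r lam = 0 → P x → P (x * D.s r)) {x : D.W} (hx : x • lam = lam) :
    P x := by
  induction hn : D.length x using Nat.strong_induction_on generalizing x with
  | _ n ih =>
    by_cases hx1 : x = 1
    · rwa [hx1]
    obtain ⟨r, hr⟩ := D.exists_mul_s_length_lt hx1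
    have h1 := coroot_nonneg_of_pos hlam (u := x * D.s r) (j := r)
      (D.pos_of_length_le _ _ (by rw [mul_s_cancel]; exact hr.le))
    rw [coroot_mul_s_inv_smul, (by rw [inv_smul_eq_iff, hx] : x⁻¹ • lam = lam)] at h1
    have h2 : D.coroot r lam = 0 := le_antisymm (by omega) (hlam r)
    rw [← D.mul_s_cancel r x]
    refine mul _ _ h2 (ih _ (hn ▸ hr) ?_ rfl)
    rw [mul_smul, s_smul (x := lam), h2, zero_smul, sub_zero, hx]

variable {b : ℚ}

/-- For `w = v s_β` the heights of `vλ` and `wλ` differ by a multiple of `⟨β^∨, λ⟩`, which `b` makes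
integral. All integrality statements about paths come from this congruence. -/
theorem BCovers.exists_ht_eq {v w : D.W} (h : D.BCovers lam b v w) (i : I) :
    ∃ n : ℤ, b * D.ht lam i w = b * D.ht lam i v + n := by
  obtain ⟨-, u, j, rfl, n, hn⟩ := h
  refine ⟨-(n * D.coroot i (v • u • D.root j)), ?_⟩
  rw [ht, ht, mul_smul, reflection_smul, smul_sub, map_sub, smul_comm v (_ : ℤ), (D.coroot i).map_smul]
  push_cast [smul_eq_mul]
  rw [← hn]
  ring

theorem BLe.exists_ht_eq {v w : D.W} (h : D.BLe lam b v w) (i : I) :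
    ∃ n : ℤ, b * D.ht lam i w = b * D.ht lam i v + n := by
  induction h with
  | refl => exact ⟨0, by simp⟩
  | tail _ h ih =>
    obtain ⟨n, hn⟩ := ih
    obtain ⟨m, hm⟩ := h.exists_ht_eq i
    exact ⟨n + m, by rw [hm, hn]; push_cast; ring⟩

theorem bCovers_zero_iff {v w : D.W} : D.BCovers lam 0 v w ↔ D.Covers v w := by
  constructor
  · rintro ⟨h, u, j, e, -⟩
    exact ⟨h, u, j, e⟩
  · rintro ⟨h, u, j, e⟩
    exact ⟨h, u, j, e, 0, by simp⟩

/-- The results on the `b`-Bruhat order thus specialize to the ordinary one at `b = 0`, where every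
integrality condition is void. -/
theorem bLe_zero_iff {v w : D.W} : D.BLe lam 0 v w ↔ D.Le v w := by
  rw [BLe, Le]
  congr! 1
  ext v w
  exact bCovers_zero_iff

theorem BLe.le {v w : D.W} (h : D.BLe lam b v w) : D.Le v w :=
  Relation.ReflTransGen.mono (fun _ _ ⟨h, u, j, e, _⟩ => ⟨h, u, j, e⟩) _ _ h

theorem Le.eq_or_length_lt {v w : D.W} (h : D.Le v w) : v = w ∨ D.length v < D.length w := by
  induction h with
  | refl => exact .inl rfl
  | tail _ h ih =>
    have := h.1
    rcases ih with rfl | ih <;> right <;> omega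

theorem Le.antisymm {v w : D.W} (h : D.Le v w) (h' : D.Le w v) : v = w := by
  rcases h.eq_or_length_lt with e | h1
  · exact e
  · rcases h'.eq_or_length_lt with e | h2
    · exact e.symm
    · omega

theorem Le.length_le {v w : D.W} (h : D.Le v w) : D.length v ≤ D.length w := by
  rcases h.eq_or_length_lt with rfl | h
  · exact le_rfl
  · exact h.le

theorem bCovers_s_mul_s_mul {i : I} {v w : D.W} (h : D.BCovers lam b v w)
    (hvw : D.length v < D.length (D.s i * v) ↔ D.length w < D.length (D.s i * w)) :
    D.BCovers lam b (D.s i * v) (D.s i * w) := by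
  obtain ⟨h, u, j, e, n, hn⟩ := h
  refine ⟨?_, u, j, by rw [e, ← mul_assoc], n, hn⟩
  have h1 := D.length_s_mul_le i v
  have h2 := D.length_s_mul_le i w
  have h3 := D.length_le_s_mul i v
  have h4 := D.length_le_s_mul i w
  have h5 := D.length_s_mul_ne i v
  have h6 := D.length_s_mul_ne i w
  omega

/-- Here the reflection is conjugated by `s_r`; since `s_r` fixes `λ`, the pairing of its coroot
with `λ` is unchanged. -/
theorem bCovers_mul_s_mul_s {r : I} (hr : D.coroot r lam = 0) {v w : D.W}
    (h : D.BCovers lam b v w)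
    (hvw : D.length v < D.length (v * D.s r) ↔ D.length w < D.length (w * D.s r)) :
    D.BCovers lam b (v * D.s r) (w * D.s r) := by
  obtain ⟨h, u, j, e, n, hn⟩ := h
  refine ⟨?_, D.s r * u, j, ?_, n, ?_⟩
  · have h1 := D.length_mul_s_le v r
    have h2 := D.length_mul_s_le w r
    have h3 := D.length_le_mul_s v r
    have h4 := D.length_le_mul_s w r
    have h5 := D.length_mul_s_ne v r
    have h6 := D.length_mul_s_ne w r
    omega
  · rw [e, mul_inv_rev, s_inv]
    simp only [mul_assoc, s_mul_cancel]
  · rw [mul_inv_rev, s_inv, mul_smul, s_smul (x := lam), hr, zero_smul, sub_zero, hn]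

theorem bCovers_s_mul {i : I} {v : D.W} (h : ∃ n : ℤ, b * D.ht lam i v = n)
    (hv : D.length v < D.length (D.s i * v)) : D.BCovers lam b v (D.s i * v) := by
  refine ⟨?_, v⁻¹, i, by simp [mul_assoc], by simpa [ht] using h⟩
  have h1 := D.length_s_mul_le i v
  omega

theorem BCovers.exists_int {i : I} {v : D.W} (h : D.BCovers lam b v (D.s i * v)) :
    ∃ n : ℤ, b * D.ht lam i v = n := by
  obtain ⟨-, u, j, e, n, hn⟩ := h
  have : u * D.s j * u⁻¹ = v⁻¹ * D.s i * v⁻¹⁻¹ := by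
    rw [mul_assoc v⁻¹, inv_inv, e]; simp [mul_assoc]
  rcases D.coroot_eq_of_reflection_eq this lam with h | h <;> rw [h, inv_inv] at hn
  · exact ⟨n, hn⟩
  · refine ⟨-n, ?_⟩
    push_cast at hn ⊢
    rw [← hn, ht]
    ring

theorem eq_s_mul_of_bCovers {i : I} {v w : D.W} (h : D.BCovers lam b v w)
    (hv : D.length v < D.length (D.s i * v)) (hw : D.length (D.s i * w) < D.length w) :
    w = D.s i * v := by
  obtain ⟨h, u, j, rfl, -⟩ := h
  exact D.eq_s_mul_of_cover h hv hw

/-- The smaller one of `v` and `sᵢ v`. -/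
noncomputable def lower (i : I) (v : D.W) : D.W :=
  if D.length v < D.length (D.s i * v) then v else D.s i * v

/-- The larger one of `v` and `sᵢ v`. -/
noncomputable def upper (i : I) (v : D.W) : D.W :=
  if D.length v < D.length (D.s i * v) then D.s i * v else v

theorem BLe.lower_upper {i : I} {v w : D.W} (h : D.BLe lam b v w)
    (hv : ∃ n : ℤ, b * D.ht lam i v = n) :
    D.BLe lam b (lower i v) (lower i w) ∧ D.BLe lam b (upper i v) (upper i w) := by
  refine reflTransGen_lifting (R := D.BCovers lam b) (l := D.length) (f := fun v => D.s i * v)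
    (P := fun v => ∃ n : ℤ, b * D.ht lam i v = n) (D.s_mul_cancel i) (D.length_s_mul_ne i)
    ?_ ?_ (fun _ _ => bCovers_s_mul_s_mul) (fun _ _ => eq_s_mul_of_bCovers)
    (fun _ => bCovers_s_mul) h hv
  · rintro v w h ⟨n, hn⟩
    obtain ⟨m, hm⟩ := h.exists_ht_eq i
    exact ⟨n + m, by rw [hm, hn]; push_cast; ring⟩
  · rintro v ⟨n, hn⟩
    exact ⟨-n, by rw [ht_s_mul]; push_cast; rw [← hn]; ring⟩

/-- If `b` times the height is integral, this is the lifting property. If not, integrality fails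
along the whole chain and `reflTransGen_map_of_same` applies. -/
theorem BLe.s_mul {i : I} {v w : D.W} (h : D.BLe lam b v w)
    (hvw : D.length v < D.length (D.s i * v) ↔ D.length w < D.length (D.s i * w)) :
    D.BLe lam b (D.s i * v) (D.s i * w) := by
  by_cases hv : ∃ n : ℤ, b * D.ht lam i v = n
  · have := h.lower_upper hv
    unfold lower upper at this
    by_cases hv' : D.length v < D.length (D.s i * v)
    · simpa only [if_pos hv', if_pos (hvw.1 hv')] using this.2
    · simpa only [if_neg hv', if_neg (mt hvw.2 hv')] using this.1
  · refine reflTransGen_map_of_same (R := D.BCovers lam b) (l := D.length)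
      (f := fun v => D.s i * v)
      (P := fun v => ∃ n : ℤ, b * D.ht lam i v = n) (D.length_s_mul_ne i)
      ?_ (fun _ _ => bCovers_s_mul_s_mul) (fun _ _ => eq_s_mul_of_bCovers)
      (fun _ => BCovers.exists_int) h hv hvw
    intro v w h
    obtain ⟨m, hm⟩ := h.exists_ht_eq i
    constructor
    · rintro ⟨n, hn⟩
      exact ⟨n + m, by rw [hm, hn]; push_cast; ring⟩
    · rintro ⟨n, hn⟩
      exact ⟨n - m, by rw [hn] at hm; push_cast; linarith⟩

theorem BLe.mul_s {r : I} (hr : D.coroot r lam = 0) {v w : D.W} (h : D.BLe lam b v w) :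
    D.BLe lam b (if D.length v < D.length (v * D.s r) then v else v * D.s r)
      (if D.length w < D.length (w * D.s r) then w else w * D.s r) ∧
    D.BLe lam b (if D.length v < D.length (v * D.s r) then v * D.s r else v)
      (if D.length w < D.length (w * D.s r) then w * D.s r else w) := by
  refine reflTransGen_lifting (R := D.BCovers lam b) (l := D.length) (f := fun v => v * D.s r)
    (P := fun _ => True) (D.mul_s_cancel r) (fun v => D.length_mul_s_ne v r)
    (fun _ _ _ _ => trivial) (fun _ _ => trivial) (fun _ _ => bCovers_mul_s_mul_s hr) ?_ ?_ h
    trivial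
  · rintro v w ⟨h, u, j, rfl, -⟩ hv hw
    exact D.eq_mul_s_of_cover h hv hw
  · intro v _ hv
    refine ⟨?_, 1, r, by simp, 0, by simp [hr]⟩
    have := D.length_mul_s_le v r
    omega

/-- If the `i`-height changes its sign along `v ≤_b w`, then it is integral at `b`. -/
theorem BLe.exists_int (hlam : D.IsDominant lam) {i : I} {v w : D.W} (h : D.BLe lam b v w)
    (hv : 0 ≤ D.ht lam i v) (hw : D.ht lam i w ≤ 0) : ∃ n : ℤ, b * D.ht lam i v = n := by
  induction h using Relation.ReflTransGen.head_induction_on with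
  | refl =>
    exact ⟨0, by rw [le_antisymm hw hv]; simp⟩
  | @head a c hac hcw ih =>
    obtain ⟨m, hm⟩ := hac.exists_ht_eq i
    rcases le_or_gt 0 (D.ht lam i c) with hc | hc
    · obtain ⟨n, hn⟩ := ih hc
      exact ⟨n - m, by rw [hn] at hm; push_cast; linarith⟩
    · rcases hv.eq_or_lt with h0 | h0
      · exact ⟨0, by simp [← h0]⟩
      · obtain rfl := eq_s_mul_of_bCovers hac (lt_of_ht_pos hlam h0) (lt_of_ht_neg hlam hc)
        exact hac.exists_int

end BOrder

/-! ### The `b`-Bruhat order on `W / W_λ`. -/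

section Cosets
variable {I Λ : Type*} [AddCommGroup Λ] {D : RootDatum I Λ} {lam : Λ} {b : ℚ}

theorem coset_eq_iff {v w : D.W} : D.coset lam v = D.coset lam w ↔ v • lam = w • lam :=
  (MulAction.injective_ofQuotientStabilizer D.W lam).eq_iff.symm

theorem exists_coset_eq (σ : D.Cosets lam) : ∃ v, D.coset lam v = σ :=
  QuotientGroup.mk_surjective σ

theorem s_smul_coset (i : I) (v : D.W) : D.s i • D.coset lam v = D.coset lam (D.s i * v) := rfl

theorem s_smul_s_smul (i : I) (σ : D.Cosets lam) : D.s i • D.s i • σ = σ := by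
  rw [← mul_smul, s_mul_self, one_smul]

/-- The number `⟨αᵢ^∨, σ λ⟩`. -/
def cht (i : I) (σ : D.Cosets lam) : ℤ :=
  D.coroot i (MulAction.ofQuotientStabilizer D.W lam σ)

theorem cht_coset (i : I) (v : D.W) : cht i (D.coset lam v) = D.ht lam i v := rfl

theorem cht_s_smul (i : I) (σ : D.Cosets lam) : cht i (D.s i • σ) = -cht i σ := by
  obtain ⟨v, rfl⟩ := exists_coset_eq σ
  rw [s_smul_coset, cht_coset, cht_coset, ht_s_mul]

theorem coset_mul_s {r : I} (hr : D.coroot r lam = 0) (v : D.W) :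
    D.coset lam (v * D.s r) = D.coset lam v := by
  rw [coset_eq_iff, mul_smul, s_smul (x := lam), hr, zero_smul, sub_zero]

theorem coset_s_mul {i : I} {v : D.W} (h : D.ht lam i v = 0) :
    D.coset lam (D.s i * v) = D.coset lam v := by
  rw [ht] at h
  rw [coset_eq_iff, mul_smul, s_smul (x := v • lam), h, zero_smul, sub_zero]

theorem bLe_mul_s {r : I} (hr : D.coroot r lam = 0) {v : D.W}
    (h : D.length v < D.length (v * D.s r)) : D.BLe lam b v (v * D.s r) := by
  refine .single ⟨?_, 1, r, by simp, 0, by simp [hr]⟩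
  have := D.length_mul_s_le v r
  omega

theorem length_mul_s_lt_of_not_lt {r : I} {v : D.W} (h : ¬D.length v < D.length (v * D.s r)) :
    D.length (v * D.s r) < D.length v :=
  lt_of_le_of_ne (not_lt.1 h) (D.length_mul_s_ne v r)

/-- A minimum length representative lies below a whole coset as soon as it lies below one element. -/
theorem IsMinRep.bLe (hlam : D.IsDominant lam) {v w w' : D.W} (hv : D.IsMinRep lam v)
    (h : D.BLe lam b v w) (hw : D.coset lam w' = D.coset lam w) : D.BLe lam b v w' := by
  have hv' : ∀ r, D.coroot r lam = 0 → D.length v < D.length (v * D.s r) := fun r hr =>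
    lt_of_le_of_ne (hv _ (coset_mul_s hr v)) (D.length_mul_s_ne v r).symm
  obtain ⟨x, rfl⟩ : ∃ x, w' = w * x := ⟨w⁻¹ * w', by simp⟩
  have hx : x • lam = lam := by
    rw [coset_eq_iff, mul_smul] at hw
    exact smul_left_cancel w hw
  clear hw
  refine stabilizer_induction hlam (P := fun x => D.BLe lam b v (w * x)) (by simpa using h)
    (fun x r hr ih => ?_) hx
  have := (ih.mul_s hr).1
  rw [if_pos (hv' r hr)] at this
  rw [← mul_assoc]
  split_ifs at this with h1
  · exact this.trans (bLe_mul_s hr h1)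
  · exact this

variable (D lam) in
theorem exists_isMinRep (σ : D.Cosets lam) : ∃ v, D.coset lam v = σ ∧ D.IsMinRep lam v := by
  have h : {n | ∃ v, D.coset lam v = σ ∧ D.length v = n}.Nonempty := by
    obtain ⟨v, hv⟩ := exists_coset_eq σ
    exact ⟨_, v, hv, rfl⟩
  obtain ⟨v, hv, h1⟩ := Nat.sInf_mem h
  refine ⟨v, hv, fun w hw => ?_⟩
  rw [h1]
  exact Nat.sInf_le ⟨w, hw.trans hv, rfl⟩

variable (b) in
/-- The weak `b`-Bruhat order on cosets, through arbitrary representatives. -/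
def CBLe (σ τ : D.Cosets lam) : Prop :=
  ∃ v w, D.coset lam v = σ ∧ D.coset lam w = τ ∧ D.BLe lam b v w

/-- Hence the order may be tested on any representatives, which makes it usable after multiplication
by `sᵢ`. -/
theorem CBLe.exists_isMinRep (hlam : D.IsDominant lam) {σ τ : D.Cosets lam} (h : CBLe b σ τ) :
    ∃ v w, D.IsMinRep lam v ∧ D.IsMinRep lam w ∧ D.coset lam v = σ ∧ D.coset lam w = τ ∧
      D.BLe lam b v w := by
  obtain ⟨v, w, rfl, rfl, h⟩ := h
  obtain ⟨v', hv, hv'⟩ := D.exists_isMinRep lam (D.coset lam v)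
  obtain ⟨w', hw, hw'⟩ := D.exists_isMinRep lam (D.coset lam w)
  exact ⟨v', w', hv', hw', hv, hw, hv'.bLe hlam ((hv'.bLe hlam .refl hv.symm).trans h) hw⟩

theorem cosetBLt_iff (hlam : D.IsDominant lam) {σ τ : D.Cosets lam} :
    D.CosetBLt lam b σ τ ↔ σ ≠ τ ∧ CBLe b σ τ := by
  refine and_congr_right fun _ => ⟨?_, fun h => h.exists_isMinRep hlam⟩
  rintro ⟨v, w, -, -, hv, hw, h⟩
  exact ⟨v, w, hv, hw, h⟩

theorem cosetLe_iff (hlam : D.IsDominant lam) {σ τ : D.Cosets lam} :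
    D.CosetLe lam σ τ ↔ CBLe 0 σ τ := by
  constructor
  · rintro ⟨v, w, -, -, hv, hw, h⟩
    exact ⟨v, w, hv, hw, bLe_zero_iff.2 h⟩
  · intro h
    obtain ⟨v, w, hv, hw, hv', hw', h⟩ := h.exists_isMinRep hlam
    exact ⟨v, w, hv, hw, hv', hw', bLe_zero_iff.1 h⟩

theorem Le.cosetLe (hlam : D.IsDominant lam) {v w : D.W} (h : D.Le v w) :
    D.CosetLe lam (D.coset lam v) (D.coset lam w) :=
  (cosetLe_iff hlam).2 ⟨v, w, rfl, rfl, bLe_zero_iff.2 h⟩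

theorem CBLe.refl (σ : D.Cosets lam) : CBLe b σ σ := by
  obtain ⟨v, hv⟩ := exists_coset_eq σ
  exact ⟨v, v, hv, hv, .refl⟩

theorem CBLe.trans (hlam : D.IsDominant lam) {σ τ ρ : D.Cosets lam} (h : CBLe b σ τ)
    (h' : CBLe b τ ρ) : CBLe b σ ρ := by
  obtain ⟨v, w, hv, hw, hv', hw', h⟩ := h.exists_isMinRep hlam
  obtain ⟨w', u, -, -, e, hu', h'⟩ := h'.exists_isMinRep hlam
  exact ⟨v, u, hv', hu', (hv.bLe hlam h (e.trans hw'.symm)).trans h'⟩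

theorem CBLe.cosetLe (hlam : D.IsDominant lam) {σ τ : D.Cosets lam} (h : CBLe b σ τ) :
    D.CosetLe lam σ τ := by
  obtain ⟨v, w, hv, hw, h⟩ := h
  exact (cosetLe_iff hlam).2 ⟨v, w, hv, hw, bLe_zero_iff.2 h.le⟩

theorem CBLe.exists_cht_eq {σ τ : D.Cosets lam} (h : CBLe b σ τ) (i : I) :
    ∃ n : ℤ, b * cht i τ = b * cht i σ + n := by
  obtain ⟨v, w, rfl, rfl, h⟩ := h
  exact h.exists_ht_eq i

theorem CBLe.exists_int (hlam : D.IsDominant lam) {σ τ : D.Cosets lam} (h : CBLe b σ τ) {i : I}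
    (hσ : 0 ≤ cht i σ) (hτ : cht i τ ≤ 0) : ∃ n : ℤ, b * cht i σ = n := by
  obtain ⟨v, w, rfl, rfl, h⟩ := h
  exact h.exists_int hlam hσ hτ

theorem CBLe.s_smul_of_pos (hlam : D.IsDominant lam) {σ τ : D.Cosets lam} (h : CBLe b σ τ) {i : I}
    (hσ : 0 < cht i σ) (hτ : 0 < cht i τ) : CBLe b (D.s i • σ) (D.s i • τ) := by
  obtain ⟨v, w, rfl, rfl, h⟩ := h
  exact ⟨_, _, rfl, rfl, h.s_mul (iff_of_true (lt_of_ht_pos hlam hσ) (lt_of_ht_pos hlam hτ))⟩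

theorem CBLe.s_smul_of_neg (hlam : D.IsDominant lam) {σ τ : D.Cosets lam} (h : CBLe b σ τ) {i : I}
    (hσ : cht i σ < 0) (hτ : cht i τ < 0) : CBLe b (D.s i • σ) (D.s i • τ) := by
  obtain ⟨v, w, rfl, rfl, h⟩ := h
  exact ⟨_, _, rfl, rfl, h.s_mul
    (iff_of_false (lt_of_ht_neg hlam hσ).not_gt (lt_of_ht_neg hlam hτ).not_gt)⟩

theorem cBLe_s_smul (hlam : D.IsDominant lam) {σ : D.Cosets lam} {i : I} (hσ : 0 < cht i σ)
    (h : ∃ n : ℤ, b * cht i σ = n) : CBLe b σ (D.s i • σ) := by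
  obtain ⟨v, rfl⟩ := exists_coset_eq σ
  exact ⟨v, D.s i * v, rfl, rfl, .single (bCovers_s_mul h (lt_of_ht_pos hlam hσ))⟩

theorem coset_upper {i : I} (hlam : D.IsDominant lam) {w : D.W} (h : D.ht lam i w ≤ 0) :
    D.coset lam (upper i w) = D.coset lam w := by
  unfold upper
  split_ifs with h'
  · exact coset_s_mul (le_antisymm h (ht_nonneg hlam h'))
  · rfl

theorem coset_lower {i : I} (hlam : D.IsDominant lam) {w : D.W} (h : 0 ≤ D.ht lam i w) :
    D.coset lam (lower i w) = D.coset lam w := by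
  unfold lower
  split_ifs with h'
  · rfl
  · refine coset_s_mul (le_antisymm ?_ h)
    by_contra h0
    exact h' (lt_of_ht_pos hlam (not_le.1 h0))

/-- The change of sign between `σ` and `τ` forces integrality, so the lifting property applies.
Passing to the upper representative of `τ` keeps the coset, because `sᵢ` fixes a coset of height
zero. -/
theorem CBLe.s_smul_left (hlam : D.IsDominant lam) {σ τ : D.Cosets lam} (h : CBLe b σ τ) {i : I}
    (hσ : 0 < cht i σ) (hτ : cht i τ ≤ 0) : CBLe b (D.s i • σ) τ := by
  have hi := h.exists_int hlam hσ.le hτ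
  obtain ⟨v, w, rfl, rfl, h⟩ := h
  have := (h.lower_upper hi).2
  rw [upper, if_pos (lt_of_ht_pos hlam hσ)] at this
  exact ⟨_, _, rfl, coset_upper hlam hτ, this⟩

theorem CBLe.s_smul_right (hlam : D.IsDominant lam) {σ τ : D.Cosets lam} (h : CBLe b σ τ) {i : I}
    (hσ : 0 ≤ cht i σ) (hτ : cht i τ < 0) : CBLe b σ (D.s i • τ) := by
  have hi := h.exists_int hlam hσ hτ.le
  obtain ⟨v, w, rfl, rfl, h⟩ := h
  have := (h.lower_upper hi).1
  rw [lower.eq_1 i w, if_neg (lt_of_ht_neg hlam hτ).not_gt] at this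
  exact ⟨_, _, coset_lower hlam hσ, rfl, this⟩

end Cosets

/-! ### Deodhar lifts -/

section Deodhar
variable {I Λ : Type*} [AddCommGroup Λ] {D : RootDatum I Λ} {lam : Λ} {i : I}

variable (D i) in
/-- `v < sᵢ v`. -/
def Asc (v : D.W) : Prop := D.length v < D.length (D.s i * v)

theorem asc_or (i : I) (v : D.W) : D.Asc i v ∨ D.Asc i (D.s i * v) := by
  have := D.length_s_mul_ne i v
  unfold Asc
  rw [s_mul_cancel]
  omega

theorem Asc.not_asc {v : D.W} (h : D.Asc i v) : ¬D.Asc i (D.s i * v) := by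
  unfold Asc at *
  rw [s_mul_cancel]
  omega

theorem Asc.length_eq {v : D.W} (h : D.Asc i v) : D.length (D.s i * v) = D.length v + 1 := by
  have := D.length_s_mul_le i v
  unfold Asc at *
  omega

theorem Asc.le {v : D.W} (h : D.Asc i v) : D.Le v (D.s i * v) :=
  .single ⟨h.length_eq, v⁻¹, i, by simp [mul_assoc]⟩

theorem lt_s_mul_iff {v : D.W} : D.Lt v (D.s i * v) ↔ D.Asc i v := by
  constructor
  · rintro ⟨h, hne⟩
    exact h.eq_or_length_lt.resolve_left hne
  · exact fun h => ⟨h.le, fun e => (lt_irrefl (D.length v)) (by rw [Asc, ← e] at h; exact h)⟩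

theorem lower_of_asc {v : D.W} (h : D.Asc i v) : lower i v = v := if_pos h

theorem upper_of_asc {v : D.W} (h : D.Asc i v) : upper i v = D.s i * v := if_pos h

theorem lower_s_mul {v : D.W} (h : D.Asc i v) : lower i (D.s i * v) = v :=
  (if_neg h.not_asc).trans (D.s_mul_cancel i v)

theorem Le.lower (i : I) {v w : D.W} (h : D.Le v w) : D.Le (lower i v) (lower i w) :=
  bLe_zero_iff.1 ((bLe_zero_iff (lam := 0)).2 h |>.lower_upper ⟨0, by simp⟩).1

theorem Le.upper (i : I) {v w : D.W} (h : D.Le v w) : D.Le (upper i v) (upper i w) :=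
  bLe_zero_iff.1 ((bLe_zero_iff (lam := 0)).2 h |>.lower_upper ⟨0, by simp⟩).2

theorem s_mul_le_s_mul_iff {v w : D.W} (hv : D.Asc i v) (hw : D.Asc i w) :
    D.Le (D.s i * v) (D.s i * w) ↔ D.Le v w := by
  constructor <;> intro h
  · simpa only [lower_s_mul hv, lower_s_mul hw] using h.lower i
  · simpa only [upper_of_asc hv, upper_of_asc hw] using h.upper i

theorem le_s_mul_iff {v w : D.W} (hv : D.Asc i v) (hw : D.Asc i w) :
    D.Le v (D.s i * w) ↔ D.Le v w := by
  constructor <;> intro h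
  · simpa only [lower_of_asc hv, lower_s_mul hw] using h.lower i
  · exact h.trans hw.le

theorem IsUp.unique {v w w' : D.W} {τ : D.Cosets lam} (h : D.IsUp lam v τ w)
    (h' : D.IsUp lam v τ w') : w = w' :=
  (h.2 _ h'.1.1 h'.1.2).antisymm (h'.2 _ h.1.1 h.1.2)

theorem asc_of_cht_pos (hlam : D.IsDominant lam) {τ : D.Cosets lam} (hτ : 0 < cht i τ) {w : D.W}
    (hw : D.coset lam w = τ) : D.Asc i w := by
  subst hw
  exact lt_of_ht_pos hlam hτ

/-- All elements of `τ` are ascents and left multiplication by `sᵢ` maps them onto `sᵢ τ`. By the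
lifting property this bijection preserves both the order and the condition of lying above `v`, so it
matches the minima. -/
theorem isUp_s_smul_iff (hlam : D.IsDominant lam) {τ : D.Cosets lam} (hτ : 0 < cht i τ)
    {v w : D.W} (hv : D.Asc i v) :
    D.IsUp lam v (D.s i • τ) (D.s i * w) ↔ D.IsUp lam v τ w := by
  have h1 : ∀ w, D.coset lam (D.s i * w) = D.s i • τ ↔ D.coset lam w = τ := fun w => by
    rw [← s_smul_coset, smul_left_cancel_iff]
  constructor
  · rintro ⟨⟨a, b⟩, c⟩
    rw [h1] at b
    have hw := asc_of_cht_pos hlam hτ b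
    refine ⟨⟨(le_s_mul_iff hv hw).1 a, b⟩, fun w' h2 h3 => ?_⟩
    have hw' := asc_of_cht_pos hlam hτ h3
    exact (s_mul_le_s_mul_iff hw hw').1 (c _ ((le_s_mul_iff hv hw').2 h2) ((h1 _).2 h3))
  · rintro ⟨⟨a, b⟩, c⟩
    have hw := asc_of_cht_pos hlam hτ b
    refine ⟨⟨(le_s_mul_iff hv hw).2 a, (h1 _).2 b⟩, fun w' h2 h3 => ?_⟩
    obtain ⟨w', rfl⟩ : ∃ x, w' = D.s i * x := ⟨D.s i * w', (D.s_mul_cancel i w').symm⟩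
    rw [h1] at h3
    have hw' := asc_of_cht_pos hlam hτ h3
    exact (s_mul_le_s_mul_iff hw hw').2 (c _ ((le_s_mul_iff hv hw').1 h2) h3)

theorem isUp_s_mul_s_smul_iff (hlam : D.IsDominant lam) {τ : D.Cosets lam} (hτ : 0 < cht i τ)
    {v w : D.W} (hv : D.Asc i v) :
    D.IsUp lam (D.s i * v) (D.s i • τ) (D.s i * w) ↔ D.IsUp lam v τ w := by
  have h1 : ∀ w, D.coset lam (D.s i * w) = D.s i • τ ↔ D.coset lam w = τ := fun w => by
    rw [← s_smul_coset, smul_left_cancel_iff]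
  constructor
  · rintro ⟨⟨a, b⟩, c⟩
    rw [h1] at b
    have hw := asc_of_cht_pos hlam hτ b
    refine ⟨⟨(s_mul_le_s_mul_iff hv hw).1 a, b⟩, fun w' h2 h3 => ?_⟩
    have hw' := asc_of_cht_pos hlam hτ h3
    exact (s_mul_le_s_mul_iff hw hw').1 (c _ ((s_mul_le_s_mul_iff hv hw').2 h2) ((h1 _).2 h3))
  · rintro ⟨⟨a, b⟩, c⟩
    have hw := asc_of_cht_pos hlam hτ b
    refine ⟨⟨(s_mul_le_s_mul_iff hv hw).2 a, (h1 _).2 b⟩, fun w' h2 h3 => ?_⟩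
    obtain ⟨w', rfl⟩ : ∃ x, w' = D.s i * x := ⟨D.s i * w', (D.s_mul_cancel i w').symm⟩
    rw [h1] at h3
    have hw' := asc_of_cht_pos hlam hτ h3
    exact (s_mul_le_s_mul_iff hw hw').2 (c _ ((s_mul_le_s_mul_iff hv hw').1 h2) h3)

/-- Reach `v` from a representative below an element of `τ` by right multiplications with simple
reflections fixing `λ`; at each of them the larger of `w'` and `w' s_r` dominates and stays in `τ`.
-/
theorem exists_le_of_cosetLe (hlam : D.IsDominant lam) {v : D.W} {τ : D.Cosets lam}
    (h : D.CosetLe lam (D.coset lam v) τ) : ∃ w, D.Le v w ∧ D.coset lam w = τ := by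
  obtain ⟨v₀, w, -, -, hv, hw, h⟩ := h
  obtain ⟨x, rfl⟩ : ∃ x, v = v₀ * x := ⟨v₀⁻¹ * v, by simp⟩
  have hx : x • lam = lam := by
    rw [coset_eq_iff, mul_smul] at hv
    exact (smul_left_cancel v₀ hv).symm
  clear hv
  refine stabilizer_induction hlam
    (P := fun x => ∃ w, D.Le (v₀ * x) w ∧ D.coset lam w = τ) ⟨w, by simpa using h, hw⟩
    (fun x r hr ih => ?_) hx
  obtain ⟨w', hw', e⟩ := ih
  have := ((bLe_zero_iff.2 hw').mul_s hr).2
  rw [← mul_assoc]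
  refine ⟨_, bLe_zero_iff.1 (.trans ?_ this), ?_⟩
  · split_ifs with h1
    · exact .refl
    · have := bLe_mul_s (b := 0) hr (v := v₀ * x * D.s r)
        (by rw [mul_s_cancel]; exact length_mul_s_lt_of_not_lt h1)
      rwa [mul_s_cancel] at this
  · split_ifs
    · rw [coset_mul_s hr, e]
    · exact e

theorem exists_s_mul_length_lt {w : D.W} (h : w ≠ 1) :
    ∃ i, D.length (D.s i * w) < D.length w := by
  obtain ⟨i, hi⟩ := D.exists_mul_s_length_lt (inv_ne_one.2 h)
  exact ⟨i, by rwa [length_s_mul, ← D.length_inv w]⟩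

/-- The Deodhar lift exists. -/
theorem exists_isUp (hlam : D.IsDominant lam) {v : D.W} {τ : D.Cosets lam}
    (h : D.CosetLe lam (D.coset lam v) τ) : ∃ w, D.IsUp lam v τ w := by
  obtain ⟨τ₀, hτ, hmin⟩ := D.exists_isMinRep lam τ
  induction hn : D.length τ₀ using Nat.strong_induction_on generalizing v τ τ₀ with
  | _ n ih =>
    -- Here `τ` is the base coset, so `v` must lie in it too and is its own lift.
    by_cases h1 : τ₀ = 1
    · subst h1
      refine ⟨v, ⟨.refl, ?_⟩, fun _ h _ => h⟩
      obtain ⟨v₀, w₀, -, hw, hv', hw', hle⟩ := h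
      have : w₀ = 1 := D.eq_one_of_length (by
        have := hw 1 (hτ.trans hw'.symm)
        rw [length_one] at this
        omega)
      rw [← hv', ← hw']
      rcases hle.eq_or_length_lt with e | e
      · rw [e]
      · rw [this, length_one] at e
        omega
    · obtain ⟨i, hi⟩ := exists_s_mul_length_lt h1
      -- Height zero would make `sᵢ τ₀` a shorter representative of `τ`, and positive height would
      -- make `τ₀` an ascent. So `sᵢ τ` has a shorter minimum representative and the induction
      -- descends to it.
      have hneg : cht i τ < 0 := by
        rw [← hτ, cht_coset]
        by_contra h0
        rcases (not_lt.1 h0).eq_or_lt with h2 | h2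
        · have := hmin _ (coset_s_mul h2.symm)
          omega
        · have := lt_of_ht_pos hlam h2
          omega
      have hpos : 0 < cht i (D.s i • τ) := by rw [cht_s_smul]; omega
      obtain ⟨w, hvw, hw⟩ := exists_le_of_cosetLe hlam h
      obtain ⟨w, rfl⟩ : ∃ x, w = D.s i * x := ⟨D.s i * w, (D.s_mul_cancel i w).symm⟩
      have hw' : D.coset lam w = D.s i • τ := by
        rw [← hw, s_smul_coset, s_mul_cancel]
      have hwa : D.Asc i w := asc_of_cht_pos hlam hpos hw'
      obtain ⟨ρ, hρ, hρ'⟩ := D.exists_isMinRep lam (D.s i • τ)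
      have hlen : D.length ρ < n := by
        have := hρ' (D.s i * τ₀) (by rw [hρ, ← s_smul_coset, hτ])
        omega
      rcases asc_or i v with hv | hv
      · obtain ⟨y, hy⟩ := ih _ hlen (v := v) (τ := D.s i • τ)
          (by rw [← hw']; exact ((le_s_mul_iff hv hwa).1 hvw).cosetLe hlam) ρ hρ hρ' rfl
        refine ⟨D.s i * y, ?_⟩
        rw [← s_smul_s_smul i τ]
        exact (isUp_s_smul_iff hlam hpos hv).2 hy
      · rw [← D.s_mul_cancel i v] at hvw
        obtain ⟨y, hy⟩ := ih _ hlen (v := D.s i * v) (τ := D.s i • τ)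
          (by rw [← hw']; exact ((s_mul_le_s_mul_iff hv hwa).1 hvw).cosetLe hlam) ρ hρ hρ' rfl
        refine ⟨D.s i * y, ?_⟩
        rw [← s_smul_s_smul i τ, ← D.s_mul_cancel i v]
        exact (isUp_s_mul_s_smul_iff hlam hpos hv).2 hy

theorem IsUp.cosetLe (hlam : D.IsDominant lam) {v w : D.W} {τ : D.Cosets lam}
    (h : D.IsUp lam v τ w) : D.CosetLe lam (D.coset lam v) τ := by
  rw [← h.1.2]
  exact h.1.1.cosetLe hlam

theorem coset_s_mul_of_cht {τ : D.Cosets lam} (hτ : cht i τ = 0) {w : D.W}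
    (hw : D.coset lam w = τ) : D.coset lam (D.s i * w) = τ := by
  subst hw
  exact coset_s_mul hτ

/-- At height zero the coset is stable under `sᵢ`. If `w` were a descent, `sᵢ w` would be a shorter
element of the coset that still lies above `v`. -/
theorem IsUp.asc {v w : D.W} {τ : D.Cosets lam} (h : D.IsUp lam v τ w) (hτ : cht i τ = 0)
    (hv : D.Asc i v) : D.Asc i w := by
  refine (asc_or i w).resolve_right fun hw => ?_
  have h1 : D.Le v (D.s i * w) := by
    have := h.1.1
    rw [← D.s_mul_cancel i w] at this
    exact (le_s_mul_iff hv hw).1 this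
  have h2 := (h.2 _ h1 (coset_s_mul_of_cht hτ h.1.2)).length_le
  rw [Asc, s_mul_cancel] at hw
  omega

/-- The lift `u` of `sᵢ v` satisfies `u ≤ sᵢ w`. If `u` is an ascent, then `w ≤ u` as well, and
there is nothing strictly between. If `u` is a descent, minimality of `w` applied to `sᵢ u` gives
`sᵢ w ≤ u`. -/
theorem IsUp.exists_s_mul (hlam : D.IsDominant lam) {v w : D.W} {τ : D.Cosets lam}
    (h : D.IsUp lam v τ w) (hτ : cht i τ = 0) (hv : D.Asc i v) :
    D.IsUp lam (D.s i * v) τ w ∨ D.IsUp lam (D.s i * v) τ (D.s i * w) := by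
  have hw := h.asc hτ hv
  have hsw := coset_s_mul_of_cht hτ h.1.2
  have hle := (s_mul_le_s_mul_iff hv hw).2 h.1.1
  obtain ⟨u, hu⟩ := exists_isUp hlam (v := D.s i * v) (τ := τ) (by
    rw [← hsw]; exact hle.cosetLe hlam)
  have huw := hu.2 _ hle hsw
  suffices u = w ∨ u = D.s i * w by
    rcases this with rfl | rfl
    · exact .inl hu
    · exact .inr hu
  rcases asc_or i u with hu' | hu'
  · have h1 := h.2 u (hv.le.trans hu.1.1) hu.1.2
    have := hw.length_eq
    rcases h1.eq_or_length_lt with e | e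
    · exact .inl e.symm
    · rcases huw.eq_or_length_lt with e' | e'
      · exact .inr e'
      · omega
  · right
    have h1 := hu.1.1
    rw [← D.s_mul_cancel i u] at h1
    have h2 := h.2 _ ((s_mul_le_s_mul_iff hv hu').1 h1) (coset_s_mul_of_cht hτ hu.1.2)
    have h3 := (s_mul_le_s_mul_iff hw hu').2 h2
    rw [s_mul_cancel] at h3
    exact huw.antisymm h3

theorem IsUp.exists_of_s_mul (hlam : D.IsDominant lam) {v u : D.W} {τ : D.Cosets lam}
    (h : D.IsUp lam (D.s i * v) τ u) (hv : D.Asc i v) : ∃ w, D.IsUp lam v τ w :=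
  exists_isUp hlam (by rw [← h.1.2]; exact Le.cosetLe hlam (hv.le.trans h.1.1))

end Deodhar
-- Step sequences, cutting and merging, integrality.
section Lists
variable {I Λ : Type*} [AddCommGroup Λ] {D : RootDatum I Λ} {lam : Λ} {i : I}

/-- The total duration of a sequence of steps. -/
def dur (L : List (D.Step lam)) : ℚ := (L.map Prod.fst).sum

@[simp] theorem dur_nil : dur ([] : List (D.Step lam)) = 0 := rfl

@[simp] theorem dur_cons (x : D.Step lam) (L) : dur (x :: L) = x.1 + dur L := by simp [dur]

@[simp] theorem dur_append (L K : List (D.Step lam)) : dur (L ++ K) = dur L + dur K := by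
  simp [dur]

@[simp] theorem height_nil : height i ([] : List (D.Step lam)) = 0 := rfl

@[simp] theorem height_cons (x : D.Step lam) (L) : height i (x :: L) = x.1 * cht i x.2 + height i L := by
  simp [height, stepHeight, cht]

@[simp] theorem height_append (L K : List (D.Step lam)) :
    height i (L ++ K) = height i L + height i K := by
  simp [height]

theorem stepHeight_eq (x : D.Step lam) : stepHeight i x = x.1 * cht i x.2 := rfl

theorem stepHeight_pos_iff {x : D.Step lam} (hx : 0 < x.1) : 0 < stepHeight i x ↔ 0 < cht i x.2 := by
  rw [stepHeight_eq, mul_pos_iff_of_pos_left hx, Int.cast_pos]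

variable (i) in
/-- Apply `sᵢ` to all directions. -/
def act (L : List (D.Step lam)) : List (D.Step lam) := L.map fun x => (x.1, D.s i • x.2)

@[simp] theorem act_nil : act i ([] : List (D.Step lam)) = [] := rfl

@[simp] theorem act_cons (x : D.Step lam) (L) : act i (x :: L) = (x.1, D.s i • x.2) :: act i L := rfl

theorem act_act (L : List (D.Step lam)) : act i (act i L) = L := by
  induction L with
  | nil => rfl
  | cons x L ih => rw [act_cons, act_cons, ih, s_smul_s_smul]

@[simp] theorem dur_act (L : List (D.Step lam)) : dur (act i L) = dur L := by
  induction L with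
  | nil => rfl
  | cons x L ih => simp [ih]

@[simp] theorem height_act (L : List (D.Step lam)) : height i (act i L) = -height i L := by
  induction L with
  | nil => simp
  | cons x L ih => simp [ih, cht_s_smul]; ring

/-- A sequence of steps describing an LS path, except that consecutive directions may be equal. -/
def IsWeakLS : List (D.Step lam) → Prop
  | [] => True
  | x :: L => 0 < x.1 ∧ IsWeakLS L ∧ ∀ y ∈ L.head?, CBLe (dur L) y.2 x.2

theorem IsWeakLS.of_append {L K : List (D.Step lam)} (h : IsWeakLS (L ++ K)) : IsWeakLS K := by
  induction L with
  | nil => exact h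
  | cons x L ih => exact ih h.2.1

theorem IsWeakLS.pos {L : List (D.Step lam)} (h : IsWeakLS L) : ∀ x ∈ L, 0 < x.1 := by
  induction L with
  | nil => simp
  | cons x L ih =>
    intro y hy
    rcases List.mem_cons.1 hy with rfl | hy
    · exact h.1
    · exact ih h.2.1 y hy

theorem dur_nonneg {L : List (D.Step lam)} (h : ∀ x ∈ L, 0 < x.1) : 0 ≤ dur L := by
  induction L with
  | nil => simp
  | cons x L ih =>
    have h1 := h x (by simp)
    have h2 := ih fun y hy => h y (by simp [hy])
    rw [dur_cons]
    linarith

/-- The order conditions inside `A` see the suffix only through its duration, so only the junction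
has to be checked again. -/
theorem IsWeakLS.replace_suffix {A Y Y' : List (D.Step lam)} (h : IsWeakLS (A ++ Y))
    (hY : IsWeakLS Y') (hd : dur Y' = dur Y)
    (hA : ∀ x ∈ A.getLast?, ∀ y ∈ Y'.head?, CBLe (dur Y') y.2 x.2) : IsWeakLS (A ++ Y') := by
  induction A with
  | nil => exact hY
  | cons x A ih =>
    refine ⟨h.1, ?_, ?_⟩
    · cases A with
      | nil => exact hY
      | cons y A => exact ih h.2.1 fun z hz => hA z (by simpa using hz)
    · cases A with
      | nil => exact fun y hy => hA x (by simp) y hy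
      | cons y A =>
        have := h.2.2
        simpa [hd] using this

theorem LSPath.isWeakLS (hlam : D.IsDominant lam) (p : D.LSPath lam) : IsWeakLS p.steps := by
  suffices ∀ L₁ L, p.steps = L₁ ++ L → IsWeakLS L from this [] _ rfl
  intro L₁ L
  induction L generalizing L₁ with
  | nil => intro; trivial
  | cons x L ih =>
    intro h
    refine ⟨p.pos x (by simp [h]), ih (L₁ ++ [x]) (by simp [h]), ?_⟩
    cases L with
    | nil => simp
    | cons y L =>
      intro z hz
      obtain rfl : y = z := by simpa using hz
      exact ((cosetBLt_iff hlam).1 (p.chain L₁ x y L h)).2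

theorem LSPath.dur_eq (p : D.LSPath lam) : dur p.steps = 1 := p.sum_eq_one

/-- No two consecutive directions are equal. -/
def IsReduced : List (D.Step lam) → Prop
  | [] => True
  | x :: L => IsReduced L ∧ ∀ y ∈ L.head?, y.2 ≠ x.2

theorem LSPath.isReduced (p : D.LSPath lam) : IsReduced p.steps := by
  suffices ∀ L₁ L, p.steps = L₁ ++ L → IsReduced L from this [] _ rfl
  intro L₁ L
  induction L generalizing L₁ with
  | nil => intro; trivial
  | cons x L ih =>
    intro h
    refine ⟨ih (L₁ ++ [x]) (by simp [h]), ?_⟩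
    cases L with
    | nil => simp
    | cons y L =>
      intro z hz
      obtain rfl : y = z := by simpa using hz
      exact (p.chain L₁ x y L h).1

theorem IsReduced.of_append {L K : List (D.Step lam)} (h : IsReduced (L ++ K)) : IsReduced K := by
  induction L with
  | nil => exact h
  | cons x L ih => exact ih h.1

/-- The LS path with the given steps. -/
def LSPath.ofIsWeakLS (hlam : D.IsDominant lam) (L : List (D.Step lam)) (h : IsWeakLS L)
    (h' : IsReduced L) (hd : dur L = 1) : D.LSPath lam where
  steps := L
  pos := h.pos
  sum_eq_one := hd
  chain := by
    rintro L₁ x y L₂ rfl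
    have h1 := h.of_append
    have h2 := h'.of_append
    exact (cosetBLt_iff hlam).2 ⟨h2.2 y rfl, h1.2.2 y rfl⟩

/-! ### Cutting and merging steps -/

/-- The steps of `B` are pieces of the step `x`. -/
def IsBlock (B : List (D.Step lam)) (x : D.Step lam) : Prop :=
  (∀ y ∈ B, 0 < y.1 ∧ y.2 = x.2) ∧ B ≠ [] ∧ (B.map Prod.fst).sum = x.1

theorem isCut_nil_iff {L : List (D.Step lam)} : IsCut L [] ↔ L = [] := by
  constructor
  · rintro ⟨bl, rfl, h⟩
    rw [List.forall₂_nil_right_iff] at h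
    simp [h]
  · rintro rfl
    exact ⟨[], rfl, .nil⟩

theorem isCut_cons_iff {L K : List (D.Step lam)} {x : D.Step lam} :
    IsCut L (x :: K) ↔ ∃ B L', L = B ++ L' ∧ IsBlock B x ∧ IsCut L' K := by
  constructor
  · rintro ⟨bl, rfl, h⟩
    rw [List.forall₂_cons_right_iff] at h
    obtain ⟨B, bl, hB, h, rfl⟩ := h
    exact ⟨B, bl.flatten, by simp, hB, bl, rfl, h⟩
  · rintro ⟨B, L', rfl, hB, bl, rfl, h⟩
    exact ⟨B :: bl, by simp, .cons hB h⟩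

theorem IsCut.append {L K L' K' : List (D.Step lam)} (h : IsCut L K) (h' : IsCut L' K') :
    IsCut (L ++ L') (K ++ K') := by
  obtain ⟨bl, rfl, h⟩ := h
  obtain ⟨bl', rfl, h'⟩ := h'
  exact ⟨bl ++ bl', by simp, List.rel_append h h'⟩

theorem isBlock_singleton {x : D.Step lam} (hx : 0 < x.1) : IsBlock [x] x := by
  refine ⟨?_, by simp, by simp⟩
  simpa using hx

theorem isCut_refl {L : List (D.Step lam)} (h : ∀ x ∈ L, 0 < x.1) : IsCut L L := by
  induction L with
  | nil => exact isCut_nil_iff.2 rfl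
  | cons x L ih => exact isCut_cons_iff.2 ⟨[x], L, rfl, isBlock_singleton (h x (by simp)),
      ih fun y hy => h y (by simp [hy])⟩

theorem IsBlock.dur_eq {B : List (D.Step lam)} {x : D.Step lam} (h : IsBlock B x) :
    dur B = x.1 := h.2.2

theorem height_of_forall_eq {B : List (D.Step lam)} {σ : D.Cosets lam} (h : ∀ y ∈ B, y.2 = σ) :
    height i B = dur B * cht i σ := by
  induction B with
  | nil => simp
  | cons x B ih =>
    rw [height_cons, dur_cons, ih fun y hy => h y (by simp [hy]), h x (by simp)]
    ring

theorem IsCut.dur_eq {L K : List (D.Step lam)} (h : IsCut L K) : dur L = dur K := by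
  induction K generalizing L with
  | nil => rw [isCut_nil_iff.1 h]
  | cons x K ih =>
    obtain ⟨B, L, rfl, hB, h⟩ := isCut_cons_iff.1 h
    rw [dur_append, dur_cons, ih h, hB.dur_eq]

theorem IsCut.height_eq {L K : List (D.Step lam)} (h : IsCut L K) : height i L = height i K := by
  induction K generalizing L with
  | nil => rw [isCut_nil_iff.1 h]
  | cons x K ih =>
    obtain ⟨B, L, rfl, hB, h⟩ := isCut_cons_iff.1 h
    rw [height_append, height_cons, ih h, height_of_forall_eq fun y hy => (hB.1 y hy).2, hB.dur_eq]

theorem IsCut.pos {L K : List (D.Step lam)} (h : IsCut L K) : ∀ x ∈ L, 0 < x.1 := by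
  induction K generalizing L with
  | nil => simp [isCut_nil_iff.1 h]
  | cons x K ih =>
    obtain ⟨B, L, rfl, hB, h⟩ := isCut_cons_iff.1 h
    intro y hy
    rcases List.mem_append.1 hy with hy | hy
    · exact (hB.1 y hy).1
    · exact ih h y hy

theorem IsCut.head_eq {L K : List (D.Step lam)} (h : IsCut L K) :
    L.head?.map Prod.snd = K.head?.map Prod.snd := by
  cases K with
  | nil => rw [isCut_nil_iff.1 h]
  | cons x K =>
    obtain ⟨B, L, rfl, hB, h⟩ := isCut_cons_iff.1 h
    cases B with
    | nil => exact absurd rfl hB.2.1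
    | cons y B => simpa using (hB.1 y (by simp)).2

theorem IsWeakLS.block_append {B L : List (D.Step lam)} {σ : D.Cosets lam}
    (hB : ∀ y ∈ B, 0 < y.1 ∧ y.2 = σ) (hL : IsWeakLS L)
    (h : ∀ y ∈ L.head?, CBLe (dur L) y.2 σ) : IsWeakLS (B ++ L) := by
  induction B with
  | nil => exact hL
  | cons x B ih =>
    refine ⟨(hB x (by simp)).1, ih fun y hy => hB y (by simp [hy]), ?_⟩
    rw [(hB x (by simp)).2]
    cases B with
    | nil => exact h
    | cons y B =>
      intro z hz
      obtain rfl : y = z := by simpa using hz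
      rw [(hB y (by simp)).2]
      exact .refl _

theorem IsWeakLS.of_isCut {L K : List (D.Step lam)} (hK : IsWeakLS K) (h : IsCut L K) :
    IsWeakLS L := by
  induction K generalizing L with
  | nil => rw [isCut_nil_iff.1 h]; trivial
  | cons x K ih =>
    obtain ⟨B, L, rfl, hB, h⟩ := isCut_cons_iff.1 h
    refine .block_append hB.1 (ih hK.2.1 h) fun y hy => ?_
    have h1 := h.head_eq
    rw [Option.mem_def.1 hy] at h1
    obtain ⟨z, hz, e⟩ := Option.map_eq_some_iff.1 h1.symm
    rw [h.dur_eq, ← e]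
    exact hK.2.2 z hz

open Classical in
/-- Join consecutive steps of the same direction. -/
noncomputable def merge : List (D.Step lam) → List (D.Step lam)
  | [] => []
  | x :: L => match merge L with
    | [] => [x]
    | y :: K => if y.2 = x.2 then (x.1 + y.1, x.2) :: K else x :: y :: K

theorem isCut_merge {L : List (D.Step lam)} (h : ∀ x ∈ L, 0 < x.1) : IsCut L (merge L) := by
  induction L with
  | nil => exact isCut_nil_iff.2 rfl
  | cons x L ih =>
    have hx := h x (by simp)
    have ih := ih fun y hy => h y (by simp [hy])
    rw [merge]
    split
    next e =>
      rw [e, isCut_nil_iff] at ih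
      rw [ih]
      exact isCut_cons_iff.2 ⟨[x], [], rfl, isBlock_singleton hx, isCut_nil_iff.2 rfl⟩
    next y K e =>
      rw [e] at ih
      split_ifs with hxy
      · obtain ⟨B, L', rfl, hB, h'⟩ := isCut_cons_iff.1 ih
        refine isCut_cons_iff.2 ⟨x :: B, L', rfl, ⟨?_, by simp, ?_⟩, h'⟩
        · intro z hz
          rcases List.mem_cons.1 hz with rfl | hz
          · exact ⟨hx, rfl⟩
          · exact ⟨(hB.1 z hz).1, (hB.1 z hz).2.trans hxy⟩
        · simpa using hB.2.2
      · exact isCut_cons_iff.2 ⟨[x], L, rfl, isBlock_singleton hx, ih⟩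

theorem isReduced_merge (L : List (D.Step lam)) : IsReduced (merge L) := by
  induction L with
  | nil => trivial
  | cons x L ih =>
    rw [merge]
    split
    next e => exact ⟨trivial, by simp⟩
    next y K e =>
      rw [e] at ih
      split_ifs with hxy
      · refine ⟨ih.1, ?_⟩
        rw [← hxy]
        exact ih.2
      · exact ⟨ih, by simpa using hxy⟩

theorem IsWeakLS.merge {L : List (D.Step lam)} (h : IsWeakLS L) : IsWeakLS (merge L) := by
  induction L with
  | nil => trivial
  | cons x L ih =>
    have hc := isCut_merge h.2.1.pos
    have ih := ih h.2.1
    rw [RootDatum.merge]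
    split
    next e => exact ⟨h.1, trivial, by simp⟩
    next y K e =>
      rw [e] at ih hc
      split_ifs with hxy
      · refine ⟨add_pos h.1 ih.1, ih.2.1, ?_⟩
        rw [← hxy]
        exact ih.2.2
      · refine ⟨h.1, ih, ?_⟩
        intro z hz
        obtain rfl : y = z := by simpa using hz
        have h1 := hc.head_eq
        obtain ⟨z, hz, e⟩ := Option.map_eq_some_iff.1 (h1.trans rfl : _ = some y.2)
        rw [← hc.dur_eq, ← e]
        exact h.2.2 z hz

/-- Reflecting pieces of cut steps yields sequences in which neighbours may have equal direction;
merging them returns to an LS path. -/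
theorem exists_lsPath (hlam : D.IsDominant lam) {L : List (D.Step lam)} (h : IsWeakLS L)
    (hd : dur L = 1) : ∃ p : D.LSPath lam, IsCut L p.steps :=
  ⟨.ofIsWeakLS hlam (merge L) h.merge (isReduced_merge L)
    (by rw [← (isCut_merge h.pos).dur_eq, hd]), isCut_merge h.pos⟩

/-! ### Integrality of local minima -/

/-- Modulo the integers, `b` times the height of the direction is the same on both sides of a
junction at `b`, so the sum telescopes. -/
theorem IsWeakLS.height_tail {x : D.Step lam} {L : List (D.Step lam)} (h : IsWeakLS (x :: L)) :
    ∃ n : ℤ, height i L = dur L * cht i x.2 + n := by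
  induction L generalizing x with
  | nil => exact ⟨0, by simp⟩
  | cons y L ih =>
    obtain ⟨n, hn⟩ := ih h.2.1
    obtain ⟨m, hm⟩ := (h.2.2 y rfl).exists_cht_eq i
    refine ⟨n - m, ?_⟩
    rw [height_cons, hn, dur_cons]
    rw [dur_cons] at hm
    push_cast
    linarith

theorem IsWeakLS.height_cons {x : D.Step lam} {L : List (D.Step lam)} (h : IsWeakLS (x :: L)) :
    ∃ n : ℤ, height i (x :: L) = dur (x :: L) * cht i x.2 + n := by
  obtain ⟨n, hn⟩ := h.height_tail (i := i)
  exact ⟨n, by rw [RootDatum.height_cons, hn, dur_cons]; ring⟩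

theorem IsWeakLS.height_total {L : List (D.Step lam)} (h : IsWeakLS L) (hd : dur L = 1) :
    ∃ n : ℤ, height i L = n := by
  cases L with
  | nil => exact ⟨0, by simp⟩
  | cons x L =>
    obtain ⟨n, hn⟩ := h.height_cons (i := i)
    rw [hd] at hn
    exact ⟨cht i x.2 + n, by rw [hn]; push_cast; ring⟩

/-- At a local minimum the height of the direction changes sign, so `b` times it is an integer
itself, not merely congruent across the junction. -/
theorem IsWeakLS.height_locMin (hlam : D.IsDominant lam) {x : D.Step lam} {L : List (D.Step lam)}
    (h : IsWeakLS (x :: L)) (hx : cht i x.2 ≤ 0) (hL : ∀ y ∈ L.head?, 0 ≤ cht i y.2) :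
    ∃ n : ℤ, height i L = n := by
  cases L with
  | nil => exact ⟨0, by simp⟩
  | cons y L =>
    obtain ⟨n, hn⟩ := h.2.1.height_cons (i := i)
    obtain ⟨m, hm⟩ := (h.2.2 y rfl).exists_int hlam (hL y rfl) hx
    exact ⟨m + n, by rw [hn, hm]; push_cast; rfl⟩

/-- Follow the path to the right while it falls strictly; it stops at a local minimum or at the end.
-/
theorem IsWeakLS.exists_locMin_right (hlam : D.IsDominant lam) {x : D.Step lam}
    {L : List (D.Step lam)} (h : IsWeakLS (x :: L)) (hx : cht i x.2 ≤ 0) :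
    ∃ Y Y', L = Y ++ Y' ∧ (∀ y ∈ Y, cht i y.2 < 0) ∧ ∃ n : ℤ, height i Y' = n := by
  induction L generalizing x with
  | nil => exact ⟨[], [], rfl, by simp, 0, by simp⟩
  | cons y L ih =>
    rcases le_or_gt 0 (cht i y.2) with hy | hy
    · exact ⟨[], y :: L, rfl, by simp, h.height_locMin hlam hx (by simpa using hy)⟩
    · obtain ⟨Y, Y', rfl, h1, h2⟩ := ih h.2.1 hy.le
      exact ⟨y :: Y, Y', rfl, by simpa using ⟨hy, by simpa using h1⟩, h2⟩

theorem IsWeakLS.exists_locMin_left (hlam : D.IsDominant lam) {x : D.Step lam}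
    {X Z : List (D.Step lam)} (h : IsWeakLS (X ++ x :: Z)) (hd : dur (X ++ x :: Z) = 1)
    (hx : 0 ≤ cht i x.2) : ∃ X₁ X₂, X = X₁ ++ X₂ ∧ (∀ y ∈ X₂, 0 < cht i y.2) ∧
      ∃ n : ℤ, height i (X₂ ++ x :: Z) = n := by
  induction X using List.reverseRecOn generalizing x Z with
  | nil => exact ⟨[], [], rfl, by simp, h.height_total hd⟩
  | append_singleton X w ih =>
    rw [List.append_assoc, List.singleton_append] at h hd
    rcases le_or_gt (cht i w.2) 0 with hw | hw
    · exact ⟨X ++ [w], [], by simp, by simp,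
        h.of_append.height_locMin hlam hw (by simpa using hx)⟩
    · obtain ⟨X₁, X₂, rfl, h1, h2⟩ := ih h hd hw.le
      refine ⟨X₁, X₂ ++ [w], by simp, ?_, by simpa using h2⟩
      intro y hy
      rcases List.mem_append.1 hy with hy | hy
      · exact h1 y hy
      · rw [List.mem_singleton.1 hy]; exact hw

end Lists
-- Paths as functions of time, independent of cutting.
section Functions
variable {I Λ : Type*} [AddCommGroup Λ] {D : RootDatum I Λ} {lam : Λ} {i : I}

variable (i) in
/-- The `i`-height at time `t`. -/
noncomputable def heightAt : List (D.Step lam) → ℚ → ℚ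
  | [], _ => 0
  | x :: L, t => if t ≤ x.1 then t * cht i x.2 else x.1 * cht i x.2 + heightAt L (t - x.1)

/-- The direction at time `t`. -/
noncomputable def dirAt : List (D.Step lam) → ℚ → Option (D.Cosets lam)
  | [], _ => none
  | x :: L, t => if t < x.1 then some x.2 else dirAt L (t - x.1)

theorem heightAt_zero {L : List (D.Step lam)} (hL : ∀ x ∈ L, 0 < x.1) : heightAt i L 0 = 0 := by
  cases L with
  | nil => rfl
  | cons x L => rw [heightAt, if_pos (hL x (by simp)).le, zero_mul]

theorem heightAt_append {X Y : List (D.Step lam)} (hX : ∀ x ∈ X, 0 < x.1) (hY : ∀ x ∈ Y, 0 < x.1)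
    {t : ℚ} (ht : 0 ≤ t) : heightAt i (X ++ Y) t =
      if t ≤ dur X then heightAt i X t else height i X + heightAt i Y (t - dur X) := by
  induction X generalizing t with
  | nil =>
    rcases ht.eq_or_lt with rfl | ht
    · simp [heightAt_zero hY, heightAt]
    · simp [not_le.2 ht]
  | cons x X ih =>
    have hX' : ∀ y ∈ X, 0 < y.1 := fun y hy => hX y (by simp [hy])
    have := dur_nonneg hX'
    rw [List.cons_append, heightAt, heightAt, dur_cons, height_cons]
    by_cases h1 : t ≤ x.1
    · rw [if_pos h1, if_pos (by linarith), if_pos h1]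
    · rw [if_neg h1, if_neg h1, ih hX' (by linarith)]
      by_cases h2 : t - x.1 ≤ dur X
      · rw [if_pos h2, if_pos (by linarith)]
      · rw [if_neg h2, if_neg (by linarith)]
        rw [sub_sub, add_assoc]

theorem heightAt_dur {L : List (D.Step lam)} (hL : ∀ x ∈ L, 0 < x.1) :
    heightAt i L (dur L) = height i L := by
  induction L with
  | nil => rfl
  | cons x L ih =>
    have hL' : ∀ y ∈ L, 0 < y.1 := fun y hy => hL y (by simp [hy])
    have := dur_nonneg hL'
    rw [heightAt, height_cons, dur_cons, add_sub_cancel_left, ih hL']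
    split_ifs with h
    · obtain h0 : dur L = 0 := by linarith
      cases L with
      | nil => simp
      | cons y L =>
        have h1 := hL' y (by simp)
        have h2 := dur_nonneg fun z (hz : z ∈ L) => hL' z (by simp [hz])
        rw [dur_cons] at h0
        linarith
    · rfl

theorem heightAt_append_dur {X Y : List (D.Step lam)} (hX : ∀ x ∈ X, 0 < x.1)
    (hY : ∀ x ∈ Y, 0 < x.1) : heightAt i (X ++ Y) (dur X) = height i X := by
  rw [heightAt_append hX hY (dur_nonneg hX), if_pos le_rfl, heightAt_dur hX]

theorem heightAt_block {B : List (D.Step lam)} {σ : D.Cosets lam}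
    (hB : ∀ y ∈ B, 0 < y.1 ∧ y.2 = σ) {t : ℚ} (ht : t ≤ dur B) (ht0 : 0 ≤ t) :
    heightAt i B t = t * cht i σ := by
  induction B generalizing t with
  | nil =>
    obtain rfl : t = 0 := le_antisymm ht ht0
    simp [heightAt]
  | cons x B ih =>
    rw [heightAt, (hB x (by simp)).2]
    rw [dur_cons] at ht
    split_ifs with h
    · rfl
    · rw [ih (fun y hy => hB y (by simp [hy])) (by linarith) (by linarith)]
      ring

theorem IsCut.heightAt_eq {L K : List (D.Step lam)} (h : IsCut L K) {t : ℚ} (ht : 0 ≤ t) :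
    heightAt i L t = heightAt i K t := by
  induction K generalizing L t with
  | nil => rw [isCut_nil_iff.1 h]
  | cons x K ih =>
    obtain ⟨B, L, rfl, hB, h⟩ := isCut_cons_iff.1 h
    rw [heightAt_append (fun y hy => (hB.1 y hy).1) h.pos ht, heightAt, hB.dur_eq]
    split_ifs with h1
    · exact heightAt_block hB.1 (by rwa [hB.dur_eq]) ht
    · rw [ih h (by linarith), height_of_forall_eq fun y hy => (hB.1 y hy).2, hB.dur_eq]

theorem dirAt_append {X Y : List (D.Step lam)} (hX : ∀ x ∈ X, 0 < x.1)
    {t : ℚ} (ht : 0 ≤ t) : dirAt (X ++ Y) t =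
      if t < dur X then dirAt X t else dirAt Y (t - dur X) := by
  induction X generalizing t with
  | nil => simp [not_lt.2 ht]
  | cons x X ih =>
    have hX' : ∀ y ∈ X, 0 < y.1 := fun y hy => hX y (by simp [hy])
    have := dur_nonneg hX'
    rw [List.cons_append, dirAt, dirAt, dur_cons]
    by_cases h1 : t < x.1
    · rw [if_pos h1, if_pos (by linarith), if_pos h1]
    · rw [if_neg h1, if_neg h1, ih hX' (by linarith)]
      by_cases h2 : t - x.1 < dur X
      · rw [if_pos h2, if_pos (by linarith)]
      · rw [if_neg h2, if_neg (by linarith), sub_sub]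

theorem dirAt_block {B : List (D.Step lam)} {σ : D.Cosets lam}
    (hB : ∀ y ∈ B, y.2 = σ) {t : ℚ} (ht : t < dur B) (ht0 : 0 ≤ t) : dirAt B t = some σ := by
  induction B generalizing t with
  | nil => exact absurd ht (not_lt.2 ht0)
  | cons x B ih =>
    rw [dirAt, hB x (by simp)]
    rw [dur_cons] at ht
    split_ifs with h
    · rfl
    · exact ih (fun y hy => hB y (by simp [hy])) (by linarith) (by linarith)

theorem IsCut.dirAt_eq {L K : List (D.Step lam)} (h : IsCut L K) {t : ℚ} (ht : 0 ≤ t) :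
    dirAt L t = dirAt K t := by
  induction K generalizing L t with
  | nil => rw [isCut_nil_iff.1 h]
  | cons x K ih =>
    obtain ⟨B, L, rfl, hB, h⟩ := isCut_cons_iff.1 h
    rw [dirAt_append (fun y hy => (hB.1 y hy).1) ht, dirAt, hB.dur_eq]
    split_ifs with h1
    · exact dirAt_block (fun y hy => (hB.1 y hy).2) (by rwa [hB.dur_eq]) ht
    · exact ih h (by linarith)

theorem dirAt_act (L : List (D.Step lam)) (t : ℚ) :
    dirAt (act i L) t = (dirAt L t).map fun σ => D.s i • σ := by
  induction L generalizing t with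
  | nil => rfl
  | cons x L ih =>
    rw [act_cons, dirAt, dirAt, ih]
    split_ifs <;> rfl

theorem heightAt_act (L : List (D.Step lam)) (t : ℚ) :
    heightAt i (act i L) t = -heightAt i L t := by
  induction L generalizing t with
  | nil => simp [heightAt]
  | cons x L ih =>
    rw [act_cons, heightAt, heightAt, ih, cht_s_smul]
    split_ifs <;> push_cast <;> ring

theorem dirAt_zero_ne {L : List (D.Step lam)} {σ : D.Cosets lam} (hL : ∀ x ∈ L, 0 < x.1)
    (h : ∀ y ∈ L.head?, y.2 ≠ σ) : dirAt L 0 ≠ some σ := by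
  cases L with
  | nil => simp [dirAt]
  | cons y L =>
    rw [dirAt, if_pos (hL y (by simp))]
    simpa using h

/-- A reduced sequence of steps is determined by its directions. -/
theorem IsReduced.eq_of_dirAt_eq {K K' : List (D.Step lam)} (h : IsReduced K) (h' : IsReduced K')
    (hK : ∀ x ∈ K, 0 < x.1) (hK' : ∀ x ∈ K', 0 < x.1)
    (e : ∀ t, 0 ≤ t → dirAt K t = dirAt K' t) : K = K' := by
  induction K generalizing K' with
  | nil =>
    cases K' with
    | nil => rfl
    | cons x K' =>
      have := e 0 le_rfl
      simp [dirAt, hK' x (by simp)] at this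
  | cons x K ih =>
    cases K' with
    | nil =>
      have := e 0 le_rfl
      simp [dirAt, hK x (by simp)] at this
    | cons y K' =>
      have hx := hK x (by simp)
      have hy := hK' y (by simp)
      have hKp : ∀ x ∈ K, 0 < x.1 := fun z hz => hK z (by simp [hz])
      have hKp' : ∀ x ∈ K', 0 < x.1 := fun z hz => hK' z (by simp [hz])
      have h2 : x.2 = y.2 := by simpa [dirAt, hx, hy] using e 0 le_rfl
      have h1 : x.1 = y.1 := by
        rcases lt_trichotomy x.1 y.1 with hlt | heq | hlt
        · have := e x.1 hx.le
          rw [dirAt, if_neg (lt_irrefl _), sub_self, dirAt, if_pos hlt, ← h2] at this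
          exact absurd this (dirAt_zero_ne hKp h.2)
        · exact heq
        · have := e y.1 hy.le
          rw [dirAt, if_pos hlt, dirAt, if_neg (lt_irrefl _), sub_self, h2] at this
          exact absurd this.symm (dirAt_zero_ne hKp' h'.2)
      rw [Prod.ext h1 h2, ih h.1 h'.1 hKp hKp' fun t ht => ?_]
      have := e (t + x.1) (by linarith)
      rw [dirAt, if_neg (by linarith), dirAt, if_neg (by linarith)] at this
      rwa [add_sub_cancel_right, ← h1, add_sub_cancel_right] at this

theorem LSPath.ext_of_dirAt {p q : D.LSPath lam}
    (e : ∀ t, 0 ≤ t → dirAt p.steps t = dirAt q.steps t) : p = q := by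
  have := p.isReduced.eq_of_dirAt_eq q.isReduced p.pos q.pos e
  cases p; cases q
  simpa using this

/-! ### From breakpoints to arbitrary times -/

theorem prefix_cons_cases {x : D.Step lam} {L : List (D.Step lam)}
    {Q : List (D.Step lam) → Prop} (h : ∀ X, X <+: x :: L → Q X) :
    Q [] ∧ ∀ X, X <+: L → Q (x :: X) :=
  ⟨h [] ⟨_, rfl⟩, fun X hX => h _ (by simpa using hX)⟩

/-- The height is linear on each step, so its minimum there is attained at an endpoint. -/
theorem le_heightAt {L : List (D.Step lam)} (hL : ∀ x ∈ L, 0 < x.1) {c : ℚ}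
    (h : ∀ X, X <+: L → c ≤ height i X) {t : ℚ} (ht : 0 ≤ t) : c ≤ heightAt i L t := by
  induction L generalizing c t with
  | nil => exact h [] ⟨_, rfl⟩
  | cons x L ih =>
    obtain ⟨h0, h1⟩ := prefix_cons_cases h
    have h2 := h1 [] ⟨_, rfl⟩
    rw [height_nil] at h0
    rw [height_cons, height_nil, add_zero] at h2
    rw [heightAt]
    split_ifs with h3
    · rcases le_total (0 : ℚ) (cht i x.2) with hc | hc
      · exact h0.trans (mul_nonneg ht hc)
      · exact h2.trans (mul_le_mul_of_nonpos_right h3 hc)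
    · have := ih (fun y hy => hL y (by simp [hy])) (c := c - x.1 * cht i x.2) (t := t - x.1)
        (fun X hX => by
          have := h1 X hX
          rw [height_cons] at this
          linarith) (by linarith)
      linarith

theorem lt_heightAt {L : List (D.Step lam)} (hL : ∀ x ∈ L, 0 < x.1) {c : ℚ} (hc : c ≤ 0)
    (h : ∀ X, X <+: L → X ≠ [] → c < height i X) {t : ℚ} (ht : 0 < t) (htL : t ≤ dur L) :
    c < heightAt i L t := by
  induction L generalizing c t with
  | nil => exact absurd htL (not_le.2 ht)
  | cons x L ih =>
    have h1 := (prefix_cons_cases h).2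
    have h2 := h1 [] ⟨_, rfl⟩ (by simp)
    rw [height_cons, height_nil, add_zero] at h2
    rw [heightAt]
    have hx := hL x (by simp)
    split_ifs with h3
    · rcases lt_or_ge (0 : ℚ) (cht i x.2) with hc' | hc'
      · exact hc.trans_lt (mul_pos ht hc')
      · exact h2.trans_le (mul_le_mul_of_nonpos_right h3 hc')
    · rw [dur_cons] at htL
      have := ih (fun y hy => hL y (by simp [hy])) (c := c - x.1 * cht i x.2) (t := t - x.1)
        (by linarith) (fun X hX _ => by
          have := h1 X hX (by simp)
          rw [height_cons] at this
          linarith) (by linarith) (by linarith)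
      linarith

theorem height_pos {B : List (D.Step lam)} (hB : ∀ x ∈ B, 0 < x.1 ∧ 0 < cht i x.2) (h : B ≠ []) :
    0 < height i B := by
  induction B with
  | nil => exact absurd rfl h
  | cons x B ih =>
    have hx := hB x (by simp)
    have h1 : 0 < x.1 * (cht i x.2 : ℚ) := mul_pos hx.1 (by exact_mod_cast hx.2)
    rw [height_cons]
    by_cases hB' : B = []
    · simpa [hB'] using h1
    · linarith [ih (fun y hy => hB y (by simp [hy])) hB']

theorem height_nonneg {B : List (D.Step lam)} (hB : ∀ x ∈ B, 0 < x.1 ∧ 0 < cht i x.2) :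
    0 ≤ height i B := by
  by_cases h : B = []
  · simp [h]
  · exact (height_pos hB h).le

theorem heightAt_pos {B : List (D.Step lam)} (hB : ∀ x ∈ B, 0 < x.1 ∧ 0 < cht i x.2) {t : ℚ}
    (ht : 0 < t) (htB : t ≤ dur B) : 0 < heightAt i B t :=
  lt_heightAt (fun x hx => (hB x hx).1) le_rfl
    (fun _ hX hX' => height_pos (fun x hx => hB x (hX.subset hx)) hX') ht htB

theorem heightAt_lt_height {B : List (D.Step lam)} (hB : ∀ x ∈ B, 0 < x.1 ∧ 0 < cht i x.2) {t : ℚ}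
    (ht : 0 ≤ t) (htB : t < dur B) : heightAt i B t < height i B := by
  induction B generalizing t with
  | nil => exact absurd htB (not_lt.2 ht)
  | cons x B ih =>
    have hB' : ∀ x ∈ B, 0 < x.1 ∧ 0 < cht i x.2 := fun y hy => hB y (by simp [hy])
    have hx : (0 : ℚ) < cht i x.2 := by exact_mod_cast (hB x (by simp)).2
    rw [heightAt, height_cons]
    split_ifs with h
    · rcases h.eq_or_lt with rfl | h
      · have : B ≠ [] := by
          rintro rfl
          simp at htB
        linarith [height_pos hB' this]
      · have := height_nonneg hB'
        have := mul_lt_mul_of_pos_right h hx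
        linarith
    · rw [dur_cons] at htB
      have := ih hB' (t := t - x.1) (by linarith) (by linarith)
      linarith

end Functions

/-! ### The root operators on cut paths. -/

section Arrows
variable {I Λ : Type*} [AddCommGroup Λ] {D : RootDatum I Λ} {lam : Λ} {i : I}

theorem prefix_append_iff {α : Type*} {X A K : List α} :
    X <+: A ++ K ↔ X <+: A ∨ ∃ Y, X = A ++ Y ∧ Y <+: K := by
  constructor
  · intro h
    obtain ⟨T, hT⟩ := h
    rcases List.append_eq_append_iff.1 hT with ⟨Y, rfl, -⟩ | ⟨Y, rfl, hY⟩
    · exact .inl ⟨Y, rfl⟩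
    · exact .inr ⟨Y, rfl, T, hY.symm⟩
  · rintro (h | ⟨Y, rfl, h⟩)
    · exact h.trans (List.prefix_append _ _)
    · exact (List.prefix_append_right_inj A).2 h

variable (i) in
/-- The sequence of steps `A ++ B ++ C` is cut in such a way that `fᵢ` reflects `B`. -/
structure IsArrowCut (A B C : List (D.Step lam)) : Prop where
  weak : IsWeakLS (A ++ B ++ C)
  dur_eq : dur (A ++ B ++ C) = 1
  le_A : ∀ X, X <+: A → height i A ≤ height i X
  pos_BC : ∀ X, X <+: B ++ C → X ≠ [] → 0 < height i X
  pos_B : ∀ x ∈ B, 0 < x.1 ∧ 0 < cht i x.2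
  height_B : height i B = 1

theorem Arrow.exists_cut (hlam : D.IsDominant lam) {p q : D.LSPath lam} (h : Arrow i p q) :
    ∃ A B C, IsArrowCut i A B C ∧ IsCut (A ++ B ++ C) p.steps ∧
      IsCut (A ++ act i B ++ C) q.steps := by
  obtain ⟨A, B, C, hp, hq, h1, h2, h3, h4⟩ := h
  refine ⟨A, B, C, ⟨(p.isWeakLS hlam).of_isCut hp, hp.dur_eq.trans p.dur_eq, h1, h2,
    fun x hx => ?_, h4⟩, hp, hq⟩
  have h0 := hp.pos x (by simp [hx])
  exact ⟨h0, (stepHeight_pos_iff h0).1 (h3 x hx)⟩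

theorem IsArrowCut.arrow {A B C : List (D.Step lam)} (h : IsArrowCut i A B C) {p q : D.LSPath lam}
    (hp : IsCut (A ++ B ++ C) p.steps) (hq : IsCut (A ++ act i B ++ C) q.steps) : Arrow i p q :=
  ⟨A, B, C, hp, hq, h.le_A, h.pos_BC,
    fun x hx => (stepHeight_pos_iff (h.pos_B x hx).1).2 (h.pos_B x hx).2, h.height_B⟩

theorem cht_getLast_nonpos {A : List (D.Step lam)} (hA : ∀ x ∈ A, 0 < x.1)
    (h : ∀ X, X <+: A → height i A ≤ height i X) : ∀ x ∈ A.getLast?, cht i x.2 ≤ 0 := by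
  intro x hx
  obtain ⟨A, rfl⟩ := List.getLast?_eq_some_iff.1 hx
  have h1 := h A (List.prefix_append _ _)
  rw [height_append, height_cons, height_nil] at h1
  have h2 : x.1 * (cht i x.2 : ℚ) ≤ 0 := by linarith
  have h3 := nonpos_of_mul_nonpos_right h2 (hA x (by simp))
  exact_mod_cast h3

theorem cht_head_pos {L : List (D.Step lam)} (hL : ∀ x ∈ L, 0 < x.1)
    (h : ∀ X, X <+: L → X ≠ [] → 0 < height i X) : ∀ x ∈ L.head?, 0 < cht i x.2 := by
  intro x hx
  obtain ⟨L, rfl⟩ := List.head?_eq_some_iff.1 hx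
  have h1 := h [x] (by simp) (by simp)
  rw [height_cons, height_nil, add_zero] at h1
  exact_mod_cast (mul_pos_iff_of_pos_left (hL x (by simp))).1 h1

/-- Heights at local minima are integral. -/
theorem IsWeakLS.height_left_int (hlam : D.IsDominant lam) {A L : List (D.Step lam)}
    (h : IsWeakLS (A ++ L)) (hd : dur (A ++ L) = 1) (hA : ∀ x ∈ A.getLast?, cht i x.2 ≤ 0)
    (hL : ∀ x ∈ L.head?, 0 ≤ cht i x.2) : ∃ n : ℤ, height i A = n := by
  rcases List.eq_nil_or_concat A with rfl | ⟨A, x, rfl⟩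
  · exact ⟨0, by simp⟩
  · obtain ⟨m, hm⟩ := h.height_total (i := i) hd
    rw [List.concat_eq_append, List.append_assoc, List.singleton_append] at h
    obtain ⟨n, hn⟩ := h.of_append.height_locMin hlam (hA x (by simp)) hL
    refine ⟨m - n, ?_⟩
    rw [height_append] at hm
    push_cast
    linarith

variable (i) in
theorem exists_last_min (L : List (D.Step lam)) : ∃ A K, L = A ++ K ∧
    (∀ X, X <+: A → height i A ≤ height i X) ∧ ∀ X, X <+: K → X ≠ [] → 0 < height i X := by
  induction L with
  | nil => exact ⟨[], [], rfl, by simp, fun X h h' => absurd (List.prefix_nil.1 h) h'⟩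
  | cons x L ih =>
    obtain ⟨A, K, rfl, h1, h2⟩ := ih
    by_cases hx : x.1 * cht i x.2 + height i A ≤ 0
    · refine ⟨x :: A, K, rfl, fun X hX => ?_, h2⟩
      rcases List.prefix_cons_iff.1 hX with rfl | ⟨X, rfl, hXL⟩
      · simpa using hx
      · rw [height_cons, height_cons]
        linarith [h1 X hXL]
    · refine ⟨[], x :: (A ++ K), rfl, by simp, fun X hX hX' => ?_⟩
      rcases List.prefix_cons_iff.1 hX with rfl | ⟨X, rfl, hXL⟩
      · exact absurd rfl hX'
      · rw [height_cons]
        have : height i A ≤ height i X := by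
          rcases prefix_append_iff.1 hXL with h | ⟨Y, rfl, hY⟩
          · exact h1 X h
          · rw [height_append]
            by_cases hY' : Y = []
            · simp [hY']
            · linarith [h2 Y hY hY']
        linarith

variable (i) in
theorem exists_first_min (L : List (D.Step lam)) : ∃ A K, L = A ++ K ∧
    (∀ X, X <+: A → X ≠ A → height i A < height i X) ∧ ∀ X, X <+: K → 0 ≤ height i X := by
  induction L with
  | nil => exact ⟨[], [], rfl, by simp, by simp⟩
  | cons x L ih =>
    obtain ⟨A, K, rfl, h1, h2⟩ := ih
    have h1' : ∀ X, X <+: A → height i A ≤ height i X := fun X hX => by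
      by_cases h : X = A
      · rw [h]
      · exact (h1 X hX h).le
    by_cases hx : x.1 * cht i x.2 + height i A < 0
    · refine ⟨x :: A, K, rfl, fun X hX hne => ?_, h2⟩
      rcases List.prefix_cons_iff.1 hX with rfl | ⟨X, rfl, hXL⟩
      · simpa using hx
      · rw [height_cons, height_cons]
        linarith [h1 X hXL fun e => hne (by rw [e])]
    · refine ⟨[], x :: (A ++ K), rfl, by simp, fun X hX => ?_⟩
      rcases List.prefix_cons_iff.1 hX with rfl | ⟨X, rfl, hXL⟩
      · simp
      · rw [height_cons]
        have : height i A ≤ height i X := by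
          rcases prefix_append_iff.1 hXL with h | ⟨Y, rfl, hY⟩
          · exact h1' X h
          · rw [height_append]
            linarith [h2 Y hY]
        linarith

theorem IsArrowCut.B_ne_nil {A B C : List (D.Step lam)} (h : IsArrowCut i A B C) : B ≠ [] := by
  rintro rfl
  simpa using h.height_B

theorem IsArrowCut.pos_A {A B C : List (D.Step lam)} (h : IsArrowCut i A B C) :
    ∀ x ∈ A, 0 < x.1 := fun x hx => h.weak.pos x (by simp [hx])

theorem IsArrowCut.pos_C {A B C : List (D.Step lam)} (h : IsArrowCut i A B C) :
    ∀ x ∈ C, 0 < x.1 := fun x hx => h.weak.pos x (by simp [hx])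

theorem IsArrowCut.head_pos {A B C : List (D.Step lam)} (h : IsArrowCut i A B C) :
    ∀ x ∈ (B ++ C).head?, 0 < cht i x.2 :=
  cht_head_pos (fun x hx => h.weak.pos x (by simpa using .inr (List.mem_append.1 hx))) h.pos_BC

theorem IsArrowCut.height_A_int (hlam : D.IsDominant lam) {A B C : List (D.Step lam)}
    (h : IsArrowCut i A B C) : ∃ n : ℤ, height i A = n := by
  have h1 := h.weak
  have h2 := h.dur_eq
  rw [List.append_assoc] at h1 h2
  exact h1.height_left_int hlam h2 (cht_getLast_nonpos h.pos_A h.le_A)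
    fun x hx => (h.head_pos x hx).le

/-- After `B` the path stays at least 1 above its minimum: the lowest point of `C` is a local
minimum, so its height above the end of `A` is a positive integer. -/
theorem IsArrowCut.height_C_nonneg (hlam : D.IsDominant lam) {A B C : List (D.Step lam)}
    (h : IsArrowCut i A B C) : ∀ X, X <+: C → 0 ≤ height i X := by
  obtain ⟨C₁, C₂, rfl, h1, h2⟩ := exists_last_min i C
  suffices 0 ≤ height i C₁ by
    intro X hX
    rcases prefix_append_iff.1 hX with h | ⟨Y, rfl, hY⟩
    · exact this.trans (h1 X h)
    · rw [height_append]
      by_cases hY' : Y = []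
      · simpa [hY'] using this
      · linarith [h2 Y hY hY']
  by_cases hC : C₁ = []
  · simp [hC]
  have e : A ++ B ++ (C₁ ++ C₂) = (A ++ B ++ C₁) ++ C₂ := by simp
  obtain ⟨n, hn⟩ := h.height_A_int hlam
  obtain ⟨m, hm⟩ := (e ▸ h.weak).height_left_int (i := i) hlam (e ▸ h.dur_eq) (by
      intro x hx
      refine cht_getLast_nonpos (fun y hy => h.pos_C y (by simp [hy])) h1 x ?_
      rwa [List.getLast?_append_of_ne_nil _ hC] at hx)
    (fun x hx => (cht_head_pos (fun y hy => h.pos_C y (by simp [hy])) h2 x hx).le)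
  have h3 := h.pos_BC (B ++ C₁) (by rw [← List.append_assoc]; exact List.prefix_append _ _)
    (by simp [hC])
  rw [height_append, h.height_B] at h3
  rw [height_append, height_append, h.height_B, hn] at hm
  have h4 : (height i C₁ : ℚ) = ((m - n - 1 : ℤ) : ℚ) := by push_cast; linarith
  rw [h4] at h3 ⊢
  norm_cast at h3 ⊢
  omega

/-! ### Existence of `fᵢ p` and `eᵢ p` -/

/-- Cutting a monotone sequence of steps at a given height. -/
theorem exists_isCut_height {P : List (D.Step lam)} {e c : ℚ}
    (hP : ∀ x ∈ P, 0 < x.1 ∧ 0 < e * cht i x.2) (hc : 0 ≤ c) (hcP : c ≤ e * height i P) :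
    ∃ B C, IsCut (B ++ C) P ∧ e * height i B = c ∧ (∀ x ∈ B, 0 < x.1 ∧ 0 < e * cht i x.2) ∧
      ∀ x ∈ C, 0 < x.1 ∧ 0 < e * cht i x.2 := by
  induction P generalizing c with
  | nil =>
    refine ⟨[], [], isCut_nil_iff.2 rfl, ?_, by simp, by simp⟩
    simp at hcP ⊢
    linarith
  | cons x P ih =>
    have hx := hP x (by simp)
    have hP' : ∀ x ∈ P, 0 < x.1 ∧ 0 < e * cht i x.2 := fun y hy => hP y (by simp [hy])
    have hcut := isCut_refl fun y hy => (hP' y hy).1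
    rcases hc.eq_or_lt with rfl | hc
    · exact ⟨[], x :: P, isCut_refl fun y hy => (hP y hy).1, by simp, by simp, hP⟩
    rcases lt_trichotomy c (x.1 * (e * cht i x.2)) with h | h | h
    · have h1 : 0 < c / (e * cht i x.2) := div_pos hc hx.2
      have h2 : 0 < x.1 - c / (e * cht i x.2) := by
        rw [sub_pos, div_lt_iff₀ hx.2]
        exact h
      -- The cut falls inside this step; the quotient is the time it takes to cover the remaining
      -- height `c`.
      refine ⟨[(c / (e * cht i x.2), x.2)], (x.1 - c / (e * cht i x.2), x.2) :: P,
        isCut_cons_iff.2 ⟨[(c / (e * cht i x.2), x.2), (x.1 - c / (e * cht i x.2), x.2)], P, by simp,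
          ⟨by simp [h1, h2], by simp, by simp⟩, hcut⟩, ?_, ?_, ?_⟩
      · rw [height_cons, height_nil, add_zero, mul_left_comm, div_mul_cancel₀ _ hx.2.ne']
      · simpa using ⟨h1, hx.2⟩
      · intro y hy
        rcases List.mem_cons.1 hy with rfl | hy
        · exact ⟨h2, hx.2⟩
        · exact hP' y hy
    · refine ⟨[x], P, isCut_refl fun y hy => (hP y hy).1, ?_, ?_, hP'⟩
      · rw [h, height_cons, height_nil]
        ring
      · intro y hy
        rw [List.mem_singleton.1 hy]
        exact hx
    · rw [height_cons] at hcP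
      obtain ⟨B, C, h1, h2, h3, h4⟩ := ih hP' (c := c - x.1 * (e * cht i x.2)) (by linarith)
        (by linarith)
      refine ⟨x :: B, C, isCut_cons_iff.2 ⟨[x], B ++ C, rfl, isBlock_singleton hx.1, h1⟩, ?_, ?_, h4⟩
      · rw [height_cons, mul_add, h2]
        ring
      · intro y hy
        rcases List.mem_cons.1 hy with rfl | hy
        · exact hx
        · exact h3 y hy

theorem exists_span (Q : D.Step lam → Prop) (L : List (D.Step lam)) : ∃ P R, L = P ++ R ∧
    (∀ x ∈ P, Q x) ∧ ∀ x ∈ R.head?, ¬Q x := by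
  induction L with
  | nil => exact ⟨[], [], rfl, by simp, by simp⟩
  | cons x L ih =>
    by_cases hx : Q x
    · obtain ⟨P, R, rfl, h1, h2⟩ := ih
      exact ⟨x :: P, R, rfl, by simpa using ⟨hx, by simpa using h1⟩, h2⟩
    · exact ⟨[], x :: L, rfl, by simp, by simpa using hx⟩

theorem exists_span_right (Q : D.Step lam → Prop) (L : List (D.Step lam)) : ∃ R P, L = R ++ P ∧
    (∀ x ∈ P, Q x) ∧ ∀ x ∈ R.getLast?, ¬Q x := by
  obtain ⟨P, R, h, h1, h2⟩ := exists_span Q L.reverse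
  refine ⟨R.reverse, P.reverse, ?_, by simpa using h1, by simpa using h2⟩
  rw [← List.reverse_append, ← h, List.reverse_reverse]

/-- Inside `B` neighbouring directions are both of positive height and are reflected together. At
the end of `B` integrality of the height of `C` makes the last direction `x` lie below `sᵢ x`. -/
theorem IsWeakLS.act_append_of_pos (hlam : D.IsDominant lam) {B C : List (D.Step lam)}
    (h : IsWeakLS (B ++ C)) (hB : ∀ x ∈ B, 0 < x.1 ∧ 0 < cht i x.2)
    (hC : ∃ n : ℤ, height i C = n) : IsWeakLS (act i B ++ C) := by
  induction B with
  | nil => exact h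
  | cons x B ih =>
    have hx := hB x (by simp)
    refine ⟨hx.1, ih h.2.1 fun y hy => hB y (by simp [hy]), ?_⟩
    cases B with
    | nil =>
      intro y hy
      obtain ⟨n, hn⟩ := hC
      obtain ⟨m, hm⟩ := IsWeakLS.height_tail (i := i) h
      refine (h.2.2 y hy).trans hlam (cBLe_s_smul hlam hx.2 ⟨n - m, ?_⟩)
      change height i C = dur C * _ + _ at hm
      change dur C * _ = _
      rw [hn] at hm
      push_cast
      linarith
    | cons z B =>
      intro y hy
      change y ∈ (act i (z :: B) ++ C).head? at hy
      simp only [act_cons, List.cons_append, List.head?_cons, Option.mem_some_iff] at hy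
      subst hy
      have := (h.2.2 z rfl).s_smul_of_pos hlam (i := i) (hB z (by simp)).2 hx.2
      change CBLe (dur (act i (z :: B) ++ C)) _ _
      change CBLe (dur (z :: B ++ C)) _ _ at this
      simpa using this

theorem IsWeakLS.act_append_of_neg (hlam : D.IsDominant lam) {B C : List (D.Step lam)}
    (h : IsWeakLS (B ++ C)) (hB : ∀ x ∈ B, 0 < x.1 ∧ cht i x.2 < 0)
    (hC : ∀ x ∈ C.head?, 0 ≤ cht i x.2) : IsWeakLS (act i B ++ C) := by
  induction B with
  | nil => exact h
  | cons x B ih =>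
    have hx := hB x (by simp)
    refine ⟨hx.1, ih h.2.1 fun y hy => hB y (by simp [hy]), ?_⟩
    cases B with
    | nil => exact fun y hy => (h.2.2 y hy).s_smul_right hlam (hC y hy) hx.2
    | cons z B =>
      intro y hy
      change y ∈ (act i (z :: B) ++ C).head? at hy
      simp only [act_cons, List.cons_append, List.head?_cons, Option.mem_some_iff] at hy
      subst hy
      have := (h.2.2 z rfl).s_smul_of_neg hlam (i := i) (hB z (by simp)).2 hx.2
      change CBLe (dur (act i (z :: B) ++ C)) _ _
      change CBLe (dur (z :: B ++ C)) _ _ at this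
      simpa using this

/-- The new junction is the one between `A` and `B`: the last direction of `A` has nonpositive
height, so it still lies above the reflected first direction of `B`. -/
theorem IsArrowCut.isWeakLS_act (hlam : D.IsDominant lam) {A B C : List (D.Step lam)}
    (h : IsArrowCut i A B C) : IsWeakLS (A ++ act i B ++ C) := by
  have hw := h.weak
  rw [List.append_assoc] at hw ⊢
  obtain ⟨n, hn⟩ := h.height_A_int hlam
  obtain ⟨m, hm⟩ := h.weak.height_total (i := i) h.dur_eq
  refine hw.replace_suffix (hw.of_append.act_append_of_pos hlam h.pos_B ⟨m - n - 1, ?_⟩)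
    (by simp) fun x hx y hy => ?_
  · rw [height_append, height_append, h.height_B, hn] at hm
    push_cast
    linarith
  · obtain ⟨A, rfl⟩ := List.getLast?_eq_some_iff.1 hx
    obtain ⟨z, B, rfl⟩ := List.exists_cons_of_ne_nil h.B_ne_nil
    simp only [act_cons, List.cons_append, List.head?_cons, Option.mem_some_iff] at hy
    subst hy
    have h1 : IsWeakLS (x :: z :: (B ++ C)) :=
      IsWeakLS.of_append (L := A) (by simpa using hw)
    have := (h1.2.2 z rfl).s_smul_left hlam (i := i) (h.pos_B z (by simp)).2
      (cht_getLast_nonpos h.pos_A h.le_A x hx)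
    simpa using this

/-- Past the last minimum the path rises. The next local minimum, or else the end, lies above it by
an integer, so the first rising run gains at least 1 and can be cut at height 1. -/
theorem exists_arrow_from (hlam : D.IsDominant lam) {p : D.LSPath lam} {X : List (D.Step lam)}
    (hX : X <+: p.steps) (hlt : height i X < height i p.steps) : ∃ q, Arrow i p q := by
  obtain ⟨A, K, hAK, hA, hK⟩ := exists_last_min i p.steps
  have hw := p.isWeakLS hlam
  have hd := p.dur_eq
  rw [hAK] at hX hlt hw hd
  have posA : ∀ x ∈ A, 0 < x.1 := fun x hx => hw.pos x (by simp [hx])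
  have posK : ∀ x ∈ K, 0 < x.1 := fun x hx => hw.pos x (by simp [hx])
  have hKpos : 0 < height i K := by
    have : height i A ≤ height i X := by
      rcases prefix_append_iff.1 hX with h | ⟨Y, rfl, hY⟩
      · exact hA X h
      · rw [height_append]
        by_cases hY' : Y = []
        · simp [hY']
        · linarith [hK Y hY hY']
    rw [height_append] at hlt
    linarith
  obtain ⟨n, hn⟩ := hw.height_left_int (i := i) hlam hd (cht_getLast_nonpos posA hA)
    fun x hx => (cht_head_pos posK hK x hx).le
  obtain ⟨m, hm⟩ := hw.height_total (i := i) hd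
  rw [height_append] at hm
  obtain ⟨P, R, rfl, hP, hR⟩ := exists_span (fun x => 0 < cht i x.2) K
  have hP' : ∀ x ∈ P, 0 < x.1 ∧ (0 : ℚ) < 1 * cht i x.2 := fun x hx =>
    ⟨posK x (by simp [hx]), by rw [one_mul]; exact_mod_cast hP x hx⟩
  have hP1 : 1 ≤ height i P := by
    by_contra hlt1
    rw [not_le] at hlt1
    -- A point of integral height after the last minimum cannot lie strictly between 0 and 1 above
    -- it.
    have key : ∀ Y Y', P ++ R = Y ++ Y' → Y ≠ [] → height i Y ≤ height i P →
        (∃ n : ℤ, height i Y' = n) → False := by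
      rintro Y Y' e hY hYP ⟨l, hl⟩
      have h1 := hK Y (e ▸ List.prefix_append _ _) hY
      have h2 : height i Y = ((m - n - l : ℤ) : ℚ) := by
        rw [e, height_append] at hm
        push_cast
        linarith
      have h3 : height i Y < 1 := by linarith
      rw [h2] at h1 h3
      norm_cast at h1 h3
      omega
    cases R with
    | nil =>
      refine key P [] rfl ?_ le_rfl ⟨0, by simp⟩
      rintro rfl
      simp at hKpos
    | cons x R =>
      have hx : cht i x.2 ≤ 0 := not_lt.1 (hR x rfl)
      obtain ⟨Y, Y', rfl, hY, hY'⟩ := hw.of_append.of_append.exists_locMin_right hlam hx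
      refine key (P ++ x :: Y) Y' (by simp) (by simp) ?_ hY'
      have h1 : x.1 * (cht i x.2 : ℚ) ≤ 0 :=
        mul_nonpos_of_nonneg_of_nonpos (posK x (by simp)).le (by exact_mod_cast hx)
      have h2 : height i Y ≤ 0 := by
        have := height_nonneg (i := i) (B := act i Y) (by
          intro y hy
          obtain ⟨z, hz, rfl⟩ := List.mem_map.1 hy
          refine ⟨posK z (by simp [hz]), ?_⟩
          have := hY z hz
          rw [cht_s_smul]
          omega)
        rw [height_act] at this
        linarith
      rw [height_append, height_cons]
      linarith
  obtain ⟨B, C, hBC, hB1, hB, hC⟩ := exists_isCut_height hP' zero_le_one (by rwa [one_mul])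
  have hB' : ∀ x ∈ B, 0 < x.1 ∧ 0 < cht i x.2 := fun x hx =>
    ⟨(hB x hx).1, by have := (hB x hx).2; rw [one_mul] at this; exact_mod_cast this⟩
  have hC' : ∀ x ∈ C, 0 < x.1 ∧ 0 < cht i x.2 := fun x hx =>
    ⟨(hC x hx).1, by have := (hC x hx).2; rw [one_mul] at this; exact_mod_cast this⟩
  rw [one_mul] at hB1
  have hcut : IsCut (A ++ B ++ (C ++ R)) p.steps := by
    rw [hAK, show A ++ B ++ (C ++ R) = A ++ (B ++ C ++ R) by simp]
    exact (isCut_refl posA).append (hBC.append (isCut_refl fun x hx => posK x (by simp [hx])))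
  have harr : IsArrowCut i A B (C ++ R) := by
    refine ⟨(p.isWeakLS hlam).of_isCut hcut, hcut.dur_eq.trans p.dur_eq, hA, fun Y hY hY' => ?_,
      hB', hB1⟩
    rcases prefix_append_iff.1 hY with h | ⟨Y, rfl, hYC⟩
    · exact height_pos (fun x hx => hB' x (h.subset hx)) hY'
    rw [height_append, hB1]
    rcases prefix_append_iff.1 hYC with h | ⟨Y, rfl, hYR⟩
    · linarith [height_nonneg fun x hx => hC' x (h.subset hx)]
    · have h1 := hK (P ++ Y) ((List.prefix_append_right_inj P).2 hYR) (by
        intro e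
        rw [(List.append_eq_nil_iff.1 e).1] at hP1
        norm_num at hP1)
      have h2 := hBC.height_eq (i := i)
      rw [height_append] at h1 h2 ⊢
      linarith
  obtain ⟨q, hq⟩ := exists_lsPath hlam (harr.isWeakLS_act hlam) (by
    have := harr.dur_eq
    simpa using this)
  exact ⟨q, harr.arrow hcut hq⟩

/-- Mirror image of `exists_arrow_from`: use the first minimum and reflect the last unit of the
falling run that leads to it. -/
theorem exists_arrow_to (hlam : D.IsDominant lam) {p : D.LSPath lam} {X : List (D.Step lam)}
    (hX : X <+: p.steps) (hlt : height i X < 0) : ∃ r, Arrow i r p := by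
  obtain ⟨A, K, hAK, hA, hK⟩ := exists_first_min i p.steps
  have hw := p.isWeakLS hlam
  have hd := p.dur_eq
  rw [hAK] at hX hw hd
  have posA : ∀ x ∈ A, 0 < x.1 := fun x hx => hw.pos x (by simp [hx])
  have posK : ∀ x ∈ K, 0 < x.1 := fun x hx => hw.pos x (by simp [hx])
  have hA' : ∀ X, X <+: A → height i A ≤ height i X := fun X hX => by
    by_cases h : X = A
    · rw [h]
    · exact (hA X hX h).le
  have hK' : ∀ x ∈ K.head?, 0 ≤ cht i x.2 := by
    intro x hx
    obtain ⟨K, rfl⟩ := List.head?_eq_some_iff.1 hx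
    have h1 := hK [x] (by simp)
    rw [height_cons, height_nil, add_zero] at h1
    exact_mod_cast nonneg_of_mul_nonneg_right h1 (posK x (by simp))
  have hAneg : height i A < 0 := by
    refine lt_of_le_of_lt ?_ hlt
    rcases prefix_append_iff.1 hX with h | ⟨Y, rfl, hY⟩
    · exact hA' X h
    · rw [height_append]
      linarith [hK Y hY]
  obtain ⟨n, hn⟩ := hw.height_left_int (i := i) hlam hd (cht_getLast_nonpos posA hA') hK'
  obtain ⟨m, hm⟩ := hw.height_total (i := i) hd
  have hn1 : n ≤ -1 := by
    rw [hn] at hAneg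
    norm_cast at hAneg
    omega
  obtain ⟨R, P, rfl, hP, hR⟩ := exists_span_right (fun x => cht i x.2 < 0) A
  have hP' : ∀ x ∈ P, 0 < x.1 ∧ (0 : ℚ) < -1 * cht i x.2 := fun x hx =>
    ⟨posA x (by simp [hx]), by
      have h1 : (cht i x.2 : ℚ) < 0 := by exact_mod_cast hP x hx
      linarith⟩
  -- If the last fall were shorter, going left over the preceding rise would reach a local minimum
  -- of integral height strictly between `n` and `n + 1`.
  have hP1 : height i P ≤ -1 := by
    by_contra hlt1
    rw [not_le] at hlt1
    rcases List.eq_nil_or_concat R with rfl | ⟨R, x, rfl⟩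
    · rw [List.nil_append] at hn hAneg
      rw [hn] at hlt1 hAneg
      norm_cast at hlt1 hAneg
      omega
    · rw [List.concat_eq_append] at *
      have hx : 0 ≤ cht i x.2 := not_lt.1 (hR x (by simp))
      have e : R ++ [x] ++ P ++ K = R ++ x :: (P ++ K) := by simp
      obtain ⟨X₁, X₂, rfl, h1, l, hl⟩ := (e ▸ hw).exists_locMin_left hlam (e ▸ hd) hx
      have h2 := hA X₁ (by simp) (by simp)
      have h3 : 0 ≤ x.1 * (cht i x.2 : ℚ) :=
        mul_nonneg (posA x (by simp)).le (by exact_mod_cast hx)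
      have h4 : 0 ≤ height i X₂ := height_nonneg fun y hy => ⟨posA y (by simp [hy]), h1 y hy⟩
      simp only [height_append, height_cons, height_nil] at hm hl h2 hn
      have h5 : height i X₁ = ((m - l : ℤ) : ℚ) := by push_cast; linarith
      have h6 : (n : ℚ) < ((m - l : ℤ) : ℚ) := by rw [← h5, ← hn]; linarith
      have h7 : ((m - l : ℤ) : ℚ) < ((n + 1 : ℤ) : ℚ) := by
        rw [← h5]
        push_cast
        rw [← hn]
        linarith
      norm_cast at h6 h7
      omega
  obtain ⟨C, B, hCB, hC1, hC, hB⟩ := exists_isCut_height hP' (c := -height i P - 1) (by linarith)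
    (by linarith)
  have hB' : ∀ x ∈ B, 0 < x.1 ∧ cht i x.2 < 0 := fun x hx =>
    ⟨(hB x hx).1, by
      have h1 := (hB x hx).2
      have h2 : (cht i x.2 : ℚ) < 0 := by linarith
      exact_mod_cast h2⟩
  have hC' : ∀ x ∈ C, 0 < x.1 ∧ cht i x.2 < 0 := fun x hx =>
    ⟨(hC x hx).1, by
      have h1 := (hC x hx).2
      have h2 : (cht i x.2 : ℚ) < 0 := by linarith
      exact_mod_cast h2⟩
  have neg_sum : ∀ Y : List (D.Step lam), (∀ x ∈ Y, 0 < x.1 ∧ cht i x.2 < 0) →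
      height i Y ≤ 0 := fun Y hY => by
    have := height_nonneg (i := i) (B := act i Y) (by
      intro y hy
      obtain ⟨z, hz, rfl⟩ := List.mem_map.1 hy
      refine ⟨(hY z hz).1, ?_⟩
      have := (hY z hz).2
      rw [cht_s_smul]
      omega)
    rw [height_act] at this
    linarith
  have hB1 : height i B = -1 := by
    have := hCB.height_eq (i := i)
    rw [height_append] at this
    linarith
  have hcut : IsCut (R ++ C ++ act i (act i B) ++ K) p.steps := by
    rw [act_act, hAK, show R ++ C ++ B ++ K = R ++ (C ++ B) ++ K by simp]
    exact ((isCut_refl fun x hx => posA x (by simp [hx])).append hCB).append (isCut_refl posK)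
  have hw' := (p.isWeakLS hlam).of_isCut hcut
  have hd' := hcut.dur_eq.trans p.dur_eq
  rw [act_act] at hw' hd'
  have hBne : B ≠ [] := by
    rintro rfl
    simp at hB1
  have hweak : IsWeakLS (R ++ C ++ act i B ++ K) := by
    rw [List.append_assoc] at hw' ⊢
    refine hw'.replace_suffix (hw'.of_append.act_append_of_neg hlam hB' hK') (by simp)
      fun x hx y hy => ?_
    obtain ⟨A', hA'x⟩ := List.getLast?_eq_some_iff.1 hx
    obtain ⟨z, B, rfl⟩ := List.exists_cons_of_ne_nil hBne
    simp only [act_cons, List.cons_append, List.head?_cons, Option.mem_some_iff] at hy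
    subst hy
    rw [hA'x, List.append_assoc, List.singleton_append] at hw'
    have h1 : IsWeakLS (x :: z :: (B ++ K)) := hw'.of_append
    have hz := (hB' z (by simp)).2
    obtain ⟨l, hl⟩ := IsWeakLS.height_cons (i := i) h1.2.1
    -- The height at the start of `B` is the integer `n + 1`, so `b` times the height of `z` is
    -- integral, and `sᵢ z ≤ z ≤ x` bridges the junction.
    have h3 : CBLe (dur (z :: (B ++ K))) (D.s i • z.2) z.2 := by
      have := cBLe_s_smul hlam (b := dur (z :: (B ++ K))) (σ := D.s i • z.2) (i := i)
        (by rw [cht_s_smul]; omega) ⟨l - (m - n - 1), by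
          rw [cht_s_smul]
          simp only [height_append, height_cons] at hm hl hn hB1
          have := hCB.height_eq (i := i)
          push_cast
          linarith⟩
      rwa [s_smul_s_smul] at this
    have := h3.trans hlam (h1.2.2 z rfl)
    simpa using this
  have harr : IsArrowCut i (R ++ C) (act i B) K := by
    refine ⟨hweak, by simpa using hd', ?_, ?_, ?_, by rw [height_act, hB1, neg_neg]⟩
    -- Local minima before the first minimum have integral height greater than `n`, hence at least
    -- `n + 1`, which is the height where the reflected block begins.
    · have hRC : height i (R ++ C) = n + 1 := by
        have := hCB.height_eq (i := i)
        simp only [height_append] at this hn ⊢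
        linarith
      have hR1 : (n + 1 : ℚ) ≤ height i R := by
        rw [← hRC, height_append]
        linarith [neg_sum C hC']
      intro Y hY
      rcases prefix_append_iff.1 hY with h | ⟨Y, rfl, hYC⟩
      · obtain ⟨R₁, R₂, rfl, h1, h2⟩ := exists_last_min i R
        suffices height i (R₁ ++ R₂ ++ C) ≤ height i R₁ by
          rcases prefix_append_iff.1 h with h | ⟨Y, rfl, hYR⟩
          · exact this.trans (h1 Y h)
          · rw [height_append R₁ Y]
            by_cases hY' : Y = []
            · simpa [hY'] using this
            · linarith [h2 Y hYR hY']
        rw [hRC]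
        by_cases hR2 : R₂ = []
        · simpa [hR2] using hR1
        have e : R₁ ++ R₂ ++ P ++ K = R₁ ++ (R₂ ++ P ++ K) := by simp
        obtain ⟨l, hl⟩ := (e ▸ hw).height_left_int (i := i) hlam (e ▸ hd)
          (cht_getLast_nonpos (fun x hx => posA x (by simp [hx])) h1) (by
            intro x hx
            refine (cht_head_pos (fun x hx => posA x (by simp [hx])) h2 x ?_).le
            rwa [List.append_assoc, List.head?_append_of_ne_nil _ hR2] at hx)
        have h3 := hA R₁ (by simp) (by simp [hR2])
        rw [hn, hl] at h3
        rw [hl]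
        norm_cast at h3 ⊢
      · rw [height_append, height_append]
        obtain ⟨C₂, rfl⟩ := hYC
        have := neg_sum C₂ fun x hx => hC' x (by simp [hx])
        rw [height_append]
        linarith
    · have hposB : ∀ x ∈ act i B, 0 < x.1 ∧ 0 < cht i x.2 := by
        intro y hy
        obtain ⟨z, hz, rfl⟩ := List.mem_map.1 hy
        refine ⟨(hB' z hz).1, ?_⟩
        have := (hB' z hz).2
        rw [cht_s_smul]
        omega
      intro Y hY hY'
      rcases prefix_append_iff.1 hY with h | ⟨Y, rfl, hYK⟩
      · exact height_pos (fun x hx => hposB x (h.subset hx)) hY'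
      · rw [height_append, height_act, hB1]
        linarith [hK Y hYK]
    · intro y hy
      obtain ⟨z, hz, rfl⟩ := List.mem_map.1 hy
      refine ⟨(hB' z hz).1, ?_⟩
      have := (hB' z hz).2
      rw [cht_s_smul]
      omega
  obtain ⟨r, hr⟩ := exists_lsPath hlam hweak (by simpa using hd')
  exact ⟨r, harr.arrow hr hcut⟩

end Arrows
-- Strings as directed paths, and lifts along step sequences.
section Strings
variable {I Λ : Type*} [AddCommGroup Λ] {D : RootDatum I Λ} {lam : Λ} {i : I}

/-- Between the times `a` and `b`, the operator `fᵢ` reflects the path `p`, which gives `q`. -/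
structure ReflectsBetween (i : I) (p q : D.LSPath lam) (a b : ℚ) : Prop where
  nonneg : 0 ≤ a
  lt : a < b
  le_one : b ≤ 1
  le_left : ∀ t, 0 ≤ t → t ≤ a → heightAt i p.steps a ≤ heightAt i p.steps t
  lt_right : ∀ t, a < t → t ≤ 1 → heightAt i p.steps a < heightAt i p.steps t
  lt_mid : ∀ t, a ≤ t → t < b → heightAt i p.steps t < heightAt i p.steps a + 1
  eq_end : heightAt i p.steps b = heightAt i p.steps a + 1
  lt_left' : ∀ t, 0 ≤ t → t < b → heightAt i q.steps b < heightAt i q.steps t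
  le_right' : ∀ t, b ≤ t → heightAt i q.steps b ≤ heightAt i q.steps t
  lt_mid' : ∀ t, a < t → t ≤ b → heightAt i q.steps t < heightAt i q.steps b + 1
  eq_start' : heightAt i q.steps a = heightAt i q.steps b + 1
  dirAt_left : ∀ t, 0 ≤ t → t < a → dirAt q.steps t = dirAt p.steps t
  dirAt_mid : ∀ t, a ≤ t → t < b → dirAt q.steps t = (dirAt p.steps t).map fun σ => D.s i • σ
  dirAt_right : ∀ t, b ≤ t → dirAt q.steps t = dirAt p.steps t

/-- Translates the cut into times, so that arrows obtained from different cuts can be compared. -/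
theorem IsArrowCut.reflectsBetween (hlam : D.IsDominant lam) {A B C : List (D.Step lam)}
    (h : IsArrowCut i A B C) {p q : D.LSPath lam} (hp : IsCut (A ++ B ++ C) p.steps)
    (hq : IsCut (A ++ act i B ++ C) q.steps) :
    ReflectsBetween i p q (dur A) (dur A + dur B) := by
  have hB : ∀ x ∈ B, 0 < x.1 := fun x hx => (h.pos_B x hx).1
  have hB' : ∀ x ∈ act i B, 0 < x.1 := by
    intro y hy
    obtain ⟨z, hz, rfl⟩ := List.mem_map.1 hy
    exact hB z hz
  have hC := h.pos_C
  have hA := h.pos_A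
  have hBC : ∀ x ∈ B ++ C, 0 < x.1 := fun x hx => (List.mem_append.1 hx).elim (hB x) (hC x)
  have hBC' : ∀ x ∈ act i B ++ C, 0 < x.1 := fun x hx => (List.mem_append.1 hx).elim (hB' x) (hC x)
  have dA := dur_nonneg hA
  have dC := dur_nonneg hC
  have dB : 0 < dur B := by
    obtain ⟨x, B, rfl⟩ := List.exists_cons_of_ne_nil h.B_ne_nil
    rw [dur_cons]
    have := dur_nonneg fun y (hy : y ∈ B) => hB y (by simp [hy])
    linarith [hB x (by simp)]
  have d1 : dur A + dur B + dur C = 1 := by simpa [add_assoc] using h.dur_eq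
  rw [List.append_assoc] at hp hq
  have Hp1 : ∀ t, 0 ≤ t → t ≤ dur A → heightAt i p.steps t = heightAt i A t := fun t h0 h1 => by
    rw [← hp.heightAt_eq h0, heightAt_append hA hBC h0, if_pos h1]
  have Hp2 : ∀ t, dur A < t → heightAt i p.steps t =
      height i A + heightAt i (B ++ C) (t - dur A) := fun t h1 => by
    rw [← hp.heightAt_eq (by linarith), heightAt_append hA hBC (by linarith),
      if_neg (not_le.2 h1)]
  have Hp3 : ∀ t, dur A < t → t ≤ dur A + dur B → heightAt i p.steps t =
      height i A + heightAt i B (t - dur A) := fun t h1 h2 => by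
    rw [Hp2 t h1, heightAt_append hB hC (by linarith), if_pos (by linarith)]
  have Hq1 : ∀ t, 0 ≤ t → t ≤ dur A → heightAt i q.steps t = heightAt i A t := fun t h0 h1 => by
    rw [← hq.heightAt_eq h0, heightAt_append hA hBC' h0, if_pos h1]
  have Hq2 : ∀ t, dur A < t → heightAt i q.steps t =
      height i A + heightAt i (act i B ++ C) (t - dur A) := fun t h1 => by
    rw [← hq.heightAt_eq (by linarith), heightAt_append hA hBC' (by linarith),
      if_neg (not_le.2 h1)]
  have Hq3 : ∀ t, dur A < t → t ≤ dur A + dur B → heightAt i q.steps t =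
      height i A - heightAt i B (t - dur A) := fun t h1 h2 => by
    rw [Hq2 t h1, heightAt_append hB' hC (by linarith), dur_act, if_pos (by linarith),
      heightAt_act]
    ring
  have HA : heightAt i A (dur A) = height i A := heightAt_dur hA
  have HB : heightAt i B (dur A + dur B - dur A) = 1 := by
    rw [add_sub_cancel_left, heightAt_dur hB, h.height_B]
  have Hqb : heightAt i q.steps (dur A + dur B) = height i A - 1 := by
    rw [Hq3 _ (by linarith) le_rfl, HB]
  refine ⟨dA, by linarith, by linarith, ?_, ?_, ?_, ?_, ?_, ?_, ?_, ?_, ?_, ?_, ?_⟩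
  · intro t h0 h1
    rw [Hp1 t h0 h1, Hp1 _ dA le_rfl, HA]
    exact le_heightAt hA h.le_A h0
  · intro t h0 h1
    rw [Hp2 t h0, Hp1 _ dA le_rfl, HA]
    linarith [lt_heightAt hBC le_rfl h.pos_BC (t := t - dur A) (by linarith)
      (by rw [dur_append]; linarith)]
  · intro t h0 h1
    rw [Hp1 _ dA le_rfl, HA]
    rcases h0.eq_or_lt with rfl | h0
    · rw [Hp1 _ dA le_rfl, HA]
      linarith
    · rw [Hp3 t h0 h1.le]
      linarith [heightAt_lt_height h.pos_B (t := t - dur A) (by linarith) (by linarith), h.height_B]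
  · rw [Hp1 _ dA le_rfl, HA, Hp3 _ (by linarith) le_rfl, HB]
  · intro t h0 h1
    rw [Hqb]
    rcases le_or_gt t (dur A) with h2 | h2
    · rw [Hq1 t h0 h2]
      linarith [le_heightAt hA h.le_A h0]
    · rw [Hq3 t h2 h1.le]
      linarith [heightAt_lt_height h.pos_B (t := t - dur A) (by linarith) (by linarith), h.height_B]
  · intro t h0
    rcases h0.eq_or_lt with rfl | h0
    · exact le_rfl
    rw [Hqb, Hq2 t (by linarith), heightAt_append hB' hC (by linarith), dur_act,
      if_neg (by linarith), height_act, h.height_B]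
    linarith [le_heightAt hC (h.height_C_nonneg hlam) (t := t - dur A - dur B) (by linarith)]
  · intro t h0 h1
    rw [Hqb, Hq3 t h0 h1]
    linarith [heightAt_pos h.pos_B (t := t - dur A) (by linarith) (by linarith)]
  · rw [Hqb, Hq1 _ dA le_rfl, HA]
    ring
  · intro t h0 h1
    rw [← hp.dirAt_eq h0, ← hq.dirAt_eq h0, dirAt_append hA h0, dirAt_append hA h0, if_pos h1,
      if_pos h1]
  · intro t h0 h1
    have h2 : 0 ≤ t := by linarith
    rw [← hp.dirAt_eq h2, ← hq.dirAt_eq h2, dirAt_append hA h2, dirAt_append hA h2,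
      if_neg (not_lt.2 h0), if_neg (not_lt.2 h0), dirAt_append hB (by linarith),
      dirAt_append hB' (by linarith), dur_act, if_pos (by linarith), if_pos (by linarith), dirAt_act]
  · intro t h0
    have h2 : 0 ≤ t := by linarith
    rw [← hp.dirAt_eq h2, ← hq.dirAt_eq h2, dirAt_append hA h2, dirAt_append hA h2,
      if_neg (by linarith), if_neg (by linarith), dirAt_append hB (by linarith),
      dirAt_append hB' (by linarith), dur_act, if_neg (by linarith), if_neg (by linarith)]

theorem Arrow.exists_reflectsBetween (hlam : D.IsDominant lam) {p q : D.LSPath lam}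
    (h : Arrow i p q) : ∃ a b, ReflectsBetween i p q a b := by
  obtain ⟨A, B, C, h, hp, hq⟩ := h.exists_cut hlam
  exact ⟨_, _, h.reflectsBetween hlam hp hq⟩

theorem LSPath.heightAt_zero (p : D.LSPath lam) : heightAt i p.steps 0 = 0 :=
  RootDatum.heightAt_zero p.pos

/-- The path `p` determines both times: `a` is the last time of its minimum and `b` the first later
time at which it is 1 higher. -/
theorem Arrow.unique_right (hlam : D.IsDominant lam) {p q q' : D.LSPath lam} (h : Arrow i p q)
    (h' : Arrow i p q') : q = q' := by
  obtain ⟨a, b, h⟩ := h.exists_reflectsBetween hlam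
  obtain ⟨a', b', h'⟩ := h'.exists_reflectsBetween hlam
  obtain rfl : a = a' := by
    rcases lt_trichotomy a a' with h1 | h1 | h1
    · exact absurd (h.lt_right a' h1 (h'.lt.le.trans h'.le_one)) (h'.le_left a h.nonneg h1.le).not_gt
    · exact h1
    · exact absurd (h'.lt_right a h1 (h.lt.le.trans h.le_one)) (h.le_left a' h'.nonneg h1.le).not_gt
  obtain rfl : b = b' := by
    rcases lt_trichotomy b b' with h1 | h1 | h1
    · exact absurd h.eq_end (h'.lt_mid b h.lt.le h1).ne
    · exact h1
    · exact absurd h'.eq_end (h.lt_mid b' h'.lt.le h1).ne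
  refine LSPath.ext_of_dirAt fun t ht => ?_
  rcases lt_or_ge t a with h1 | h1
  · rw [h.dirAt_left t ht h1, h'.dirAt_left t ht h1]
  rcases lt_or_ge t b with h2 | h2
  · rw [h.dirAt_mid t h1 h2, h'.dirAt_mid t h1 h2]
  · rw [h.dirAt_right t h2, h'.dirAt_right t h2]

/-- Here `q` determines them: `b` is the first time of its minimum and `a` the last earlier time at
which it is 1 higher. -/
theorem Arrow.unique_left (hlam : D.IsDominant lam) {p p' q : D.LSPath lam} (h : Arrow i p q)
    (h' : Arrow i p' q) : p = p' := by
  obtain ⟨a, b, h⟩ := h.exists_reflectsBetween hlam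
  obtain ⟨a', b', h'⟩ := h'.exists_reflectsBetween hlam
  obtain rfl : b = b' := by
    have hb := h.nonneg.trans h.lt.le
    have hb' := h'.nonneg.trans h'.lt.le
    rcases lt_trichotomy b b' with h1 | h1 | h1
    · exact absurd (h'.lt_left' b hb h1) (h.le_right' b' h1.le).not_gt
    · exact h1
    · exact absurd (h.lt_left' b' hb' h1) (h'.le_right' b h1.le).not_gt
  obtain rfl : a = a' := by
    rcases lt_trichotomy a a' with h1 | h1 | h1
    · exact absurd h'.eq_start' (h.lt_mid' a' h1 h'.lt.le).ne
    · exact h1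
    · exact absurd h.eq_start' (h'.lt_mid' a h1 h.lt.le).ne
  refine LSPath.ext_of_dirAt fun t ht => ?_
  rcases lt_or_ge t a with h1 | h1
  · rw [← h.dirAt_left t ht h1, ← h'.dirAt_left t ht h1]
  rcases lt_or_ge t b with h2 | h2
  · refine Option.map_injective (MulAction.injective (D.s i)) ?_
    exact (h.dirAt_mid t h1 h2).symm.trans (h'.dirAt_mid t h1 h2)
  · rw [← h.dirAt_right t h2, ← h'.dirAt_right t h2]

/-- Every path of an `i`-string can be reached from its head. -/
theorem IsString.reach_head (hlam : D.IsDominant lam) {S : Set (D.LSPath lam)} (hS : IsString i S)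
    {h : D.LSPath lam} (hh : IsHead i S h) {p : D.LSPath lam} (hp : p ∈ S) :
    Relation.ReflTransGen (Arrow i) h p := by
  obtain ⟨p₀, rfl⟩ := hS
  have e : Relation.EqvGen (Arrow i) h p := .trans _ _ _ (.symm _ _ hh.1) hp
  suffices ∀ x y, Relation.EqvGen (Arrow i) x y → (Relation.ReflTransGen (Arrow i) h x ↔
      Relation.ReflTransGen (Arrow i) h y) from (this _ _ e).1 .refl
  intro x y hxy
  induction hxy with
  | rel x y hxy =>
    refine ⟨fun hx => hx.tail hxy, fun hy => ?_⟩
    rcases Relation.ReflTransGen.cases_tail hy with rfl | ⟨z, hz, hzy⟩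
    · exact absurd hxy (hh.2 x)
    · rwa [hxy.unique_left hlam hzy]
  | refl => rfl
  | symm _ _ _ ih => exact ih.symm
  | trans _ _ _ _ _ ih ih' => exact ih.trans ih'

/-- Every path of an `i`-string reaches its tail. -/
theorem IsString.reach_tail (hlam : D.IsDominant lam) {S : Set (D.LSPath lam)} (hS : IsString i S)
    {t : D.LSPath lam} (ht : IsTail i S t) {p : D.LSPath lam} (hp : p ∈ S) :
    Relation.ReflTransGen (Arrow i) p t := by
  obtain ⟨p₀, rfl⟩ := hS
  have e : Relation.EqvGen (Arrow i) t p := .trans _ _ _ (.symm _ _ ht.1) hp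
  suffices ∀ x y, Relation.EqvGen (Arrow i) x y → (Relation.ReflTransGen (Arrow i) x t ↔
      Relation.ReflTransGen (Arrow i) y t) from (this _ _ e).1 .refl
  intro x y hxy
  induction hxy with
  | rel x y hxy =>
    refine ⟨fun hx => ?_, fun hy => .head hxy hy⟩
    rcases Relation.ReflTransGen.cases_head hx with rfl | ⟨z, hz, hzy⟩
    · exact absurd hxy (ht.2 y)
    · rwa [hxy.unique_right hlam hz]
  | refl => rfl
  | symm _ _ _ ih => exact ih.symm
  | trans _ _ _ _ _ ih ih' => exact ih.trans ih'

theorem IsString.mem_of_arrow {S : Set (D.LSPath lam)} (hS : IsString i S) {p q : D.LSPath lam}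
    (h : Arrow i p q) : p ∈ S ↔ q ∈ S := by
  obtain ⟨p₀, rfl⟩ := hS
  exact ⟨fun hp => .trans _ _ _ hp (.rel _ _ h), fun hq => .trans _ _ _ hq (.symm _ _ (.rel _ _ h))⟩

/-! ### Lifts along sequences of steps -/

theorem isLiftList_append {z w : D.W} {X Y : List (D.Step lam)} :
    IsLiftList z (X ++ Y) w ↔ ∃ v, IsLiftList z Y v ∧ IsLiftList v X w := by
  induction X generalizing w with
  | nil => simp [IsLiftList]
  | cons x X ih =>
    simp only [List.cons_append, IsLiftList, ih]
    constructor
    · rintro ⟨v, ⟨u, h1, h2⟩, h3⟩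
      exact ⟨u, h1, v, h2, h3⟩
    · rintro ⟨u, h1, v, h2, h3⟩
      exact ⟨v, ⟨u, h1, h2⟩, h3⟩

theorem isLiftList_singleton {z w : D.W} {x : D.Step lam} :
    IsLiftList z [x] w ↔ D.IsUp lam z x.2 w := by
  simp [IsLiftList]

theorem IsLiftList.unique {z w w' : D.W} {L : List (D.Step lam)} (h : IsLiftList z L w)
    (h' : IsLiftList z L w') : w = w' := by
  induction L generalizing w w' with
  | nil => exact Eq.trans h (Eq.symm h')
  | cons x L ih =>
    obtain ⟨v, h1, h2⟩ := h
    obtain ⟨v', h1', h2'⟩ := h'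
    obtain rfl := ih h1 h1'
    exact h2.unique h2'

/-- An element of `σ` is its own lift to `σ`, so repeating a direction has no effect and lifts do
not see how a path is cut. -/
theorem isLiftList_block {z w : D.W} {B : List (D.Step lam)} {σ : D.Cosets lam}
    (hB : ∀ y ∈ B, y.2 = σ) (hne : B ≠ []) : IsLiftList z B w ↔ D.IsUp lam z σ w := by
  induction B generalizing w with
  | nil => exact absurd rfl hne
  | cons x B ih =>
    rw [IsLiftList, hB x (by simp)]
    by_cases hB0 : B = []
    · subst hB0
      simp [IsLiftList]
    · have ih := fun w => ih (w := w) (fun y hy => hB y (by simp [hy])) hB0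
      simp only [ih]
      have idem : ∀ v, D.IsUp lam z σ v → D.IsUp lam v σ v := fun v h =>
        ⟨⟨.refl, h.1.2⟩, fun _ h1 _ => h1⟩
      constructor
      · rintro ⟨v, h1, h2⟩
        rwa [h2.unique (idem v h1)]
      · exact fun h => ⟨w, h, idem w h⟩

theorem IsCut.isLiftList_iff {L K : List (D.Step lam)} (h : IsCut L K) {z w : D.W} :
    IsLiftList z L w ↔ IsLiftList z K w := by
  induction K generalizing L w with
  | nil => rw [isCut_nil_iff.1 h]
  | cons x K ih =>
    obtain ⟨B, L, rfl, hB, h⟩ := isCut_cons_iff.1 h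
    rw [isLiftList_append, IsLiftList]
    simp only [ih h, isLiftList_block (fun y hy => (hB.1 y hy).2) hB.2.1]

theorem IsWeakLS.exists_isLiftList (hlam : D.IsDominant lam) {z : D.W} {L : List (D.Step lam)}
    (hL : IsWeakLS L) (hne : L ≠ []) (h : D.CosetLe lam (D.coset lam z) (L.getLast hne).2) :
    ∃ w, IsLiftList z L w ∧ ∀ x ∈ L.head?, D.coset lam w = x.2 := by
  induction L with
  | nil => exact absurd rfl hne
  | cons x L ih =>
    cases L with
    | nil =>
      obtain ⟨w, hw⟩ := exists_isUp hlam h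
      exact ⟨w, isLiftList_singleton.2 hw, by simpa using hw.1.2⟩
    | cons y L =>
      obtain ⟨v, hv, hv'⟩ := ih hL.2.1 (by simp) (by simpa using h)
      have h1 := (hL.2.2 y rfl).cosetLe hlam
      rw [← hv' y rfl] at h1
      obtain ⟨w, hw⟩ := exists_isUp hlam h1
      exact ⟨w, ⟨v, hv, hw⟩, by simpa using hw.1.2⟩

theorem LSPath.cosetLe_final_of_isLiftList (hlam : D.IsDominant lam) {p : D.LSPath lam} {z w : D.W}
    (h : IsLiftList z p.steps w) : D.CosetLe lam (D.coset lam z) p.final := by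
  rw [LSPath.final]
  rw [← List.dropLast_append_getLast p.steps_ne_nil, isLiftList_append] at h
  obtain ⟨v, hv, -⟩ := h
  exact (isLiftList_singleton.1 hv).cosetLe hlam

theorem LSPath.isLift_iff (hlam : D.IsDominant lam) {p : D.LSPath lam} {z w : D.W} :
    p.IsLift z w ↔ IsLiftList z p.steps w :=
  ⟨fun h => h.2, fun h => ⟨p.cosetLe_final_of_isLiftList hlam h, h⟩⟩

theorem LSPath.cosetLe_final_iff (hlam : D.IsDominant lam) {p : D.LSPath lam} {z : D.W} :
    D.CosetLe lam (D.coset lam z) p.final ↔ ∃ w, IsLiftList z p.steps w := by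
  constructor
  · intro h
    obtain ⟨w, hw, -⟩ := (p.isWeakLS hlam).exists_isLiftList hlam p.steps_ne_nil h
    exact ⟨w, hw⟩
  · rintro ⟨w, hw⟩
    exact p.cosetLe_final_of_isLiftList hlam hw

variable (i) in
/-- All steps have `i`-height zero. -/
def AllZero (L : List (D.Step lam)) : Prop := ∀ x ∈ L, cht i x.2 = 0

variable (i) in
/-- The last step of nonzero `i`-height exists, and its height is negative. -/
def EndsNeg (L : List (D.Step lam)) : Prop :=
  ∃ L' x Z, L = L' ++ x :: Z ∧ cht i x.2 < 0 ∧ AllZero i Z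

variable (i) in
/-- The first step of nonzero `i`-height exists, and its height is positive. -/
def StartsPos (L : List (D.Step lam)) : Prop :=
  ∃ Z x L', L = Z ++ x :: L' ∧ 0 < cht i x.2 ∧ AllZero i Z

theorem AllZero.height_eq {L : List (D.Step lam)} (h : AllZero i L) : height i L = 0 := by
  induction L with
  | nil => simp
  | cons x L ih => rw [height_cons, ih fun y hy => h y (by simp [hy]), h x (by simp)]; simp

theorem allZero_or_endsNeg {L : List (D.Step lam)} (hL : ∀ x ∈ L, 0 < x.1)
    (h : ∀ X, X <+: L → height i L ≤ height i X) : AllZero i L ∨ EndsNeg i L := by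
  induction L using List.reverseRecOn with
  | nil => exact .inl (by simp [AllZero])
  | append_singleton L x ih =>
    have hx : cht i x.2 ≤ 0 := cht_getLast_nonpos hL h x (by simp)
    rcases hx.eq_or_lt with hx | hx
    · rcases ih (fun y hy => hL y (by simp [hy])) fun X hX => by
        have := h X (hX.trans (List.prefix_append _ _))
        simpa [hx] using this with h1 | ⟨L', y, Z, rfl, h1, h2⟩
      · left
        intro y hy
        rcases List.mem_append.1 hy with hy | hy
        · exact h1 y hy
        · rwa [List.mem_singleton.1 hy]
      · refine .inr ⟨L', y, Z ++ [x], by simp, h1, fun z hz => ?_⟩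
        rcases List.mem_append.1 hz with hz | hz
        · exact h2 z hz
        · rwa [List.mem_singleton.1 hz]
    · exact .inr ⟨L, x, [], by simp, hx, by simp [AllZero]⟩

theorem allZero_or_startsPos {L : List (D.Step lam)} (hL : ∀ x ∈ L, 0 < x.1)
    (h : ∀ X, X <+: L → 0 ≤ height i X) : AllZero i L ∨ StartsPos i L := by
  induction L with
  | nil => exact .inl (by simp [AllZero])
  | cons x L ih =>
    have h1 := h [x] (by simp)
    rw [height_cons, height_nil, add_zero] at h1
    have hx : 0 ≤ cht i x.2 := by
      exact_mod_cast nonneg_of_mul_nonneg_right h1 (hL x (by simp))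
    rcases hx.eq_or_lt with hx | hx
    · rcases ih (fun y hy => hL y (by simp [hy])) fun X hX => by
        have := h (x :: X) (by simpa using hX)
        simpa [← hx] using this with h1 | ⟨Z, y, L', rfl, h1, h2⟩
      · left
        intro y hy
        rcases List.mem_cons.1 hy with rfl | hy
        · exact hx.symm
        · exact h1 y hy
      · refine .inr ⟨x :: Z, y, L', by simp, h1, fun z hz => ?_⟩
        rcases List.mem_cons.1 hz with rfl | hz
        · exact hx.symm
        · exact h2 z hz
    · exact .inr ⟨[], x, L, by simp, hx, by simp [AllZero]⟩

theorem AllZero.asc {Z : List (D.Step lam)} (hZ : AllZero i Z) {v w : D.W} (hv : D.Asc i v)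
    (h : IsLiftList v Z w) : D.Asc i w := by
  induction Z generalizing w with
  | nil => rwa [show w = v from h]
  | cons x Z ih =>
    obtain ⟨u, h1, h2⟩ := h
    exact h2.asc (hZ x (by simp)) (ih (fun y hy => hZ y (by simp [hy])) h1)

/-- As long as the two lifts differ by `sᵢ`, `IsUp.exists_s_mul` applies to the next step; once they
coincide, they stay equal. -/
theorem AllZero.isLiftList_s_mul (hlam : D.IsDominant lam) {Z : List (D.Step lam)}
    (hZ : AllZero i Z) {v w : D.W} (hv : D.Asc i v) (h : IsLiftList v Z w) :
    IsLiftList (D.s i * v) Z w ∨ IsLiftList (D.s i * v) Z (D.s i * w) := by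
  induction Z generalizing w with
  | nil => exact .inr (by rw [show w = v from h]; rfl)
  | cons x Z ih =>
    obtain ⟨u, h1, h2⟩ := h
    have hZ' : AllZero i Z := fun y hy => hZ y (by simp [hy])
    rcases ih hZ' h1 with h3 | h3
    · exact .inl ⟨u, h3, h2⟩
    · exact (h2.exists_s_mul hlam (hZ x (by simp)) (hZ'.asc hv h1)).imp
        (fun h4 => ⟨_, h3, h4⟩) fun h4 => ⟨_, h3, h4⟩

theorem AllZero.exists_isLiftList (hlam : D.IsDominant lam) {Z : List (D.Step lam)}
    (hZ : AllZero i Z) {v u : D.W} (hv : D.Asc i v) (h : IsLiftList (D.s i * v) Z u) :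
    ∃ w, IsLiftList v Z w := by
  induction Z generalizing u with
  | nil => exact ⟨v, rfl⟩
  | cons x Z ih =>
    obtain ⟨y, h1, h2⟩ := h
    have hZ' : AllZero i Z := fun y hy => hZ y (by simp [hy])
    obtain ⟨c, hc⟩ := ih hZ' h1
    rcases hZ'.isLiftList_s_mul hlam hv hc with h3 | h3
    · rw [h1.unique h3] at h2
      exact ⟨u, c, hc, h2⟩
    · rw [h1.unique h3] at h2
      obtain ⟨w, hw⟩ := h2.exists_of_s_mul hlam (hZ'.asc hv hc)
      exact ⟨w, c, hc, hw⟩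

/-- Every element of `τ` has the form `sᵢ w` with `w` an ascent, and it lies above `v` exactly when
it lies above `sᵢ v`. -/
theorem isUp_s_mul_iff_of_neg (hlam : D.IsDominant lam) {τ : D.Cosets lam} (hτ : cht i τ < 0)
    {v w : D.W} (hv : D.Asc i v) : D.IsUp lam (D.s i * v) τ w ↔ D.IsUp lam v τ w := by
  have hτ' : 0 < cht i (D.s i • τ) := by rw [cht_s_smul]; omega
  rw [← s_smul_s_smul i τ, ← D.s_mul_cancel i w, isUp_s_mul_s_smul_iff hlam hτ' hv,
    isUp_s_smul_iff hlam hτ' hv]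

/-- Lifting starts at the end of the list: the final zero steps keep a discrepancy of at most `sᵢ`,
and the negative step absorbs it. -/
theorem EndsNeg.isLiftList_s_mul_iff (hlam : D.IsDominant lam) {L : List (D.Step lam)}
    (hL : EndsNeg i L) {v w : D.W} (hv : D.Asc i v) :
    IsLiftList (D.s i * v) L w ↔ IsLiftList v L w := by
  obtain ⟨L, x, Z, rfl, hx, hZ⟩ := hL
  suffices ∀ u, (∃ c, IsLiftList (D.s i * v) Z c ∧ D.IsUp lam c x.2 u) ↔
      ∃ c, IsLiftList v Z c ∧ D.IsUp lam c x.2 u by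
    rw [isLiftList_append, isLiftList_append]
    simp only [IsLiftList, this]
  intro u
  constructor
  · rintro ⟨c, h1, h2⟩
    obtain ⟨c', hc'⟩ := hZ.exists_isLiftList hlam hv h1
    refine ⟨c', hc', ?_⟩
    rcases hZ.isLiftList_s_mul hlam hv hc' with h3 | h3
    · rwa [h1.unique h3] at h2
    · rwa [h1.unique h3, isUp_s_mul_iff_of_neg hlam hx (hZ.asc hv hc')] at h2
  · rintro ⟨c, h1, h2⟩
    rcases hZ.isLiftList_s_mul hlam hv h1 with h3 | h3
    · exact ⟨c, h3, h2⟩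
    · exact ⟨_, h3, (isUp_s_mul_iff_of_neg hlam hx (hZ.asc hv h1)).2 h2⟩

theorem StartsPos.asc (hlam : D.IsDominant lam) {L : List (D.Step lam)}
    (hL : StartsPos i L) {v w : D.W} (h : IsLiftList v L w) : D.Asc i w := by
  obtain ⟨Z, x, L, rfl, hx, hZ⟩ := hL
  obtain ⟨u, ⟨c, h1, h2⟩, h3⟩ := isLiftList_append.1 h
  exact hZ.asc (asc_of_cht_pos hlam hx h2.1.2) h3

theorem asc_of_pos (hlam : D.IsDominant lam) {B : List (D.Step lam)}
    (hB : ∀ x ∈ B, 0 < cht i x.2) {v w : D.W} (hv : D.Asc i v) (h : IsLiftList v B w) :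
    D.Asc i w := by
  cases B with
  | nil => rwa [show w = v from h]
  | cons x B =>
    obtain ⟨u, -, h2⟩ := h
    exact asc_of_cht_pos hlam (hB x (by simp)) h2.1.2

/-- The first lift acquires the factor `sᵢ`; at every later step both the element lifted and the
direction carry it, and the lift keeps it. -/
theorem isLiftList_act_iff (hlam : D.IsDominant lam) {B : List (D.Step lam)}
    (hB : ∀ x ∈ B, 0 < cht i x.2) (hne : B ≠ []) {v w : D.W} (hv : D.Asc i v) :
    IsLiftList v (act i B) (D.s i * w) ↔ IsLiftList v B w := by
  induction B generalizing w with
  | nil => exact absurd rfl hne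
  | cons x B ih =>
    have hx := hB x (by simp)
    have hB' : ∀ x ∈ B, 0 < cht i x.2 := fun y hy => hB y (by simp [hy])
    by_cases hB0 : B = []
    · subst hB0
      rw [act_cons, act_nil, isLiftList_singleton, isLiftList_singleton]
      exact isUp_s_smul_iff hlam hx hv
    · have ih := fun w => ih (w := w) hB' hB0
      rw [act_cons, IsLiftList, IsLiftList]
      constructor
      · rintro ⟨u, h1, h2⟩
        rw [← D.s_mul_cancel i u, ih] at h1
        rw [← D.s_mul_cancel i u,
          isUp_s_mul_s_smul_iff hlam hx (asc_of_pos hlam hB' hv h1)] at h2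
        exact ⟨_, h1, h2⟩
      · rintro ⟨u, h1, h2⟩
        exact ⟨D.s i * u, (ih u).2 h1,
          (isUp_s_mul_s_smul_iff hlam hx (asc_of_pos hlam hB' hv h1)).2 h2⟩

end Strings
-- Behaviour of lifts along a string.
section StringLifts
variable {I Λ : Type*} [AddCommGroup Λ] {D : RootDatum I Λ} {lam : Λ} {i : I}

theorem IsArrowCut.isLiftList_act_append_iff (hlam : D.IsDominant lam) {A B C : List (D.Step lam)}
    (h : IsArrowCut i A B C) {v u : D.W} (hC : ∀ c, IsLiftList v C c → D.Asc i c) :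
    IsLiftList v (act i B ++ C) (D.s i * u) ↔ IsLiftList v (B ++ C) u := by
  rw [isLiftList_append, isLiftList_append]
  refine exists_congr fun c => and_congr_right fun hc => ?_
  exact isLiftList_act_iff hlam (fun x hx => (h.pos_B x hx).2) h.B_ne_nil (hC c hc)

theorem IsArrowCut.asc (hlam : D.IsDominant lam) {A B C : List (D.Step lam)}
    (h : IsArrowCut i A B C) {v u : D.W} (hC : ∀ c, IsLiftList v C c → D.Asc i c)
    (hu : IsLiftList v (B ++ C) u) : D.Asc i u := by
  obtain ⟨c, h1, h2⟩ := isLiftList_append.1 hu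
  exact asc_of_pos hlam (fun x hx => (h.pos_B x hx).2) (hC c h1) h2

theorem IsArrowCut.isLiftList_iff_of_endsNeg (hlam : D.IsDominant lam) {A B C : List (D.Step lam)}
    (h : IsArrowCut i A B C) (hA : EndsNeg i A) {v y : D.W}
    (hC : ∀ c, IsLiftList v C c → D.Asc i c) :
    IsLiftList v (A ++ B ++ C) y ↔ IsLiftList v (A ++ act i B ++ C) y := by
  rw [List.append_assoc, List.append_assoc, isLiftList_append, isLiftList_append]
  constructor
  · rintro ⟨u, h1, h2⟩
    exact ⟨D.s i * u, (h.isLiftList_act_append_iff hlam hC).2 h1,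
      (hA.isLiftList_s_mul_iff hlam (h.asc hlam hC h1)).2 h2⟩
  · rintro ⟨u, h1, h2⟩
    rw [← D.s_mul_cancel i u] at h1 h2
    rw [h.isLiftList_act_append_iff hlam hC] at h1
    exact ⟨_, h1, (hA.isLiftList_s_mul_iff hlam (h.asc hlam hC h1)).1 h2⟩

theorem IsArrowCut.isLiftList_of_allZero (hlam : D.IsDominant lam) {A B C : List (D.Step lam)}
    (h : IsArrowCut i A B C) (hA : AllZero i A) {v : D.W}
    (hC : ∀ c, IsLiftList v C c → D.Asc i c) :
    (∀ y, IsLiftList v (A ++ B ++ C) y → D.Asc i y ∧ (IsLiftList v (A ++ act i B ++ C) y ∨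
      IsLiftList v (A ++ act i B ++ C) (D.s i * y))) ∧
    ∀ x, IsLiftList v (A ++ act i B ++ C) x → ∃ y, IsLiftList v (A ++ B ++ C) y := by
  constructor
  · intro y hy
    rw [List.append_assoc] at hy ⊢
    obtain ⟨u, h1, h2⟩ := isLiftList_append.1 hy
    have hu := h.asc hlam hC h1
    refine ⟨hA.asc hu h2, ?_⟩
    have h3 := (h.isLiftList_act_append_iff hlam hC).2 h1
    exact (hA.isLiftList_s_mul hlam hu h2).imp (fun h4 => isLiftList_append.2 ⟨_, h3, h4⟩)
      fun h4 => isLiftList_append.2 ⟨_, h3, h4⟩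
  · intro x hx
    rw [List.append_assoc] at hx ⊢
    obtain ⟨u, h1, h2⟩ := isLiftList_append.1 hx
    rw [← D.s_mul_cancel i u] at h1 h2
    rw [h.isLiftList_act_append_iff hlam hC] at h1
    obtain ⟨y, hy⟩ := hA.exists_isLiftList hlam (h.asc hlam hC h1) h2
    exact ⟨y, isLiftList_append.2 ⟨_, h1, hy⟩⟩

/-- If `C` has height zero throughout, `q` ends at its minimum and admits no further arrow, so `v`
itself is an ascent and stays one. Otherwise the first nonzero step of `C` is positive and makes any
lift an ascent. The second alternative on `v` is what allows `v = sᵢ z`. -/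
theorem IsArrowCut.asc_of_isLiftList_C (hlam : D.IsDominant lam) {A B C : List (D.Step lam)}
    (h : IsArrowCut i A B C) {p q : D.LSPath lam} (hp : IsCut (A ++ B ++ C) p.steps)
    (hq : IsCut (A ++ act i B ++ C) q.steps) {v : D.W}
    (hv : D.Asc i v ∨ ∃ q', Arrow i q q') (c : D.W) (hc : IsLiftList v C c) : D.Asc i c := by
  rcases allZero_or_startsPos h.pos_C (h.height_C_nonneg hlam) with hC | hC
  · rcases hv with hv | ⟨q', hq'⟩
    · exact hC.asc hv hc
    · exfalso
      have hr := h.reflectsBetween hlam hp hq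
      obtain ⟨a', b', hr'⟩ := hq'.exists_reflectsBetween hlam
      have h1 := hr'.lt_right 1 (hr'.lt.trans_le hr'.le_one) le_rfl
      have h2 : heightAt i q.steps (dur A + dur B) ≤ heightAt i q.steps a' := by
        rcases lt_or_ge a' (dur A + dur B) with h3 | h3
        · exact (hr.lt_left' a' hr'.nonneg h3).le
        · exact hr.le_right' a' h3
      have h3 : heightAt i q.steps (dur A + dur B) = height i (A ++ act i B) := by
        rw [← hq.heightAt_eq (hr.nonneg.trans hr.lt.le), ← dur_act (i := i) B, ← dur_append]
        exact heightAt_append_dur (fun x hx => hq.pos x (List.mem_append_left _ hx)) h.pos_C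
      have h4 : heightAt i q.steps 1 = height i (A ++ act i B) := by
        rw [← q.dur_eq, heightAt_dur q.pos, ← hq.height_eq, height_append, hC.height_eq, add_zero]
      rw [h3] at h2
      rw [h4] at h1
      exact absurd h1 h2.not_gt
  · exact hC.asc hlam hc

/-- Since `p` has a predecessor, its minimum is negative; hence `A` is not of height zero
throughout, ends in a negative step, and absorbs the factor from the reflected block. -/
theorem Arrow.isLiftList_iff (hlam : D.IsDominant lam) {r p q : D.LSPath lam} (h : Arrow i p q)
    (hr : Arrow i r p) {v y : D.W} (hv : D.Asc i v ∨ ∃ q', Arrow i q q') :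
    IsLiftList v p.steps y ↔ IsLiftList v q.steps y := by
  obtain ⟨A, B, C, h, hp, hq⟩ := h.exists_cut hlam
  rw [← hp.isLiftList_iff, ← hq.isLiftList_iff]
  refine h.isLiftList_iff_of_endsNeg hlam ?_ (h.asc_of_isLiftList_C hlam hp hq hv)
  refine (allZero_or_endsNeg h.pos_A h.le_A).resolve_left fun hA => ?_
  have hpq := h.reflectsBetween hlam hp hq
  obtain ⟨a, b, hrp⟩ := hr.exists_reflectsBetween hlam
  have hb := hrp.nonneg.trans_lt hrp.lt
  have h1 := hrp.lt_left' 0 le_rfl hb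
  rw [p.heightAt_zero] at h1
  have h2 : heightAt i p.steps (dur A) = 0 := by
    rw [← hp.heightAt_eq hpq.nonneg, List.append_assoc, heightAt_append_dur h.pos_A, hA.height_eq]
    intro x hx
    exact hp.pos x (by simpa using .inr (List.mem_append.1 hx))
  rcases le_or_gt b (dur A) with h3 | h3
  · linarith [hpq.le_left b hb.le h3]
  · linarith [hpq.lt_right b h3 hrp.le_one]

theorem heightAt_nonneg_of_head (hlam : D.IsDominant lam) {h : D.LSPath lam}
    (hh : ∀ p, ¬Arrow i p h) (X : List (D.Step lam)) (hX : X <+: h.steps) : 0 ≤ height i X := by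
  by_contra h0
  obtain ⟨r, hr⟩ := exists_arrow_to hlam hX (not_le.1 h0)
  exact hh r hr

theorem asc_of_head (hlam : D.IsDominant lam) {h : D.LSPath lam} (hh : ∀ p, ¬Arrow i p h)
    {z w : D.W} (hz : D.Asc i z) (hw : IsLiftList z h.steps w) : D.Asc i w := by
  rcases allZero_or_startsPos h.pos (heightAt_nonneg_of_head hlam hh) with h0 | h0
  · exact h0.asc hz hw
  · exact h0.asc hlam hw

/-- For a head, `A` may consist of zero steps only, and then the lift may pick up a factor `sᵢ`.
Otherwise `A` starts upward, so the lift is an ascent, and ends downward, so it is preserved. -/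
theorem Arrow.isLiftList_of_head (hlam : D.IsDominant lam) {h q : D.LSPath lam} (hq : Arrow i h q)
    (hh : ∀ p, ¬Arrow i p h) {v : D.W} (hv : D.Asc i v ∨ ∃ q', Arrow i q q') :
    (∀ y, IsLiftList v h.steps y → D.Asc i y ∧
      (IsLiftList v q.steps y ∨ IsLiftList v q.steps (D.s i * y))) ∧
    ∀ x, IsLiftList v q.steps x → ∃ y, IsLiftList v h.steps y := by
  obtain ⟨A, B, C, hc, hp, hq⟩ := hq.exists_cut hlam
  have hC := hc.asc_of_isLiftList_C hlam hp hq hv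
  simp only [← hp.isLiftList_iff, ← hq.isLiftList_iff]
  have hBC : ∀ x ∈ B ++ C, 0 < x.1 := fun x hx =>
    hp.pos x (by simpa using .inr (List.mem_append.1 hx))
  rcases allZero_or_endsNeg hc.pos_A hc.le_A with hA | hA
  · exact hc.isLiftList_of_allZero hlam hA hC
  · have hA' : StartsPos i A := by
      refine (allZero_or_startsPos hc.pos_A fun X hX => ?_).resolve_left fun h0 => ?_
      · have h1 := le_heightAt h.pos (heightAt_nonneg_of_head hlam hh)
          (dur_nonneg fun x hx => hc.pos_A x (hX.subset hx))
        obtain ⟨Y, rfl⟩ := hX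
        have hX : ∀ x ∈ X, 0 < x.1 := fun x hx => hc.pos_A x (by simp [hx])
        rwa [← hp.heightAt_eq (dur_nonneg hX), List.append_assoc, List.append_assoc,
          heightAt_append_dur hX fun x hx => hp.pos x (by
            rw [List.append_assoc, List.append_assoc]; exact List.mem_append_right _ hx)] at h1
      · obtain ⟨L', x, Z, rfl, hx, -⟩ := hA
        exact hx.ne (h0 x (by simp))
    have key := fun y => hc.isLiftList_iff_of_endsNeg hlam hA (y := y) hC
    refine ⟨fun y hy => ⟨?_, .inl ((key y).1 hy)⟩, fun x hx => ⟨x, (key x).2 hx⟩⟩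
    rw [List.append_assoc] at hy
    obtain ⟨u, -, h2⟩ := isLiftList_append.1 hy
    exact hA'.asc hlam h2

theorem allZero_or_endsNeg_of_tail (hlam : D.IsDominant lam) {t : D.LSPath lam}
    (ht : ∀ p, ¬Arrow i t p) : AllZero i t.steps ∨ EndsNeg i t.steps := by
  refine allZero_or_endsNeg t.pos fun X hX => ?_
  by_contra h0
  obtain ⟨r, hr⟩ := exists_arrow_from hlam hX (not_le.1 h0)
  exact ht r hr

/-- A tail with a predecessor has negative minimum and attains it at its end, so its last step of
nonzero height is negative. -/
theorem isLiftList_s_mul_iff_of_tail (hlam : D.IsDominant lam) {r t : D.LSPath lam}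
    (ht : ∀ p, ¬Arrow i t p) (hr : Arrow i r t) {z y : D.W} (hz : D.Asc i z) :
    IsLiftList (D.s i * z) t.steps y ↔ IsLiftList z t.steps y := by
  rcases allZero_or_endsNeg_of_tail hlam ht with h0 | h0
  · exfalso
    obtain ⟨a, b, hr⟩ := hr.exists_reflectsBetween hlam
    have hb := hr.nonneg.trans_lt hr.lt
    have h1 := hr.lt_left' 0 le_rfl hb
    rw [t.heightAt_zero] at h1
    refine absurd h1 (not_lt.2 (le_heightAt t.pos (fun X hX => ?_) hb.le))
    exact (AllZero.height_eq fun x hx => h0 x (hX.subset hx)).ge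
  · exact h0.isLiftList_s_mul_iff hlam hz

theorem isLiftList_s_mul_of_tail (hlam : D.IsDominant lam) {t : D.LSPath lam}
    (ht : ∀ p, ¬Arrow i t p) {z w : D.W} (hz : D.Asc i z) (hw : IsLiftList z t.steps w) :
    IsLiftList (D.s i * z) t.steps w ∨ IsLiftList (D.s i * z) t.steps (D.s i * w) := by
  rcases allZero_or_endsNeg_of_tail hlam ht with h0 | h0
  · exact h0.isLiftList_s_mul hlam hz hw
  · exact .inl ((h0.isLiftList_s_mul_iff hlam hz).2 hw)

open Relation in
/-- The lifts are constant along the arrows that do not start at a head. -/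
theorem isLiftList_iff_of_reach (hlam : D.IsDominant lam) {r q p : D.LSPath lam}
    (h : ReflTransGen (Arrow i) q p) (hr : Arrow i r q) {v : D.W}
    (hv : D.Asc i v ∨ ∃ p', Arrow i p p') (x : D.W) :
    IsLiftList v q.steps x ↔ IsLiftList v p.steps x := by
  induction h using ReflTransGen.head_induction_on generalizing r with
  | refl => rfl
  | @head a c hac hcp ih =>
    rw [hac.isLiftList_iff hlam hr, ih hac]
    refine hv.imp_right fun ⟨p', hp'⟩ => ?_
    rcases ReflTransGen.cases_head hcp with rfl | ⟨d, hd, -⟩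
    · exact ⟨p', hp'⟩
    · exact ⟨d, hd⟩

/-- The lifts of `z` and `sᵢ z` along an `i`-string with at least two elements. -/
theorem IsString.exists_lifts (hlam : D.IsDominant lam) {S : Set (D.LSPath lam)}
    (hS : IsString i S) {h t : D.LSPath lam} (hh : IsHead i S h) (ht : IsTail i S t) (hht : h ≠ t)
    {z w : D.W} (hz : D.Asc i z) (hw : IsLiftList z h.steps w) :
    ∃ e, (e = w ∨ e = D.s i * w) ∧ (∀ p ∈ S, p ≠ h → IsLiftList z p.steps e) ∧
      IsLiftList (D.s i * z) t.steps e ∧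
      ((∀ p ∈ S, p ≠ t → ∀ x, ¬IsLiftList (D.s i * z) p.steps x) ∨
        ∃ y e', D.Asc i y ∧ (e' = y ∨ e' = D.s i * y) ∧ IsLiftList (D.s i * z) h.steps y ∧
          ∀ p ∈ S, p ≠ h → p ≠ t → IsLiftList (D.s i * z) p.steps e') := by
  obtain ⟨q, hq⟩ : ∃ q, Arrow i h q := by
    rcases Relation.ReflTransGen.cases_head (hS.reach_head hlam hh ht.1) with e | ⟨q, hq, -⟩
    · exact absurd e hht
    · exact ⟨q, hq⟩
  obtain ⟨r, hr⟩ : ∃ r, Arrow i r t := by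
    rcases Relation.ReflTransGen.cases_tail (hS.reach_head hlam hh ht.1) with e | ⟨q, -, hq⟩
    · exact absurd e.symm hht
    · exact ⟨q, hq⟩
  have hreach : ∀ p ∈ S, p ≠ h → Relation.ReflTransGen (Arrow i) q p := by
    intro p hp hph
    rcases Relation.ReflTransGen.cases_head (hS.reach_head hlam hh hp) with e | ⟨q', hq', h'⟩
    · exact absurd e.symm hph
    · rwa [hq.unique_right hlam hq']
  have hout : ∀ p ∈ S, p ≠ t → ∃ p', Arrow i p p' := by
    intro p hp hpt
    rcases Relation.ReflTransGen.cases_head (hS.reach_tail hlam ht hp) with e | ⟨q', hq', h'⟩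
    · exact absurd e hpt
    · exact ⟨q', hq'⟩
  have hzq := (hq.isLiftList_of_head hlam hh.2 (.inl hz)).1 w hw
  obtain ⟨e, he, hqe⟩ : ∃ e, (e = w ∨ e = D.s i * w) ∧ IsLiftList z q.steps e :=
    hzq.2.elim (fun h => ⟨_, .inl rfl, h⟩) fun h => ⟨_, .inr rfl, h⟩
  have hze : ∀ p ∈ S, p ≠ h → IsLiftList z p.steps e := fun p hp hph =>
    (isLiftList_iff_of_reach hlam (hreach p hp hph) hq (.inl hz) e).1 hqe
  refine ⟨e, he, hze, (isLiftList_s_mul_iff_of_tail hlam ht.2 hr hz).2 (hze t ht.1 hht.symm), ?_⟩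
  -- With only two paths there is no middle, and the arrow into the tail gives no control over `sᵢ
  -- z`. It is enough that the head rises, which makes the lift of `sᵢ z` there an ascent if it
  -- exists.
  by_cases hqt : q = t
  · have hmid : ∀ p ∈ S, p ≠ h → p = t := by
      intro p hp hph
      rcases Relation.ReflTransGen.cases_head (hreach p hp hph) with e | ⟨q', hq', -⟩
      · rw [← e, hqt]
      · exact absurd (hqt ▸ hq') (ht.2 q')
    by_cases hy : ∃ y, IsLiftList (D.s i * z) h.steps y
    · obtain ⟨y, hy⟩ := hy
      refine .inr ⟨y, y, ?_, .inl rfl, hy, fun p hp hph hpt => absurd (hmid p hp hph) hpt⟩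
      rcases allZero_or_startsPos h.pos (heightAt_nonneg_of_head hlam hh.2) with h0 | h0
      · exfalso
        obtain ⟨a, b, hab⟩ := hq.exists_reflectsBetween hlam
        have h1 := hab.lt_right 1 (hab.lt.trans_le hab.le_one) le_rfl
        rw [← h.dur_eq, heightAt_dur h.pos, h0.height_eq] at h1
        exact absurd h1 (not_lt.2 (le_heightAt h.pos (heightAt_nonneg_of_head hlam hh.2) hab.nonneg))
      · exact h0.asc hlam hy
    · left
      intro p hp hpt x hx
      by_cases hph : p = h
      · exact hy ⟨x, hph ▸ hx⟩
      · exact hpt (hmid p hp hph)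
  · have hqS : q ∈ S := (hS.mem_of_arrow hq).1 hh.1
    -- Although `sᵢ z` is not an ascent, `q` has an outgoing arrow, and this is all the head
    -- argument needs.
    obtain ⟨k1, k2⟩ := hq.isLiftList_of_head hlam hh.2 (v := D.s i * z) (.inr (hout q hqS hqt))
    have key : ∀ p ∈ S, p ≠ h → p ≠ t → ∀ x, IsLiftList (D.s i * z) q.steps x ↔
        IsLiftList (D.s i * z) p.steps x := fun p hp hph hpt =>
      isLiftList_iff_of_reach hlam (hreach p hp hph) hq (.inr (hout p hp hpt))
    by_cases hy : ∃ y, IsLiftList (D.s i * z) h.steps y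
    · obtain ⟨y, hy⟩ := hy
      obtain ⟨hya, hy'⟩ := k1 y hy
      refine .inr ⟨y, ?_⟩
      rcases hy' with hy' | hy'
      · exact ⟨y, hya, .inl rfl, hy, fun p hp hph hpt => (key p hp hph hpt _).1 hy'⟩
      · exact ⟨_, hya, .inr rfl, hy, fun p hp hph hpt => (key p hp hph hpt _).1 hy'⟩
    · left
      intro p hp hpt x hx
      by_cases hph : p = h
      · exact hy ⟨x, hph ▸ hx⟩
      · exact hy (k2 x ((key p hp hph hpt x).2 hx))

end StringLifts
-- Subsets of a string described by head, tail and middle.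
section ThreePart
variable {α : Type*} {S : Set α} {h t : α}

/-- The subset of `S` which contains `h` if `a`, `t` if `b`, and all other elements of `S` if `c`. -/
def threePart (S : Set α) (h t : α) (a b c : Prop) : Set α :=
  {p ∈ S | (p = h ∧ a) ∨ (p = t ∧ b) ∨ (p ≠ h ∧ p ≠ t ∧ c)}

/-- Turns each equality of sets in the chart into three equivalences of propositions; the one for
the middle counts only if the middle is inhabited. -/
theorem threePart_eq_iff (hh : h ∈ S) (ht : t ∈ S) (hht : h ≠ t) {a b c a' b' c' : Prop} :
    threePart S h t a b c = threePart S h t a' b' c' ↔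
      (a ↔ a') ∧ (b ↔ b') ∧ ((∃ p ∈ S, p ≠ h ∧ p ≠ t) → (c ↔ c')) := by
  constructor
  · intro e
    have key : ∀ p, p ∈ threePart S h t a b c ↔ p ∈ threePart S h t a' b' c' := fun p => by rw [e]
    refine ⟨?_, ?_, ?_⟩
    · simpa [threePart, hh, hht] using key h
    · simpa [threePart, ht, hht.symm] using key t
    · rintro ⟨p, hp, h1, h2⟩
      simpa [threePart, hp, h1, h2] using key p
  · rintro ⟨h1, h2, h3⟩
    ext p
    simp only [threePart, Set.mem_ofPred_eq]
    refine and_congr_right fun hp => ?_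
    rw [h1, h2]
    refine or_congr_right (or_congr_right (and_congr_right fun ph => and_congr_right fun pt => ?_))
    exact h3 ⟨p, hp, ph, pt⟩

theorem eq_threePart_of_mem_iff {P : Set α} {a b c : Prop} (hP : P ⊆ S) (h1 : h ∈ S → (h ∈ P ↔ a))
    (h2 : t ∈ S → (t ∈ P ↔ b)) (h3 : ∀ p ∈ S, p ≠ h → p ≠ t → (p ∈ P ↔ c)) :
    P = threePart S h t a b c := by
  ext p
  by_cases hp : p ∈ S
  · by_cases e1 : p = h
    · subst e1
      by_cases e2 : p = t
      · subst e2
        have := h1 hp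
        have := h2 hp
        simp only [threePart, Set.mem_ofPred_eq]
        tauto
      · simp [threePart, hp, e2, h1 hp]
    · by_cases e2 : p = t
      · subst e2
        simp [threePart, hp, e1, h2 hp]
      · simp [threePart, hp, e1, e2, h3 p hp e1 e2]
  · exact iff_of_false (fun h => hp (hP h)) fun h => hp h.1

theorem two_le_encard (hh : h ∈ S) (ht : t ∈ S) (hht : h ≠ t) : 2 ≤ S.encard := by
  rw [← Set.encard_pair hht]
  exact Set.encard_le_encard (Set.insert_subset hh (Set.singleton_subset_iff.2 ht))

theorem three_le_encard_iff (hh : h ∈ S) (ht : t ∈ S) (hht : h ≠ t) :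
    3 ≤ S.encard ↔ ∃ p ∈ S, p ≠ h ∧ p ≠ t := by
  constructor
  · intro h3
    by_contra! hne
    have : S ⊆ {h, t} := fun p hp => by
      by_cases e : p = h
      · exact .inl e
      · exact .inr (hne p hp e)
    have := h3.trans ((Set.encard_le_encard this).trans_eq (Set.encard_pair hht))
    exact absurd this (by norm_num)
  · rintro ⟨p, hp, h1, h2⟩
    have : ({p, h, t} : Set α) ⊆ S := by
      rintro q (rfl | rfl | rfl) <;> assumption
    refine le_trans ?_ (Set.encard_le_encard this)
    rw [Set.encard_insert_of_notMem (by simp [h1, h2]), Set.encard_pair hht]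
    norm_num

end ThreePart

/-! ### The pattern of lifts and the chart. -/

section Chart
variable {I Λ : Type*} [AddCommGroup Λ] {D : RootDatum I Λ} {lam : Λ} {i : I}

theorem Asc.ne_s_mul {x w : D.W} (hx : D.Asc i x) (hw : D.Asc i w) : x ≠ D.s i * w := by
  rintro rfl
  exact hw.not_asc hx

theorem s_mul_eq_iff {x w : D.W} : D.s i * x = D.s i * w ↔ x = w := mul_right_inj _

theorem Asc.eq_iff_of_mem {x w e : D.W} (hx : D.Asc i x) (hw : D.Asc i w)
    (he : e = w ∨ e = D.s i * w) : (x = e ↔ x = w ∧ e = w) ∧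
      (D.s i * x = e ↔ x = w ∧ e ≠ w) := by
  have h1 := hx.ne_s_mul hw
  have h2 := hw.ne_s_mul hx
  have h3 := hw.ne_s_mul hw
  rcases he with rfl | rfl
  · exact ⟨by tauto, iff_of_false h2.symm (by tauto)⟩
  · refine ⟨iff_of_false h1 (fun h => h3 h.2.symm), ?_⟩
    rw [s_mul_eq_iff]
    exact ⟨fun h => ⟨h, h3.symm⟩, And.left⟩

/-- The lifts of `z` and `sᵢ z` along a set of paths with distinct head `h` and tail `t`: those of
`z` are `w` at `h` and `e` elsewhere; those of `sᵢ z` are `e` at `t` and, if `Y` holds, `y` at `h`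
and `e'` elsewhere. -/
structure LiftPattern (i : I) (S : Set (D.LSPath lam)) (h t : D.LSPath lam) (z w e y e' : D.W)
    (Y : Prop) : Prop where
  head_mem : h ∈ S
  tail_mem : t ∈ S
  head_ne_tail : h ≠ t
  asc_w : D.Asc i w
  asc_y : D.Asc i y
  e_mem : e = w ∨ e = D.s i * w
  e'_mem : e' = y ∨ e' = D.s i * y
  lift_head : ∀ x, h.IsLift z x ↔ x = w
  lift : ∀ p ∈ S, p ≠ h → ∀ x, p.IsLift z x ↔ x = e
  lift_s_tail : ∀ x, t.IsLift (D.s i * z) x ↔ x = e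
  lift_s_head : ∀ x, h.IsLift (D.s i * z) x ↔ Y ∧ x = y
  lift_s : ∀ p ∈ S, p ≠ h → p ≠ t → ∀ x, p.IsLift (D.s i * z) x ↔ Y ∧ x = e'

theorem IsString.exists_liftPattern (hlam : D.IsDominant lam) {S : Set (D.LSPath lam)}
    (hS : IsString i S) {h t : D.LSPath lam} (hh : IsHead i S h) (ht : IsTail i S t) (hht : h ≠ t)
    {z w : D.W} (hz : D.Asc i z) (hw : IsLiftList z h.steps w) :
    ∃ e y e' Y, LiftPattern i S h t z w e y e' Y := by
  have hwa := asc_of_head hlam hh.2 hz hw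
  obtain ⟨e, he, h1, h2, h3⟩ := hS.exists_lifts hlam hh ht hht hz hw
  have uniq : ∀ {p : D.LSPath lam} {v u : D.W}, IsLiftList v p.steps u →
      ∀ x, p.IsLift v x ↔ x = u := fun hu x => by
    rw [LSPath.isLift_iff hlam]
    exact ⟨fun hx => hx.unique hu, fun hx => hx ▸ hu⟩
  rcases h3 with h3 | ⟨y, e', hy, he', hyl, hel⟩
  -- No lift of `sᵢ z` exists away from the tail, so `y` and `e'` are placeholders, both taken to be
  -- `w`.
  · refine ⟨e, w, w, False, hh.1, ht.1, hht, hwa, hwa, he, .inl rfl, uniq hw,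
      fun p hp hph => uniq (h1 p hp hph), uniq h2, fun x => ?_, fun p hp _ hpt x => ?_⟩
    · rw [LSPath.isLift_iff hlam]
      exact iff_of_false (h3 h hh.1 hht x) (fun h => h.1)
    · rw [LSPath.isLift_iff hlam]
      exact iff_of_false (h3 p hp hpt x) (fun h => h.1)
  · refine ⟨e, y, e', True, hh.1, ht.1, hht, hwa, hy, he, he', uniq hw,
      fun p hp hph => uniq (h1 p hp hph), uniq h2, fun x => ?_, fun p hp hph hpt x => ?_⟩
    · rw [uniq hyl, true_and]
    · rw [uniq (hel p hp hph hpt), true_and]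

namespace LiftPattern

variable {S : Set (D.LSPath lam)} {h t : D.LSPath lam} {z w e y e' : D.W} {Y : Prop}

theorem upSet_eq (H : LiftPattern i S h t z w e y e' Y) (x : D.W) :
    upSet S x z = threePart S h t (x = w) (x = e) (x = e) := by
  refine eq_threePart_of_mem_iff (fun p hp => hp.1) (fun hp => ?_) (fun hp => ?_)
    fun p hp h1 h2 => ?_
  · exact (and_iff_right hp).trans (H.lift_head x)
  · exact (and_iff_right hp).trans (H.lift t hp H.head_ne_tail.symm x)
  · exact (and_iff_right hp).trans (H.lift p hp h1 x)

theorem upSet_s_eq (H : LiftPattern i S h t z w e y e' Y) (x : D.W) :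
    upSet S x (D.s i * z) = threePart S h t (Y ∧ x = y) (x = e) (Y ∧ x = e') := by
  refine eq_threePart_of_mem_iff (fun p hp => hp.1) (fun hp => ?_) (fun hp => ?_)
    fun p hp h1 h2 => ?_
  · exact (and_iff_right hp).trans (H.lift_s_head x)
  · exact (and_iff_right hp).trans (H.lift_s_tail x)
  · exact (and_iff_right hp).trans (H.lift_s p hp h1 h2 x)

/-- The conditions on an ascent `x` that put it into the columns of the chart. -/
theorem inCase_iff (H : LiftPattern i S h t z w e y e' Y) {x : D.W} (hx : D.Asc i x) :
    (AllEmpty i S z x ↔ x ≠ w ∧ ¬(Y ∧ x = y)) ∧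
    ∀ c, InCase i S h t z x c ↔ match c with
      | .U11 => x = w ∧ e = w ∧ ¬(Y ∧ x = y)
      | .U12 => x = w ∧ e = w ∧ (Y ∧ x = y) ∧ ((∃ p ∈ S, p ≠ h ∧ p ≠ t) → e' = y)
      | .U13 => x = w ∧ e = w ∧ (Y ∧ x = y) ∧ e' ≠ y ∧ ∃ p ∈ S, p ≠ h ∧ p ≠ t
      | .U21 => x = w ∧ e ≠ w ∧ ¬(Y ∧ x = y)
      | .U22 => x = w ∧ e ≠ w ∧ (Y ∧ x = y) ∧ ((∃ p ∈ S, p ≠ h ∧ p ≠ t) → e' ≠ y)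
      | .U23 => x = w ∧ e ≠ w ∧ (Y ∧ x = y) ∧ e' = y ∧ ∃ p ∈ S, p ≠ h ∧ p ≠ t
      | .U31 => x ≠ w ∧ (Y ∧ x = y) ∧ ((∃ p ∈ S, p ≠ h ∧ p ≠ t) → e' = y)
      | .U32 => x ≠ w ∧ (Y ∧ x = y) ∧ e' ≠ y ∧ ∃ p ∈ S, p ≠ h ∧ p ≠ t := by
  have hhS := H.head_mem
  have htS := H.tail_mem
  have hht := H.head_ne_tail
  have key : ∀ {P : Set (D.LSPath lam)} {a' b' c' : Prop}, P = threePart S h t a' b' c' →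
      ∀ a b c : Prop, threePart S h t a b c = P ↔
        (a ↔ a') ∧ (b ↔ b') ∧ ((∃ p ∈ S, p ≠ h ∧ p ≠ t) → (c ↔ c')) :=
    fun hP a b c => hP ▸ threePart_eq_iff hhS htS hht
  have s1 := key (P := S) (a' := True) (b' := True) (c' := True) <|
    eq_threePart_of_mem_iff subset_rfl (by simp) (by simp) (by simp +contextual)
  have s2 := key (P := ∅) (a' := False) (b' := False) (c' := False) <|
    eq_threePart_of_mem_iff (by simp) (by simp) (by simp) (by simp)
  have s3 := key (P := {h}) (a' := True) (b' := False) (c' := False) <|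
    eq_threePart_of_mem_iff (by simpa) (by simp) (by simp [hht.symm]) (by simp +contextual)
  have s4 := key (P := {t}) (a' := False) (b' := True) (c' := False) <|
    eq_threePart_of_mem_iff (by simpa) (by simp [hht]) (by simp) (by simp +contextual)
  have s5 := key (P := {h, t}) (a' := True) (b' := True) (c' := False) <|
    eq_threePart_of_mem_iff (Set.insert_subset hhS (by simpa)) (by simp) (by simp)
      (by simp +contextual)
  have s6 := key (P := S \ {h}) (a' := False) (b' := True) (c' := True) <|
    eq_threePart_of_mem_iff Set.sdiff_subset (by simp) (by simp [hht.symm]) (by simp +contextual)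
  have s7 := key (P := S \ {t}) (a' := True) (b' := False) (c' := True) <|
    eq_threePart_of_mem_iff Set.sdiff_subset (by simp [hht]) (by simp) (by simp +contextual)
  have s8 := key (P := S \ {h, t}) (a' := False) (b' := False) (c' := True) <|
    eq_threePart_of_mem_iff Set.sdiff_subset (by simp) (by simp) (by simp +contextual)
  have c2 := two_le_encard hhS htS hht
  have c1 : 1 ≤ S.encard := le_trans (by norm_num) c2
  have c3 := three_le_encard_iff hhS htS hht
  obtain ⟨e1, e2⟩ := hx.eq_iff_of_mem H.asc_w H.e_mem
  obtain ⟨e3, e4⟩ := hx.eq_iff_of_mem H.asc_y H.e'_mem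
  have e5 : D.s i * x ≠ w := (H.asc_w.ne_s_mul hx).symm
  have e6 : D.s i * x ≠ y := (H.asc_y.ne_s_mul hx).symm
  clear key
  -- From here on only truth values matter: whether the middle is inhabited, `x = w`, `Y ∧ x = y`,
  -- `e = w` and `e' = y`.
  generalize (∃ p ∈ S, p ≠ h ∧ p ≠ t) = M at *
  refine ⟨?_, fun c => ?_⟩
  · simp only [AllEmpty, H.upSet_eq, H.upSet_s_eq, s2, e1, e2, e3, e4, e5, e6]
    by_cases k1 : x = w <;> by_cases k2 : Y ∧ x = y <;> by_cases k3 : e = w <;>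
      by_cases k4 : e' = y <;> by_cases k5 : M <;> simp [k1, k2, k3, k4, k5]
  · cases c <;> simp only [InCase, H.upSet_eq, H.upSet_s_eq, s1, s2, s3, s4, s5, s6, s7, s8, c1, c2,
      c3, e1, e2, e3, e4, e5, e6, ← and_assoc (a := Y), ne_eq]
    all_goals
      clear * -
      generalize (x = w) = a
      generalize (Y ∧ x = y) = b
      generalize (e = w) = c
      generalize (e' = y) = d
      by_cases a <;> by_cases b <;> by_cases c <;> by_cases d <;> by_cases M <;> simp [*]

/-- The eight formulas of `inCase_iff` partition the truth assignments with `x = w` or `Y ∧ x = y`;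
an empty middle together with `Y ∧ x = y` falls under `U12`, `U22` or `U31`. -/
theorem inCase_unique (H : LiftPattern i S h t z w e y e' Y) {x : D.W} (hx : D.Asc i x) :
    ((∃! c, InCase i S h t z x c) ∧ ¬AllEmpty i S z x) ∨
      ((∀ c, ¬InCase i S h t z x c) ∧ AllEmpty i S z x) := by
  obtain ⟨h1, h2⟩ := H.inCase_iff hx
  simp only [h1, h2]
  clear h1 h2
  generalize (∃ p ∈ S, p ≠ h ∧ p ≠ t) = M
  by_cases ha : x = w ∨ (Y ∧ x = y)
  · refine .inl ⟨?_, by tauto⟩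
    apply existsUnique_of_exists_of_unique
    · by_cases a : x = w
      · by_cases c : e = w
        · by_cases b : Y ∧ x = y
          · by_cases d : M → e' = y
            · exact ⟨.U12, a, c, b, d⟩
            · exact ⟨.U13, a, c, b, by tauto⟩
          · exact ⟨.U11, a, c, b⟩
        · by_cases b : Y ∧ x = y
          · by_cases d : M → e' ≠ y
            · exact ⟨.U22, a, c, b, d⟩
            · exact ⟨.U23, a, c, b, by tauto⟩
          · exact ⟨.U21, a, c, b⟩
      · by_cases d : M → e' = y
        · exact ⟨.U31, a, by tauto, d⟩
        · exact ⟨.U32, a, by tauto, by tauto⟩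
    · intro c c' k1 k2
      cases c <;> cases c' <;> first | rfl | (exfalso; dsimp only at k1 k2; tauto)
  · exact .inr ⟨fun c => by cases c <;> dsimp only <;> tauto, by tauto⟩

/-- The head decides: its lift `y` is an ascent, so it belongs to `{w, sᵢ w}` only if it equals `w`,
and then all the other lifts follow. -/
theorem lift1_iff (H : LiftPattern i S h t z w e y e' Y) : Lift1 i S z w ↔ Y ∧ y = w := by
  constructor
  · intro hl
    have k := hl h H.head_mem
    rw [LiftMem, H.lift_s_head, H.lift_s_head] at k
    rcases k with k | k
    · exact ⟨k.1, k.2.symm⟩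
    · exact absurd k.2.symm (H.asc_y.ne_s_mul H.asc_w)
  · rintro ⟨hY, rfl⟩ p hp
    rw [LiftMem]
    by_cases e1 : p = t
    · subst e1
      rw [H.lift_s_tail, H.lift_s_tail]
      exact H.e_mem.imp Eq.symm Eq.symm
    · by_cases e2 : p = h
      · subst e2
        exact .inl ((H.lift_s_head _).2 ⟨hY, rfl⟩)
      · rw [H.lift_s p hp e2 e1, H.lift_s p hp e2 e1]
        exact H.e'_mem.imp (⟨hY, ·.symm⟩) (⟨hY, ·.symm⟩)

theorem liftMem_s_tail (H : LiftPattern i S h t z w e y e' Y) : LiftMem i t (D.s i * z) w := by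
  rw [LiftMem, H.lift_s_tail, H.lift_s_tail]
  exact H.e_mem.imp Eq.symm Eq.symm

theorem lift2_iff (H : LiftPattern i S h t z w e y e' Y) (hlam : D.IsDominant lam) :
    Lift2 i S t z w ↔ ¬Y := by
  rw [Lift2, and_iff_right H.liftMem_s_tail]
  simp only [LSPath.cosetLe_final_iff hlam, ← LSPath.isLift_iff hlam]
  constructor
  · exact fun hl hY => hl h ⟨H.head_mem, H.head_ne_tail⟩ ⟨y, (H.lift_s_head y).2 ⟨hY, rfl⟩⟩
  · rintro hY p ⟨hp, hpt⟩ ⟨x, hx⟩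
    by_cases e1 : p = h
    · subst e1
      exact hY ((H.lift_s_head x).1 hx).1
    · exact hY ((H.lift_s p hp e1 hpt x).1 hx).1

theorem lift3_iff (H : LiftPattern i S h t z w e y e' Y) {x : D.W} :
    Lift3 i S t z w x ↔ Y ∧ x = y ∧ y ≠ w := by
  rw [Lift3, and_iff_right H.liftMem_s_tail, lt_s_mul_iff]
  constructor
  · rintro ⟨h1, -, hx, hl⟩
    have k := hl h ⟨H.head_mem, H.head_ne_tail⟩
    rw [LiftMem, H.lift_s_head, H.lift_s_head] at k
    rcases k with k | k
    · exact ⟨k.1, k.2, k.2 ▸ h1⟩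
    · exact absurd k.2.symm (H.asc_y.ne_s_mul hx)
  · rintro ⟨hY, rfl, hxw⟩
    refine ⟨hxw, H.asc_y.ne_s_mul H.asc_w, H.asc_y, ?_⟩
    rintro p ⟨hp, hpt⟩
    rw [LiftMem]
    by_cases e2 : p = h
    · subst e2
      exact .inl ((H.lift_s_head _).2 ⟨hY, rfl⟩)
    · rw [H.lift_s p hp e2 hpt, H.lift_s p hp e2 hpt]
      exact H.e'_mem.imp (⟨hY, ·.symm⟩) (⟨hY, ·.symm⟩)

theorem liftMem (H : LiftPattern i S h t z w e y e' Y) {p : D.LSPath lam} (hp : p ∈ S) :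
    LiftMem i p z w := by
  rw [LiftMem]
  by_cases e1 : p = h
  · subst e1
    exact .inl ((H.lift_head w).2 rfl)
  · rw [H.lift p hp e1, H.lift p hp e1]
    exact H.e_mem.imp Eq.symm Eq.symm

end LiftPattern

section Singleton
variable {h : D.LSPath lam} {z w e : D.W}

theorem upSet_singleton {v u : D.W} (hu : ∀ x, h.IsLift v x ↔ x = u) (x : D.W) :
    upSet {h} x v = {p ∈ ({h} : Set (D.LSPath lam)) | x = u} := by
  ext p
  constructor
  · rintro ⟨rfl, hp⟩
    exact ⟨rfl, (hu x).1 hp⟩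
  · rintro ⟨rfl, hp⟩
    exact ⟨rfl, (hu x).2 hp⟩

/-- The chart for a string with a single element. -/
theorem inCase_singleton_iff (hw : D.Asc i w) (he : e = w ∨ e = D.s i * w)
    (h1 : ∀ x, h.IsLift z x ↔ x = w) (h2 : ∀ x, h.IsLift (D.s i * z) x ↔ x = e) {x : D.W}
    (hx : D.Asc i x) : (AllEmpty i {h} z x ↔ x ≠ w) ∧
      ∀ c, InCase i {h} h h z x c ↔ match c with
        | .U11 => x = w ∧ e = w
        | .U21 => x = w ∧ e ≠ w
        | _ => False := by
  obtain ⟨e1, e2⟩ := hx.eq_iff_of_mem hw he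
  have e5 : D.s i * x ≠ w := (hw.ne_s_mul hx).symm
  have s1 : ∀ a : Prop, {p ∈ ({h} : Set (D.LSPath lam)) | a} = {h} ↔ a := fun a => by
    by_cases a <;> simp_all [Set.ext_iff]
  have s2 : ∀ a : Prop, {p ∈ ({h} : Set (D.LSPath lam)) | a} = ∅ ↔ ¬a := fun a => by
    by_cases a <;> simp_all [Set.ext_iff]
  have n2 : ¬(2 : ℕ∞) ≤ 1 := by norm_num
  have n3 : ¬(3 : ℕ∞) ≤ 1 := by norm_num
  refine ⟨?_, fun c => ?_⟩
  · simp only [AllEmpty, upSet_singleton h1, upSet_singleton h2, s2, e1, e2, e5]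
    tauto
  · cases c <;> simp only [InCase, upSet_singleton h1, upSet_singleton h2, s1, s2, e1, e2, e5,
      Set.encard_singleton, n2, n3, sdiff_self, Set.bot_eq_empty, le_refl] <;> tauto

end Singleton
end Chart
end RootDatum
end KacMoody

/-! ### Assembly of the proposition. -/

theorem proposition3p4 {I Λ : Type*} [Finite I] [AddCommGroup Λ] [Module.Free ℤ Λ]
    [Module.Finite ℤ Λ] (D : KacMoody.RootDatum I Λ) (lam : Λ) (hlam : D.IsDominant lam)
    (i : I) (S : Set (D.LSPath lam)) (hS : KacMoody.RootDatum.IsString i S)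
    (h t : D.LSPath lam) (hh : KacMoody.RootDatum.IsHead i S h)
    (ht : KacMoody.RootDatum.IsTail i S t)
    (z : D.W) (hz : D.Lt z (D.s i * z)) (hzh : D.CosetLe lam (D.coset lam z) h.final) :
    ∃ w : D.W, h.IsLift z w ∧ D.Lt w (D.s i * w) ∧
      -- the lifts of `z`
      (∀ p ∈ S, KacMoody.RootDatum.LiftMem i p z w) ∧
      -- the three cases for the lifts of `sz`; they merge if `S` is a single path
      (S.encard = 1 → KacMoody.RootDatum.Lift1 i S z w ∧ KacMoody.RootDatum.Lift2 i S t z w) ∧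
      (2 ≤ S.encard →
        (KacMoody.RootDatum.Lift1 i S z w ∨ KacMoody.RootDatum.Lift2 i S t z w ∨
          ∃ w', KacMoody.RootDatum.Lift3 i S t z w w') ∧
        ¬ (KacMoody.RootDatum.Lift1 i S z w ∧ KacMoody.RootDatum.Lift2 i S t z w) ∧
        ¬ (KacMoody.RootDatum.Lift1 i S z w ∧ ∃ w', KacMoody.RootDatum.Lift3 i S t z w w') ∧
        ¬ (KacMoody.RootDatum.Lift2 i S t z w ∧
          ∃ w', KacMoody.RootDatum.Lift3 i S t z w w')) ∧
      -- the chart: its columns exclude each other and cover all nonempty possibilities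
      (∀ x : D.W, D.Lt x (D.s i * x) →
        ((∃! c, KacMoody.RootDatum.InCase i S h t z x c) ∧
          ¬ KacMoody.RootDatum.AllEmpty i S z x) ∨
        ((∀ c, ¬ KacMoody.RootDatum.InCase i S h t z x c) ∧
          KacMoody.RootDatum.AllEmpty i S z x)) ∧
      -- how the columns correspond to the three cases
      (S.encard = 1 → KacMoody.RootDatum.InCase i S h t z w .U11 ∨
        KacMoody.RootDatum.InCase i S h t z w .U21) ∧
      (2 ≤ S.encard →
        (KacMoody.RootDatum.Lift1 i S z w ↔
          KacMoody.RootDatum.InCase i S h t z w .U12 ∨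
          KacMoody.RootDatum.InCase i S h t z w .U13 ∨
          KacMoody.RootDatum.InCase i S h t z w .U22 ∨
          KacMoody.RootDatum.InCase i S h t z w .U23) ∧
        ((KacMoody.RootDatum.Lift2 i S t z w ∨
            ∃ w', KacMoody.RootDatum.Lift3 i S t z w w') ↔
          KacMoody.RootDatum.InCase i S h t z w .U11 ∨
          KacMoody.RootDatum.InCase i S h t z w .U21) ∧
        (∀ x : D.W, D.Lt x (D.s i * x) →
          (KacMoody.RootDatum.Lift3 i S t z w x ↔
            KacMoody.RootDatum.InCase i S h t z x .U31 ∨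
            KacMoody.RootDatum.InCase i S h t z x .U32))) := by
  open KacMoody KacMoody.RootDatum in
  have hza := lt_s_mul_iff.1 hz
  obtain ⟨w, hw⟩ := (LSPath.cosetLe_final_iff hlam).1 hzh
  have hwa : D.Asc i w := asc_of_head hlam hh.2 hza hw
  refine ⟨w, (LSPath.isLift_iff hlam).2 hw, lt_s_mul_iff.2 hwa, ?_⟩
  simp only [lt_s_mul_iff]
  -- Head and tail coincide exactly for one-element strings, where `lift_s_tail` and `lift_s_head`
  -- would conflict; the lift pattern is used only when they differ.
  by_cases hht : h = t
  · subst hht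
    obtain rfl : S = {h} := by
      ext p
      refine ⟨fun hp => ?_, fun hp => hp ▸ hh.1⟩
      rcases Relation.ReflTransGen.cases_head (hS.reach_head hlam hh hp) with e | ⟨q, hq, -⟩
      · exact e.symm
      · exact absurd hq (ht.2 q)
    obtain ⟨e, he, hel⟩ : ∃ e, (e = w ∨ e = D.s i * w) ∧ IsLiftList (D.s i * z) h.steps e :=
      (isLiftList_s_mul_of_tail hlam ht.2 hza hw).elim (fun k => ⟨_, .inl rfl, k⟩)
        fun k => ⟨_, .inr rfl, k⟩
    have k1 : ∀ x, h.IsLift z x ↔ x = w := fun x => by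
      rw [LSPath.isLift_iff hlam]
      exact ⟨fun hx => hx.unique hw, fun hx => hx ▸ hw⟩
    have k2 : ∀ x, h.IsLift (D.s i * z) x ↔ x = e := fun x => by
      rw [LSPath.isLift_iff hlam]
      exact ⟨fun hx => hx.unique hel, fun hx => hx ▸ hel⟩
    have k3 : LiftMem i h (D.s i * z) w := by
      rw [LiftMem, k2, k2]
      exact he.imp Eq.symm Eq.symm
    have key := fun {x} => inCase_singleton_iff (x := x) hwa he k1 k2
    have hcard : ¬2 ≤ ({h} : Set (D.LSPath lam)).encard := by
      rw [Set.encard_singleton]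
      norm_num
    refine ⟨?_, fun _ => ⟨?_, k3, ?_⟩, fun hc => absurd hc hcard, fun x hx => ?_, fun _ => ?_,
      fun hc => absurd hc hcard⟩
    · rintro p rfl
      exact .inl ((k1 w).2 rfl)
    · rintro p rfl
      exact k3
    · rintro p ⟨hp, hp'⟩
      exact absurd hp hp'
    · rw [(key hx).1]
      simp only [(key hx).2]
      by_cases a : x = w
      · refine .inl ⟨?_, not_not.2 a⟩
        by_cases c : e = w
        · exact ⟨.U11, ⟨a, c⟩, fun c' h' => by cases c' <;> simp_all⟩
        · exact ⟨.U21, ⟨a, c⟩, fun c' h' => by cases c' <;> simp_all⟩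
      · exact .inr ⟨fun c => by cases c <;> simp [a], a⟩
    · rw [(key hwa).2, (key hwa).2]
      by_cases c : e = w <;> simp [c]
  · obtain ⟨e, y, e', Y, H⟩ := hS.exists_liftPattern hlam hh ht hht hza hw
    have hcard : S.encard ≠ 1 := fun hc => by
      have := two_le_encard H.head_mem H.tail_mem hht
      rw [hc] at this
      exact absurd this (by norm_num)
    have hc := (H.inCase_iff hwa).2
    refine ⟨fun p hp => H.liftMem hp, fun k => absurd k hcard, fun _ => ?_,
      fun x hx => H.inCase_unique hx, fun k => absurd k hcard, fun _ => ⟨?_, ?_, fun x hx => ?_⟩⟩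
    · simp only [H.lift1_iff, H.lift2_iff hlam, H.lift3_iff]
      by_cases a : Y <;> by_cases b : y = w <;> simp [a, b]
    · rw [H.lift1_iff, hc, hc, hc, hc]
      dsimp only
      rw [eq_comm (a := w) (b := y)]
      generalize (∃ p ∈ S, p ≠ h ∧ p ≠ t) = M
      simp only [ne_eq]
      generalize (e' = y) = N
      by_cases a : Y <;> by_cases b : y = w <;> by_cases c : e = w <;> by_cases d : N <;>
        by_cases m : M <;> simp [a, b, c, d, m]
    · simp only [H.lift2_iff hlam, H.lift3_iff, hc]
      rw [eq_comm (a := w) (b := y)]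
      by_cases a : Y <;> by_cases b : y = w <;> by_cases c : e = w <;> simp [a, b, c]
    · rw [H.lift3_iff, (H.inCase_iff hx).2, (H.inCase_iff hx).2]
      dsimp only
      by_cases a : x = y
      · subst a
        tauto
      · simp [a]
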